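/- Let $M$ be a smooth manifold of dimension $m$ without boundary (Hausdorff, second countable), let $\mathbb K=\mathbb R$ or $\mathbb C$, and let $E\to M$ be a smooth $\mathbb K$-vector bundle of finite rank. For a smooth ($\mathbb K$-linear) connection $\nabla$ on $E$ let $D$ be the exterior covariant derivative on $\operatorname{End}(E)$-valued forms for the induced connection, $$(D\lambda)(X_0,\dots,X_p)=\sum_i(-1)^i\nabla_{X_i}\bigl(\lambda(X_0,\dots,\widehat{X_i},\dots,X_p)\bigr)+\sum_{i<j}(-1)^{i+j}\lambda([X_i,X_j],X_0,\dots,\widehat{X_i},\dots,\widehat{X_j},\dots,X_p),$$ let $\Omega=\Omega_\nabla$, $\Omega(X,Y)=\nabla_X\nabla_Y-\nabla_Y\nabla_X-\nabla_{[X,Y]}$, be the curvature, an $\operatorname{End}(E)$-valued $2$-form, and let $\Omega^k=\Omega\wedge\dots\wedge\Omega$ ($k$ factors, $\Omega^0=\mathrm{Id}$), where the exterior product of $\operatorname{End}(E)$-valued forms uses composition of endomorphisms and the convention $(\alpha\wedge\beta)(v_1,\dots,v_{p+q})=\sum_{\sigma}\operatorname{sgn}(\sigma)\,\alpha(v_{\sigma(1)},\dots,v_{\sigma(p)})\,\beta(v_{\sigma(p+1)},\dots,v_{\sigma(p+q)})$,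 summed over the $(p,q)$-shuffles. The $k$-th Chern form of $\nabla$ is the $\mathbb K$-valued $2k$-form $\operatorname{tr}(\Omega^k)$. Then: 1. For every smooth connection and every smooth $\operatorname{End}(E)$-valued $p$-form $\lambda$, the form $\operatorname{tr}\lambda$ is smooth and $\operatorname{tr}(D\lambda)=d(\operatorname{tr}\lambda)$. 2. For every smooth connection and every $k\ge 0$ the Chern form $\operatorname{tr}(\Omega^k)$ is smooth and closed. 3. For any two smooth connections $\nabla,\nabla'$ on $E$ and every $k\geq 0$ the form $\operatorname{tr}(\Omega_{\nabla'}^k)-\operatorname{tr}(\Omega_\nabla^k)$ is exact (for $k=0$: it is zero). 4. Hence for every $k\ge0$ there is exactly one class $c_k(E)$ in the de Rham cohomology $H^{2k}(M;\mathbb K)$ such that $c_k(E)=[\operatorname{tr}(\Omega_\nabla^k)]$ for every smooth connection $\nabla$ on $E$. 5. For every smooth connection $\nabla$, every smooth $\operatorname{End}(E)$-valued $1$-form $\gamma$ and every $n\ge1$, $$\frac{d}{dt}\Big|_{t=0}\operatorname{tr}\bigl(\Omega_{\nabla+t\gamma}^n\bigr)=n\operatorname{tr}(\Omega_\nabla^{n-1}\wedge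 D\gamma)=n\,d\operatorname{tr}(\Omega_\nabla^{n-1}\wedge\gamma)$$ pointwise on $M$. 6. If $M$ is moreover compact and oriented, of dimension $m=2n$, then for every smooth connection $\nabla$ and every smooth $\operatorname{End}(E)$-valued $1$-form $\gamma$ the function $t\mapsto\int_M\operatorname{tr}(\Omega_{\nabla+t\gamma}^n)$ is differentiable at $t=0$ with derivative $0$; for $n\ge1$ this derivative is $$n\int_M\operatorname{tr}(\Omega_\nabla^{n-1}\wedge D\gamma)=n\int_M d\operatorname{tr}(\Omega_\nabla^{n-1}\wedge\gamma)=0 .$$ -/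

import Mathlib

open Bundle Set Filter Topology MeasureTheory
open scoped Manifold ContDiff

noncomputable section

set_option linter.unusedSectionVars false

namespace ChernForms

/-! ### Scalar differential forms on a smooth manifold without boundary -/

section Scalar

variable (G : Type*) [NormedAddCommGroup G] [NormedSpace ℝ G] (m : ℕ)

/-- (Not necessarily smooth) differential `p`-forms on the `m`-dimensional manifold `M` with values
in the real normed vector space `G`: an alternating `p`-linear form on every tangent space. (The tangent space
`TangentSpace (𝓡 m) x` is by definition a copy of `EuclideanSpace ℝ (Fin m)`, identified with it
through the preferred chart at `x`.) -/
abbrev DForm (M : Type*) (p : ℕ) : Type _ :=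
  M → EuclideanSpace ℝ (Fin m) [⋀^Fin p]→L[ℝ] G

variable {G m} {M : Type*} [TopologicalSpace M] [ChartedSpace (EuclideanSpace ℝ (Fin m)) M]
  {p : ℕ}

/-- The expression of a form in the preferred chart at `x₀`: the pullback of the form by the
inverse of the chart, a form on (the target of the chart in) `ℝᵐ`. -/
def DForm.rep (α : DForm G m M p) (x₀ : M) (y : EuclideanSpace ℝ (Fin m)) :
    EuclideanSpace ℝ (Fin m) [⋀^Fin p]→L[ℝ] G :=
  (α ((extChartAt (𝓡 m) x₀).symm y)).compContinuousLinearMap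
    (mfderiv 𝓘(ℝ, EuclideanSpace ℝ (Fin m)) (𝓡 m) (extChartAt (𝓡 m) x₀).symm y)

/-- Smooth forms: the expressions in charts are smooth. -/
def DForm.IsSmooth (α : DForm G m M p) : Prop :=
  ∀ x₀ : M, ContDiffOn ℝ ∞ (α.rep x₀) (extChartAt (𝓡 m) x₀).target

/-- The exterior derivative, computed at `x` in the preferred chart at `x`. -/
def DForm.d (α : DForm G m M p) : DForm G m M (p + 1) := fun x ↦
  (extDeriv (α.rep x) (extChartAt (𝓡 m) x x)).compContinuousLinearMap
    (mfderiv (𝓡 m) 𝓘(ℝ, EuclideanSpace ℝ (Fin m)) (extChartAt (𝓡 m) x) x)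

lemma DForm.rep_add (α η : DForm G m M p) (x : M) :
    DForm.rep (α + η) x = α.rep x + η.rep x := by
  ext y v; rfl

lemma DForm.rep_smul (c : ℝ) (α : DForm G m M p) (x : M) :
    DForm.rep (c • α) x = c • α.rep x := by
  ext y v; rfl

lemma DForm.rep_zero (x : M) : DForm.rep (0 : DForm G m M p) x = 0 := by
  ext y v; rfl

lemma DForm.isSmooth_zero : DForm.IsSmooth (0 : DForm G m M p) := fun x ↦ by
  rw [DForm.rep_zero]; exact contDiffOn_const

lemma DForm.IsSmooth.add {α η : DForm G m M p} (hα : α.IsSmooth) (hη : η.IsSmooth) :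
    DForm.IsSmooth (α + η) := fun x ↦ by
  rw [DForm.rep_add]; exact (hα x).add (hη x)

lemma DForm.IsSmooth.smul (c : ℝ) {α : DForm G m M p} (hα : α.IsSmooth) :
    DForm.IsSmooth (c • α) := fun x ↦ by
  rw [DForm.rep_smul]; exact (hα x).const_smul c

lemma DForm.IsSmooth.differentiableAt {α : DForm G m M p} (hα : α.IsSmooth) (x : M) :
    DifferentiableAt ℝ (α.rep x) (extChartAt (𝓡 m) x x) :=
  ((hα x).contDiffAt (extChartAt_target_mem_nhds x)).differentiableAt (by simp)

lemma DForm.d_zero : DForm.d (0 : DForm G m M p) = 0 := by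
  funext x
  have h := extDeriv_smul (0 : ℝ) (fun _ : EuclideanSpace ℝ (Fin m) ↦
    (0 : EuclideanSpace ℝ (Fin m) [⋀^Fin p]→L[ℝ] G)) (x := extChartAt (𝓡 m) x x)
  have h' : (0 : ℝ) • (fun _ : EuclideanSpace ℝ (Fin m) ↦
    (0 : EuclideanSpace ℝ (Fin m) [⋀^Fin p]→L[ℝ] G)) = 0 := zero_smul _ _
  rw [h', zero_smul] at h
  simp only [DForm.d, DForm.rep_zero, h]
  rfl

lemma DForm.d_add {α η : DForm G m M p} (hα : α.IsSmooth) (hη : η.IsSmooth) :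
    DForm.d (α + η) = α.d + η.d := by
  funext x
  simp only [DForm.d, DForm.rep_add,
    extDeriv_add (hα.differentiableAt x) (hη.differentiableAt x)]
  rfl

lemma DForm.d_smul (c : ℝ) (α : DForm G m M p) : DForm.d (c • α) = c • α.d := by
  funext x
  simp only [DForm.d, DForm.rep_smul, extDeriv_smul]
  rfl

variable (G m M)

/-- The space `Zᵖ(M; G)` of smooth closed `p`-forms. -/
def closedForms (p : ℕ) : Submodule ℝ (DForm G m M p) where
  carrier := {α | α.IsSmooth ∧ α.d = 0}
  add_mem' := fun ha hb ↦ ⟨ha.1.add hb.1, by rw [DForm.d_add ha.1 hb.1, ha.2, hb.2, add_zero]⟩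
  zero_mem' := ⟨DForm.isSmooth_zero, DForm.d_zero⟩
  smul_mem' := fun c _ ha ↦ ⟨ha.1.smul c, by rw [DForm.d_smul, ha.2, smul_zero]⟩

/-- The space `Bᵖ(M; G)` of exact `p`-forms, i.e. of exterior derivatives of smooth
`(p-1)`-forms; it is zero for `p = 0`. -/
def exactForms : (p : ℕ) → Submodule ℝ (DForm G m M p)
  | 0 => ⊥
  | p + 1 =>
    { carrier := {α | ∃ η : DForm G m M p, η.IsSmooth ∧ α = η.d}
      add_mem' := by
        rintro _ _ ⟨a, ha, rfl⟩ ⟨b, hb, rfl⟩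
        exact ⟨a + b, ha.add hb, (DForm.d_add ha hb).symm⟩
      zero_mem' := ⟨0, DForm.isSmooth_zero, DForm.d_zero.symm⟩
      smul_mem' := by
        rintro c _ ⟨a, ha, rfl⟩
        exact ⟨c • a, ha.smul c, (DForm.d_smul c a).symm⟩ }

/-- De Rham cohomology `Hᵖ(M; G)`: smooth closed forms modulo exact forms. -/
abbrev DeRham (p : ℕ) : Type _ :=
  closedForms G m M p ⧸ (exactForms G m M p).submoduleOf (closedForms G m M p)

variable {G m M}

/-- The integral over `M` of a form `α` of top degree `p = m`, for the orientation of `M` given by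
the nowhere vanishing form `o`, computed with a partition of unity `ρ` subordinate to the domains
of the preferred charts: the sum over the charts of the integrals over the images of the charts of
the coefficient of `ρ_c α`, taken with sign `-1` where the chart reverses the orientation. -/
def integral (o : DForm ℝ m M m) (ρ : SmoothPartitionOfUnity M (𝓡 m) M univ)
    (hp : p = m) (α : DForm G m M p) : G :=
  ∑ᶠ c : M, ∫ y in (extChartAt (𝓡 m) c).target,
    (ρ c ((extChartAt (𝓡 m) c).symm y) *
      (SignType.sign (o.rep c y fun i ↦ EuclideanSpace.single i (1 : ℝ)) : ℝ)) •
      α.rep c y fun i ↦ EuclideanSpace.single (Fin.cast hp i) (1 : ℝ)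

end Scalar

/-! ### Forms with values in the endomorphisms of a vector bundle -/

section EndValued

variable (𝕜 : Type*) [RCLike 𝕜] (m : ℕ)
  {M : Type*} [TopologicalSpace M] [ChartedSpace (EuclideanSpace ℝ (Fin m)) M]
  [IsManifold (𝓡 m) ∞ M]
  (F : Type*) [NormedAddCommGroup F] [NormedSpace ℝ F] [NormedSpace 𝕜 F]
  (V : M → Type*) [TopologicalSpace (TotalSpace F V)]
  [∀ x, AddCommGroup (V x)] [∀ x, Module ℝ (V x)] [∀ x, Module 𝕜 (V x)]
  [∀ x, IsScalarTower ℝ 𝕜 (V x)]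
  [∀ x, TopologicalSpace (V x)] [∀ x, IsTopologicalAddGroup (V x)]
  [∀ x, ContinuousSMul ℝ (V x)]
  [FiberBundle F V] [VectorBundle ℝ F V] [VectorBundle 𝕜 F V] [ContMDiffVectorBundle ∞ F V (𝓡 m)]

/-- (Not necessarily smooth) `p`-forms on `M` with values in the bundle `End(V)` of `𝕜`-linear
endomorphisms of the fibres of `V`. -/
abbrev EndForm (p : ℕ) : Type _ :=
  Π x : M, EuclideanSpace ℝ (Fin m) [⋀^Fin p]→ₗ[ℝ] Module.End 𝕜 (V x)

variable {m} in
/-- The vector field extending the tangent vector `v` at `x` which is constant in the preferred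
chart at `x` (a linear combination with constant coefficients of the coordinate fields); zero
outside of the domain of the chart. -/
def extVec (x : M) (v : EuclideanSpace ℝ (Fin m)) (y : M) : EuclideanSpace ℝ (Fin m) :=
  (trivializationAt (EuclideanSpace ℝ (Fin m)) (TangentSpace (𝓡 m) : M → Type _) x).symmₗ ℝ y
    ((trivializationAt (EuclideanSpace ℝ (Fin m)) (TangentSpace (𝓡 m) : M → Type _) x).linearMapAt
      ℝ x v)

variable {V} in
/-- The section of `V` extending `s ∈ V x` which is constant in the preferred local trivialization
at `x` (a linear combination with constant coefficients of a local frame); zero outside of the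
domain of the trivialization. -/
def extSec {x : M} (s : V x) (y : M) : V y :=
  (trivializationAt F V x).symmₗ ℝ y ((trivializationAt F V x).linearMapAt ℝ x s)

variable {𝕜 m V} {p q : ℕ}

/-- The local section `y ↦ λ_y(W₁, …, W_p) S` of `V`, where the `Wᵢ` and `S` are the extensions of
`wᵢ ∈ T_x M` and `s ∈ V x` with constant coefficients in the local frames at `x`. -/
def EndForm.evalExt (lam : EndForm 𝕜 m V p) (x : M) (w : Fin p → EuclideanSpace ℝ (Fin m))
    (s : V x) (y : M) : V y :=
  lam y (fun i ↦ extVec x (w i) y) (extSec F s y)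

/-- Smooth `End(V)`-valued forms: the coefficients in the local frames around any point are
smooth. -/
def EndForm.IsSmooth (lam : EndForm 𝕜 m V p) : Prop :=
  ∀ (x : M) (w : Fin p → EuclideanSpace ℝ (Fin m)) (s : V x),
    ContMDiffAt (𝓡 m) ((𝓡 m).prod 𝓘(ℝ, F)) ∞
      (fun y ↦ TotalSpace.mk' F y (lam.evalExt F x w s y)) x

/-- Differentiability at `x`: the coefficients in the local frames at `x` are differentiable
at `x`. -/
def EndForm.IsDiffAt (lam : EndForm 𝕜 m V p) (x : M) : Prop :=
  ∀ (w : Fin p → EuclideanSpace ℝ (Fin m)) (s : V x),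
    MDifferentiableAt (𝓡 m) ((𝓡 m).prod 𝓘(ℝ, F))
      (fun y ↦ TotalSpace.mk' F y (lam.evalExt F x w s y)) x

/-- The exterior product of `End(V)`-valued forms, with composition of endomorphisms as product:
`(α ∧ β)(v₁, …, v_{p+q})` is the sum over the `(p, q)`-shuffles `σ` of
`sign σ • α(v_{σ 1}, …, v_{σ p}) ∘ β(v_{σ (p+1)}, …, v_{σ (p+q)})`. -/
def EndForm.wedge (a : EndForm 𝕜 m V p) (b : EndForm 𝕜 m V q) : EndForm 𝕜 m V (p + q) :=
  fun x ↦ ((LinearMap.mul' ℝ (Module.End 𝕜 (V x))).compAlternatingMap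
    ((a x).domCoprod (b x))).domDomCongr finSumFinEquiv

/-- The `k`-th exterior power of an `End(V)`-valued `2`-form; the `0`-th power is the identity
endomorphism. -/
def EndForm.pow (a : EndForm 𝕜 m V 2) : (k : ℕ) → EndForm 𝕜 m V (2 * k)
  | 0 => fun _ ↦ AlternatingMap.constOfIsEmpty ℝ _ (Fin 0) 1
  | k + 1 => (EndForm.pow a k).wedge a

lemma continuous_alternatingMap {m p : ℕ}
    (f : EuclideanSpace ℝ (Fin m) [⋀^Fin p]→ₗ[ℝ] 𝕜) : Continuous f := by
  have h : (f : (Fin p → EuclideanSpace ℝ (Fin m)) → 𝕜) = fun v ↦ ∑ r : Fin p → Fin m,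
      (∏ i, v i (r i)) • f (fun i ↦ EuclideanSpace.single (r i) (1 : ℝ)) := by
    funext v
    have hv : v = fun i ↦ ∑ j, v i j • EuclideanSpace.single j (1 : ℝ) := by
      funext i
      ext l
      simp [Finset.sum_apply, Pi.single_apply]
    conv_lhs => rw [hv]
    rw [← AlternatingMap.coe_multilinearMap, MultilinearMap.map_sum]
    refine Finset.sum_congr rfl fun r _ ↦ ?_
    rw [MultilinearMap.map_smul_univ]
  rw [h]
  fun_prop

/-- The trace of an `End(V)`-valued form, taken pointwise; a scalar form. -/
def EndForm.tr (lam : EndForm 𝕜 m V p) : DForm 𝕜 m M p := fun x ↦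
  { toAlternatingMap :=
      ((LinearMap.trace 𝕜 (V x)).restrictScalars ℝ).compAlternatingMap (lam x)
    cont := continuous_alternatingMap (m := m)
      (((LinearMap.trace 𝕜 (V x)).restrictScalars ℝ).compAlternatingMap (lam x)) }

/-! ### Connections, exterior covariant derivative, curvature -/

lemma extVec_add (x : M) (v w : EuclideanSpace ℝ (Fin m)) (y : M) :
    extVec x (v + w) y = extVec x v y + extVec x w y :=
  ((Trivialization.symmₗ ℝ (trivializationAt (EuclideanSpace ℝ (Fin m))
    (TangentSpace (𝓡 m) : M → Type _) x) y).comp (Trivialization.linearMapAt ℝ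
      (trivializationAt (EuclideanSpace ℝ (Fin m)) (TangentSpace (𝓡 m) : M → Type _) x) x)).map_add v w

lemma extVec_smul (x : M) (c : ℝ) (v : EuclideanSpace ℝ (Fin m)) (y : M) :
    extVec x (c • v) y = c • extVec x v y :=
  ((Trivialization.symmₗ ℝ (trivializationAt (EuclideanSpace ℝ (Fin m))
    (TangentSpace (𝓡 m) : M → Type _) x) y).comp (Trivialization.linearMapAt ℝ
      (trivializationAt (EuclideanSpace ℝ (Fin m)) (TangentSpace (𝓡 m) : M → Type _) x) x)).map_smul c v

lemma extVec_update {ι : Type*} [DecidableEq ι] (x : M) (w : ι → EuclideanSpace ℝ (Fin m)) (i : ι)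
    (a : EuclideanSpace ℝ (Fin m)) (y : M) :
    (fun j ↦ extVec x (Function.update w i a j) y) =
      Function.update (fun j ↦ extVec x (w j) y) i (extVec x a y) := by
  funext j
  rcases eq_or_ne j i with rfl | hj
  · simp
  · simp [hj]

variable (𝕜 m V) in
/-- A connection on the `𝕜`-vector bundle `V → M`: a covariant derivative
`∇ : Γ(V) → Γ(T*M ⊗ V)` which is `𝕜`-linear (the last condition is automatic for `𝕜 = ℝ`).
The value `(∇_X σ)(x)` is written `∇ σ x (X x)`. -/
structure Connection extends CovariantDerivative (𝓡 m) F V where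
  map_smul' : ∀ (c : 𝕜) (σ : Π x, V x) (x : M) (v : TangentSpace (𝓡 m) x),
    MDifferentiableAt (𝓡 m) ((𝓡 m).prod 𝓘(ℝ, F)) (fun y ↦ TotalSpace.mk' F y (σ y)) x →
    toFun (fun y ↦ c • σ y) x v = c • toFun σ x v

/-- Smooth connections: `∇` maps smooth sections to smooth sections. -/
def Connection.IsSmooth (D : Connection 𝕜 m F V) : Prop :=
  CovariantDerivative.ContMDiffCovariantDerivative D.toCovariantDerivative ∞

variable {F} in
/-- The vector `∇_v σ ∈ V x`, for `v ∈ T_x M`, as a linear function of `v`. -/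
def Connection.cov (D : Connection 𝕜 m F V) (σ : Π x, V x) (x : M) :
    EuclideanSpace ℝ (Fin m) →ₗ[ℝ] V x :=
  (D.toFun σ x).toLinearMap

/-- An `End(V)`-valued `1`-form, as a linear map on each tangent space. -/
def EndForm.toLin (γ : EndForm 𝕜 m V 1) (x : M) :
    EuclideanSpace ℝ (Fin m) →ₗ[ℝ] Module.End 𝕜 (V x) :=
  (AlternatingMap.ofSubsingleton ℝ (EuclideanSpace ℝ (Fin m)) (Module.End 𝕜 (V x)) 0).symm (γ x)

/-- The connection `∇ + γ`, for an `End(V)`-valued `1`-form `γ`: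
`(∇ + γ)_X σ = ∇_X σ + γ(X) σ`. -/
def Connection.addForm (D : Connection 𝕜 m F V) (γ : EndForm 𝕜 m V 1) : Connection 𝕜 m F V where
  toFun σ x := D.toFun σ x + LinearMap.toContinuousLinearMap (E := EuclideanSpace ℝ (Fin m))
    (F' := V x)
    { toFun := fun v ↦ γ.toLin x v (σ x)
      map_add' := fun v w ↦ by simp
      map_smul' := fun c v ↦ by simp }
  isCovariantDerivativeOnUniv :=
    { add := fun {σ σ' x} hσ hσ' _ ↦ by
        rw [D.isCovariantDerivativeOnUniv.add hσ hσ']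
        ext v
        change (D.toFun σ x v + D.toFun σ' x v) + γ.toLin x v (σ x + σ' x) =
          (D.toFun σ x v + γ.toLin x v (σ x)) + (D.toFun σ' x v + γ.toLin x v (σ' x))
        rw [map_add]
        abel
      leibniz := fun {σ g x} hσ hg _ ↦ by
        rw [D.isCovariantDerivativeOnUniv.leibniz hσ hg]
        ext v
        have h : γ.toLin x v (g x • σ x) = g x • γ.toLin x v (σ x) := by
          rw [← algebraMap_smul 𝕜 (g x) (σ x), map_smul, algebraMap_smul]
        change (g x • D.toFun σ x v + _) + γ.toLin x v (g x • σ x) =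
          g x • (D.toFun σ x v + γ.toLin x v (σ x)) + _
        rw [h, smul_add]
        abel }
  map_smul' c σ x v h := by
    change D.toFun (fun y ↦ c • σ y) x v + γ.toLin x v (c • σ x) =
      c • (D.toFun σ x v + γ.toLin x v (σ x))
    rw [D.map_smul' c σ x v h, map_smul, smul_add]

lemma extSec_add (x : M) (s s' : V x) (y : M) :
    extSec F (s + s') y = extSec F s y + extSec F s' y :=
  ((Trivialization.symmₗ ℝ (trivializationAt F V x) y).comp
    (Trivialization.linearMapAt ℝ (trivializationAt F V x) x)).map_add s s'

variable (𝕜) in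
lemma extSec_smul (x : M) (c : 𝕜) (s : V x) (y : M) :
    extSec F (c • s) y = c • extSec F s y := by
  have hx := FiberBundle.mem_baseSet_trivializationAt' (F := F) (E := V) x
  have h (s : V x) : extSec F s y =
      (trivializationAt F V x).symmₗ 𝕜 y ((trivializationAt F V x).linearMapAt 𝕜 x s) := by
    by_cases hy : y ∈ (trivializationAt F V x).baseSet
    · simp [extSec, hx, hy, Trivialization.linearMapAt_apply]
    · simp [extSec, hy]
  rw [h, h, _root_.map_smul, _root_.map_smul]

lemma eventually_mdifferentiableAt_extSec {x : M} (s : V x) :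
    ∀ᶠ y in 𝓝 x, MDifferentiableAt (𝓡 m) ((𝓡 m).prod 𝓘(ℝ, F))
      (fun y ↦ TotalSpace.mk' F y (extSec F s y)) y := by
  have hx := FiberBundle.mem_baseSet_trivializationAt' (F := F) (E := V) x
  obtain ⟨u, hu, hs⟩ := FiberBundle.exists_contMDiffOn_extend (k := ∞) (𝓡 m) F s
  filter_upwards [eventually_mem_nhds_iff.2 hu,
    (trivializationAt F V x).open_baseSet.eventually_mem hx] with y hy hy'
  refine ((hs.contMDiffAt hy).mdifferentiableAt (by simp)).congr_of_eventuallyEq ?_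
  filter_upwards [(trivializationAt F V x).open_baseSet.eventually_mem hy'] with z hz
  simp [extSec, FiberBundle.extend, hz, hx, Trivialization.linearMapAt_apply]

lemma mdifferentiableAt_extSec {x : M} (s : V x) :
    MDifferentiableAt (𝓡 m) ((𝓡 m).prod 𝓘(ℝ, F)) (fun y ↦ TotalSpace.mk' F y (extSec F s y)) x :=
  (eventually_mdifferentiableAt_extSec F s).self_of_nhds

lemma Connection.map_add (D : Connection 𝕜 m F V) {σ σ' : Π x, V x} {x : M}
    (hσ : MDifferentiableAt (𝓡 m) ((𝓡 m).prod 𝓘(ℝ, F)) (fun y ↦ TotalSpace.mk' F y (σ y)) x)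
    (hσ' : MDifferentiableAt (𝓡 m) ((𝓡 m).prod 𝓘(ℝ, F)) (fun y ↦ TotalSpace.mk' F y (σ' y)) x)
    (v : EuclideanSpace ℝ (Fin m)) :
    D.cov (fun y ↦ σ y + σ' y) x v = D.cov σ x v + D.cov σ' x v := by
  have h := D.isCovariantDerivativeOnUniv.add hσ hσ'
  exact DFunLike.congr_fun h v

lemma Connection.map_smul_real (D : Connection 𝕜 m F V) (c : ℝ) {σ : Π x, V x} {x : M}
    (hσ : MDifferentiableAt (𝓡 m) ((𝓡 m).prod 𝓘(ℝ, F)) (fun y ↦ TotalSpace.mk' F y (σ y)) x)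
    (v : EuclideanSpace ℝ (Fin m)) :
    D.cov (fun y ↦ c • σ y) x v = c • D.cov σ x v := by
  have h := D.isCovariantDerivativeOnUniv.smul_const c hσ
  exact DFunLike.congr_fun h v

lemma Connection.map_smul_cov (D : Connection 𝕜 m F V) (c : 𝕜) {σ : Π x, V x} {x : M}
    (hσ : MDifferentiableAt (𝓡 m) ((𝓡 m).prod 𝓘(ℝ, F)) (fun y ↦ TotalSpace.mk' F y (σ y)) x)
    (v : EuclideanSpace ℝ (Fin m)) :
    D.cov (fun y ↦ c • σ y) x v = c • D.cov σ x v :=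
  D.map_smul' c σ x v hσ

lemma Connection.map_zero (D : Connection 𝕜 m F V) (x : M) (v : EuclideanSpace ℝ (Fin m)) :
    D.cov (fun _ ↦ 0) x v = 0 :=
  DFunLike.congr_fun (D.isCovariantDerivativeOnUniv.zero (x := x)) v

lemma Connection.cov_congr (D : Connection 𝕜 m F V) {σ σ' : Π x, V x} {x : M}
    (hσ : MDifferentiableAt (𝓡 m) ((𝓡 m).prod 𝓘(ℝ, F)) (fun y ↦ TotalSpace.mk' F y (σ y)) x)
    (h : ∀ᶠ y in 𝓝 x, σ y = σ' y) (v : EuclideanSpace ℝ (Fin m)) :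
    D.cov σ x v = D.cov σ' x v := by
  have hσ' : MDifferentiableAt (𝓡 m) ((𝓡 m).prod 𝓘(ℝ, F))
      (fun y ↦ TotalSpace.mk' F y (σ' y)) x := by
    refine hσ.congr_of_eventuallyEq ?_
    filter_upwards [h] with y hy
    rw [hy]
  exact DFunLike.congr_fun
    (D.isCovariantDerivativeOnUniv.congr_of_eventuallyEq hσ hσ' univ_mem h) v

/-- The covariant derivative at `x` of an `End(V)`-valued `p`-form `λ`, for the connection induced
on `End(V)` and the coordinate vector fields at `x`: for the extensions `Wᵢ`, `S` of `wᵢ`, `s` with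
constant coefficients in the local frames at `x`, it is
`(v, w, s) ↦ ∇_v (λ(W₁, …, W_p) S) - λ(w₁, …, w_p) (∇_v S)`.
(Defined to be `0` if `λ` is not differentiable at `x`.) -/
def Connection.covDeriv (D : Connection 𝕜 m F V) (lam : EndForm 𝕜 m V p) (x : M) :
    EuclideanSpace ℝ (Fin m) →ₗ[ℝ]
      EuclideanSpace ℝ (Fin m) [⋀^Fin p]→ₗ[ℝ] Module.End 𝕜 (V x) :=
  open Classical in
  if h : lam.IsDiffAt F x then
    { toFun := fun v ↦
        { toFun := fun w ↦
            { toFun := fun s ↦ D.cov (lam.evalExt F x w s) x v -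
                lam x w (D.cov (extSec F s) x v)
              map_add' := fun s s' ↦ by
                have h1 : lam.evalExt F x w (s + s') =
                    fun y ↦ lam.evalExt F x w s y + lam.evalExt F x w s' y := by
                  funext y
                  simp only [EndForm.evalExt, extSec_add, _root_.map_add]
                have h2 : extSec F (s + s') = fun y ↦ extSec F s y + extSec F s' y := by
                  funext y
                  exact extSec_add F x s s' y
                rw [h1, h2, D.map_add F (h w s) (h w s'),
                  D.map_add F (mdifferentiableAt_extSec F s) (mdifferentiableAt_extSec F s'),
                  _root_.map_add]
                abel
              map_smul' := fun c s ↦ by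
                have h1 : lam.evalExt F x w (c • s) =
                    fun y ↦ c • lam.evalExt F x w s y := by
                  funext y
                  simp only [EndForm.evalExt, extSec_smul, _root_.map_smul]
                have h2 : extSec F (c • s) = fun y ↦ c • extSec F s y := by
                  funext y
                  exact extSec_smul 𝕜 F x c s y
                rw [h1, h2, D.map_smul_cov F c (h w s),
                  D.map_smul_cov F c (mdifferentiableAt_extSec F s), _root_.map_smul]
                simp [smul_sub] }
          map_update_add' := fun w i a b ↦ by
            ext s
            have h1 : lam.evalExt F x (Function.update w i (a + b)) s = fun y ↦
                lam.evalExt F x (Function.update w i a) s y +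
                  lam.evalExt F x (Function.update w i b) s y := by
              funext y
              simp only [EndForm.evalExt, extVec_update, extVec_add]
              rw [(lam y).map_update_add]
              rfl
            simp only [LinearMap.coe_mk, AddHom.coe_mk, LinearMap.add_apply]
            rw [h1, D.map_add F (h _ s) (h _ s), (lam x).map_update_add, LinearMap.add_apply]
            abel
          map_update_smul' := fun w i c a ↦ by
            ext s
            have h1 : lam.evalExt F x (Function.update w i (c • a)) s = fun y ↦
                c • lam.evalExt F x (Function.update w i a) s y := by
              funext y
              simp only [EndForm.evalExt, extVec_update, extVec_smul]
              rw [(lam y).map_update_smul]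
              rfl
            simp only [LinearMap.coe_mk, AddHom.coe_mk, LinearMap.smul_apply]
            rw [h1, D.map_smul_real F c (h _ s), (lam x).map_update_smul, LinearMap.smul_apply,
              smul_sub]
          map_eq_zero_of_eq' := fun w i j hij hne ↦ by
            ext s
            have h1 : lam.evalExt F x w s = fun _ ↦ 0 := by
              funext y
              simp only [EndForm.evalExt]
              rw [(lam y).map_eq_zero_of_eq _ (by simp only [hij]) hne]
              rfl
            simp only [LinearMap.coe_mk, AddHom.coe_mk, LinearMap.zero_apply]
            rw [h1, D.map_zero, (lam x).map_eq_zero_of_eq _ hij hne]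
            simp }
      map_add' := fun v v' ↦ by
        ext w s
        change D.cov _ x (v + v') - lam x w (D.cov _ x (v + v')) =
          (D.cov _ x v - lam x w (D.cov _ x v)) + (D.cov _ x v' - lam x w (D.cov _ x v'))
        rw [_root_.map_add, _root_.map_add, _root_.map_add]
        abel
      map_smul' := fun c v ↦ by
        ext w s
        change D.cov _ x (c • v) - lam x w (D.cov _ x (c • v)) =
          c • (D.cov _ x v - lam x w (D.cov _ x v))
        rw [_root_.map_smul, _root_.map_smul, LinearMap.map_smul_of_tower, smul_sub] }
  else 0

/-- The exterior covariant derivative `D λ` of an `End(V)`-valued `p`-form: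
`Dλ(v₀, …, v_p) = ∑ᵢ (-1)ⁱ (∇_{vᵢ} (λ(V₀, …, V̂ᵢ, …, V_p)))`, where the `Vᵢ` are the extensions of
the `vᵢ` with constant coefficients in the chart at `x`, so that the terms with the brackets
`[Vᵢ, Vⱼ] = 0` of the general formula are absent. -/
def Connection.extD (D : Connection 𝕜 m F V) (lam : EndForm 𝕜 m V p) : EndForm 𝕜 m V (p + 1) :=
  fun x ↦ AlternatingMap.alternatizeUncurryFin (D.covDeriv F lam x)

/-- The section `y ↦ (∇_W S)(y)` of `V`, where `W` and `S` are the extensions of `w ∈ T_x M` and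
`s ∈ V x` with constant coefficients in the local frames at `x`. -/
def Connection.derivExt (D : Connection 𝕜 m F V) (x : M) (w : EuclideanSpace ℝ (Fin m)) (s : V x)
    (y : M) : V y :=
  D.cov (extSec F s) y (extVec x w y)

/-- The second covariant derivative `(v, w, s) ↦ ∇_v ∇_W S` at `x`, where `W` and `S` are the
extensions of `w` and `s` with constant coefficients in the local frames at `x`.
(Defined to be `0` if one of the sections `∇_W S` is not differentiable at `x`.) -/
def Connection.covDeriv₂ (D : Connection 𝕜 m F V) (x : M) :
    EuclideanSpace ℝ (Fin m) →ₗ[ℝ] EuclideanSpace ℝ (Fin m) →ₗ[ℝ] Module.End 𝕜 (V x) :=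
  open Classical in
  if h : ∀ w s, MDifferentiableAt (𝓡 m) ((𝓡 m).prod 𝓘(ℝ, F))
      (fun y ↦ TotalSpace.mk' F y (D.derivExt F x w s y)) x then
    LinearMap.mk₂ ℝ
      (fun v w ↦
        { toFun := fun s ↦ D.cov (D.derivExt F x w s) x v
          map_add' := fun s s' ↦ by
            rw [← D.map_add F (h w s) (h w s')]
            refine D.cov_congr F (h w (s + s')) ?_ v
            filter_upwards [eventually_mdifferentiableAt_extSec (m := m) F s,
              eventually_mdifferentiableAt_extSec (m := m) F s'] with y hy hy'
            rw [Connection.derivExt, Connection.derivExt, Connection.derivExt,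
              ← D.map_add F hy hy']
            congr 2
            funext z
            exact extSec_add F x s s' z
          map_smul' := fun c s ↦ by
            rw [RingHom.id_apply, ← D.map_smul_cov F c (h w s)]
            refine D.cov_congr F (h w (c • s)) ?_ v
            filter_upwards [eventually_mdifferentiableAt_extSec (m := m) F s] with y hy
            rw [Connection.derivExt, Connection.derivExt, ← D.map_smul_cov F c hy]
            congr 2
            funext z
            exact extSec_smul 𝕜 F x c s z })
      (fun v v' w ↦ by
        ext s
        exact _root_.map_add (D.cov (D.derivExt F x w s) x) v v')
      (fun c v w ↦ by
        ext s
        exact _root_.map_smul (D.cov (D.derivExt F x w s) x) c v)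
      (fun v w w' ↦ by
        ext s
        have h1 : D.derivExt F x (w + w') s =
            fun y ↦ D.derivExt F x w s y + D.derivExt F x w' s y := by
          funext y
          simp only [Connection.derivExt, extVec_add, _root_.map_add]
        simp only [LinearMap.coe_mk, AddHom.coe_mk, LinearMap.add_apply]
        rw [h1, D.map_add F (h w s) (h w' s)])
      (fun c v w ↦ by
        ext s
        have h1 : D.derivExt F x (c • w) s = fun y ↦ c • D.derivExt F x w s y := by
          funext y
          simp only [Connection.derivExt, extVec_smul, _root_.map_smul]
        simp only [LinearMap.coe_mk, AddHom.coe_mk, LinearMap.smul_apply]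
        rw [h1, D.map_smul_real F c (h w s)])
  else 0

/-- The curvature `Ω` of a connection, an `End(V)`-valued `2`-form:
`Ω(v, w) s = ∇_v ∇_W S - ∇_w ∇_U S` for the extensions `U`, `W` of `v`, `w ∈ T_x M` and `S` of
`s ∈ V x` with constant coefficients in the local frames at `x`; the term with the bracket
`[U, W] = 0` of the general formula is absent. -/
def Connection.curvature (D : Connection 𝕜 m F V) : EndForm 𝕜 m V 2 := fun x ↦
  AlternatingMap.alternatizeUncurryFin
    { toFun := fun v ↦ AlternatingMap.ofSubsingleton ℝ (EuclideanSpace ℝ (Fin m))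
        (Module.End 𝕜 (V x)) (0 : Fin 1) (D.covDeriv₂ F x v)
      map_add' := fun v v' ↦ by
        ext w s
        simp
      map_smul' := fun c v ↦ by
        ext w s
        simp }

/-- The `k`-th Chern form `tr(Ωᵏ)` of a connection, a form of degree `2k`. -/
def Connection.chernForm (D : Connection 𝕜 m F V) (k : ℕ) : DForm 𝕜 m M (2 * k) :=
  ((D.curvature F).pow k).tr

end EndValued

end ChernForms

end

open Bundle Set Filter Topology MeasureTheory
open scoped Manifold ContDiff

noncomputable section

namespace ChernForms

set_option linter.unusedSectionVars false

/-! ### Exterior products of algebra-valued forms, modelled in `ExteriorAlgebra ℝ E ⊗[ℝ] A` -/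

section Algebra

open scoped TensorProduct Nat

variable {E : Type*} [AddCommGroup E] [Module ℝ E] {m : ℕ} (b : Module.Basis (Fin m) ℝ E)
  {A : Type*} [Ring A] [Algebra ℝ A] {p q : ℕ}

/-! In a local frame a connection is `d + Γ`, and everything reduces to the calculus of
matrix-valued forms. There `∇_v` acts on `End(V)`-valued forms as `∂_v + [Γ(v), ·]`
(`Connection.matL_covDeriv`) and `Ω = dΓ + Γ ∧ Γ` (`Connection.IsSmooth.formAt_curvature`). The
trace kills commutators, so `tr ∘ D = d ∘ tr` (`Connection.tr_extD`). Symmetry of second derivatives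
gives the Bianchi identity `DΩ = 0`, and expanding `Γ + tγ` gives `Ω_{∇+tγ} = Ω + t Dγ + t² γ ∧ γ`.
The definitions evaluate everything at a point in the chart and frame centred there, so each formula
must also be carried over to the other points of a fixed chart.

Powers and signs are handled by `toGr`, which turns an `A`-valued form into an element of `Λ E ⊗ A`.
The exterior product becomes multiplication, and `D` becomes `∑ ι(bᵢ) · ∇_{bᵢ}`. A `2`-form lands in
the subalgebra `centralGr` generated by `A` and the center of `Λ E`; hence vectors move past it
without sign, and the trace is cyclic as soon as one factor lies there. This yields `D(Ωᵏ) = 0`, so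
Chern forms are closed; then `D(Ωᵏ ∧ γ) = Ωᵏ ∧ Dγ`; and, by cyclicity, `d/dt tr(Ωⁿ) = n tr(Ωⁿ⁻¹ ∧
Dγ) = n d tr(Ωⁿ⁻¹ ∧ γ)`.

For the transgression, `Ω_{∇+tγ}ᵏ` is a polynomial in `t` with smooth forms as coefficients, so the
derivative formula, valid at every `t`, is integrated from `0` to `1` coefficient by coefficient.
Any two connections differ by an `End(V)`-valued `1`-form, which gives exactness in general. A
smooth connection exists by patching local flat ones with a partition of unity; without one the
Chern class would not be unique.

On a compact oriented manifold Stokes' theorem makes the integrals of cohomologous forms equal. The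
function `t ↦ ∫ tr(Ωⁿ)` is therefore constant, and no differentiation under the integral sign is
needed. -/

/-- The exterior product of alternating maps with values in an algebra. -/
def altWedge (f : E [⋀^Fin p]→ₗ[ℝ] A) (g : E [⋀^Fin q]→ₗ[ℝ] A) : E [⋀^Fin (p + q)]→ₗ[ℝ] A :=
  ((LinearMap.mul' ℝ A).compAlternatingMap (f.domCoprod g)).domDomCongr finSumFinEquiv

/-- Each shuffle represents a coset of `p! q!` permutations, all with the same signed term. Summing
over all permutations and dividing avoids the quotient in `domCoprod`. -/
lemma altWedge_apply (f : E [⋀^Fin p]→ₗ[ℝ] A) (g : E [⋀^Fin q]→ₗ[ℝ] A) (v : Fin (p + q) → E) :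
    altWedge f g v = ((p ! * q ! : ℕ) : ℝ)⁻¹ • ∑ σ : Equiv.Perm (Fin p ⊕ Fin q),
      Equiv.Perm.sign σ • (f (fun i ↦ v (finSumFinEquiv (σ (Sum.inl i)))) *
        g (fun j ↦ v (finSumFinEquiv (σ (Sum.inr j))))) := by
  have h := congrArg (fun F ↦ LinearMap.mul' ℝ A (F (fun i ↦ v (finSumFinEquiv i))))
    (MultilinearMap.domCoprod_alternization_eq f g)
  simp only [MultilinearMap.alternatization_apply, AlternatingMap.smul_apply, Fintype.card_fin,
    map_sum, map_nsmul] at h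
  have hne : ((p ! * q ! : ℕ) : ℝ) ≠ 0 := by positivity
  rw [eq_inv_smul_iff₀ hne, Nat.cast_smul_eq_nsmul]
  refine h.symm.trans (Finset.sum_congr rfl fun σ _ ↦ ?_)
  simp only [MultilinearMap.domDomCongr_apply,
    MultilinearMap.domCoprod_apply, LinearMap.map_smul_of_tower]
  rfl

lemma altWedge_add_left (f f' : E [⋀^Fin p]→ₗ[ℝ] A) (g : E [⋀^Fin q]→ₗ[ℝ] A) :
    altWedge (f + f') g = altWedge f g + altWedge f' g := by
  ext v
  simp [altWedge_apply, add_mul, Finset.sum_add_distrib]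

lemma altWedge_add_right (f : E [⋀^Fin p]→ₗ[ℝ] A) (g g' : E [⋀^Fin q]→ₗ[ℝ] A) :
    altWedge f (g + g') = altWedge f g + altWedge f g' := by
  ext v
  simp [altWedge_apply, mul_add, Finset.sum_add_distrib]

lemma altWedge_smul_left (c : ℝ) (f : E [⋀^Fin p]→ₗ[ℝ] A) (g : E [⋀^Fin q]→ₗ[ℝ] A) :
    altWedge (c • f) g = c • altWedge f g := by
  ext v
  simp only [altWedge_apply, AlternatingMap.smul_apply, smul_mul_assoc, smul_comm _ c,
    ← Finset.smul_sum]

lemma altWedge_smul_right (c : ℝ) (f : E [⋀^Fin p]→ₗ[ℝ] A) (g : E [⋀^Fin q]→ₗ[ℝ] A) :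
    altWedge f (c • g) = c • altWedge f g := by
  ext v
  simp only [altWedge_apply, AlternatingMap.smul_apply, mul_smul_comm, smul_comm _ c,
    ← Finset.smul_sum]

/-- The element of `Λ E ⊗ A` which represents an `A`-valued alternating map, in terms of a basis. -/
def toGr (f : E [⋀^Fin p]→ₗ[ℝ] A) : ExteriorAlgebra ℝ E ⊗[ℝ] A :=
  ((p ! : ℕ) : ℝ)⁻¹ • ∑ r : Fin p → Fin m,
    ExteriorAlgebra.ιMulti ℝ p (fun i ↦ b (r i)) ⊗ₜ[ℝ] f (fun i ↦ b (r i))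

lemma toGr_add (f g : E [⋀^Fin p]→ₗ[ℝ] A) : toGr b (f + g) = toGr b f + toGr b g := by
  simp [toGr, TensorProduct.tmul_add, Finset.sum_add_distrib]

lemma toGr_smul (c : ℝ) (f : E [⋀^Fin p]→ₗ[ℝ] A) : toGr b (c • f) = c • toGr b f := by
  simp only [toGr, AlternatingMap.smul_apply, TensorProduct.tmul_smul, ← Finset.smul_sum,
    smul_comm c]

/-- Antisymmetrization does not change the element of `Λ E ⊗ A` represented by a map. -/
lemma sum_ιMulti_tmul_perm {p : ℕ} (g : (Fin p → Fin m) → A) (σ : Equiv.Perm (Fin p)) :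
    ∑ r : Fin p → Fin m, ExteriorAlgebra.ιMulti ℝ p (fun i ↦ b (r i)) ⊗ₜ[ℝ]
      (Equiv.Perm.sign σ • g (r ∘ σ)) =
    ∑ r : Fin p → Fin m, ExteriorAlgebra.ιMulti ℝ p (fun i ↦ b (r i)) ⊗ₜ[ℝ] g r := by
  refine Fintype.sum_equiv (Equiv.arrowCongr σ.symm (Equiv.refl _)) _ _ fun r ↦ ?_
  have h : (Equiv.arrowCongr σ.symm (Equiv.refl (Fin m))) r = r ∘ σ := by
    ext i; simp [Equiv.arrowCongr]
  rw [h]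
  have h2 := (ExteriorAlgebra.ιMulti ℝ p (M := E)).map_perm (fun i ↦ b (r i)) σ
  have h3 : (fun i ↦ b ((r ∘ σ) i)) = (fun i ↦ b (r i)) ∘ σ := rfl
  rw [h3, h2]
  rcases Int.units_eq_one_or (Equiv.Perm.sign σ) with hs | hs <;>
    simp [hs, TensorProduct.neg_tmul, TensorProduct.tmul_neg]

/-- Against the antisymmetric `ιMulti`, every permutation in the exterior product contributes the
same amount, so only the product `f(…) * g(…)` of the two blocks survives. An index word of length
`p + q` is a pair of words, and the sum factors. -/
lemma toGr_altWedge (f : E [⋀^Fin p]→ₗ[ℝ] A) (g : E [⋀^Fin q]→ₗ[ℝ] A) :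
    toGr b (altWedge f g) = toGr b f * toGr b g := by
  set G : (Fin (p + q) → Fin m) → A := fun r ↦
    f (fun i ↦ b (r (Fin.castAdd q i))) * g (fun j ↦ b (r (Fin.natAdd p j))) with hG
  -- The `(p + q)!` equal permutation terms cancel the normalization of `toGr` in degree `p + q`;
  -- what remains is the factor `1 / (p! q!)` of `altWedge_apply`.
  have h1 : toGr b (altWedge f g) = ((p ! : ℕ) : ℝ)⁻¹ • ((q ! : ℕ) : ℝ)⁻¹ •
      ∑ r : Fin (p + q) → Fin m,
        ExteriorAlgebra.ιMulti ℝ (p + q) (fun i ↦ b (r i)) ⊗ₜ[ℝ] G r := by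
    have h2 : ∀ r : Fin (p + q) → Fin m, altWedge f g (fun i ↦ b (r i)) =
        ((p ! * q ! : ℕ) : ℝ)⁻¹ • ∑ σ : Equiv.Perm (Fin (p + q)),
          Equiv.Perm.sign σ • G (r ∘ σ) := by
      intro r
      rw [altWedge_apply]
      congr 1
      refine Fintype.sum_equiv (Equiv.permCongr finSumFinEquiv) _ _ fun σ ↦ ?_
      simp [hG]
    have hne : (((p + q) ! : ℕ) : ℝ) ≠ 0 := by positivity
    have h3 : toGr b (altWedge f g) = (((p + q) ! : ℕ) : ℝ)⁻¹ • ((p ! * q ! : ℕ) : ℝ)⁻¹ •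
        ∑ σ : Equiv.Perm (Fin (p + q)), ∑ r : Fin (p + q) → Fin m,
          ExteriorAlgebra.ιMulti ℝ (p + q) (fun i ↦ b (r i)) ⊗ₜ[ℝ]
            (Equiv.Perm.sign σ • G (r ∘ σ)) := by
      rw [toGr, Finset.sum_comm]
      congr 1
      simp only [h2, TensorProduct.tmul_smul, ← Finset.smul_sum, TensorProduct.tmul_sum]
    rw [h3]
    simp only [sum_ιMulti_tmul_perm]
    rw [Finset.sum_const, Finset.card_univ, Fintype.card_perm, Fintype.card_fin,
      ← Nat.cast_smul_eq_nsmul ℝ, smul_comm (((p ! * q ! : ℕ) : ℝ)⁻¹), inv_smul_smul₀ hne,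
      Nat.cast_mul, mul_inv, mul_smul]
  rw [h1, toGr, toGr, smul_mul_assoc, mul_smul_comm]
  congr 2
  rw [Finset.sum_mul_sum, ← Fintype.sum_prod_type']
  refine (Fintype.sum_equiv (Fin.appendEquiv p q) _ _ fun r ↦ ?_).symm
  rw [Algebra.TensorProduct.tmul_mul_tmul, ExteriorAlgebra.ιMulti_mul_ιMulti]
  congr 2
  · ext i
    refine Fin.addCases (fun i ↦ ?_) (fun i ↦ ?_) i <;> simp [Fin.appendEquiv]
  · congr 1
    ext i
    simp [Fin.appendEquiv]
  · congr 1
    ext i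
    simp [Fin.appendEquiv]

/-- The values on basis tuples can be read off: pairing the exterior factor with the minor of the
coordinates `s` returns `f(b ∘ s)`. Identities between forms may thus be proved in `Λ E ⊗ A`. -/
lemma toGr_injective : Function.Injective (toGr b : E [⋀^Fin p]→ₗ[ℝ] A → _) := by
  intro f f' hff
  -- The functional on `Λ E` is the determinant of the coordinates `s` in degree `p` and zero in all
  -- other degrees.
  have key : ∀ (f : E [⋀^Fin p]→ₗ[ℝ] A) (s : Fin p → Fin m),
      TensorProduct.lid ℝ A (TensorProduct.map (ExteriorAlgebra.liftAlternating fun k ↦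
        if h : p = k then h ▸ (Matrix.detRowAlternating (n := Fin p) (R := ℝ)).compLinearMap
          (LinearMap.pi fun i ↦ b.coord (s i)) else 0) LinearMap.id (toGr b f)) =
        f (fun i ↦ b (s i)) := by
    intro f s
    have hne : ((p ! : ℕ) : ℝ) ≠ 0 := by positivity
    simp only [toGr, map_smul, map_sum, TensorProduct.map_tmul,
      ExteriorAlgebra.liftAlternating_apply_ιMulti, dite_true, LinearMap.id_apply,
      TensorProduct.lid_tmul, AlternatingMap.compLinearMap_apply]
    rw [inv_smul_eq_iff₀ hne]
    have h1 : ∀ r : Fin p → Fin m, (Matrix.detRowAlternating (n := Fin p) (R := ℝ)) (fun j ↦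
        LinearMap.pi (fun i ↦ b.coord (s i)) (b (r j))) =
        ∑ σ : Equiv.Perm (Fin p), if r ∘ σ = s then ((Equiv.Perm.sign σ : ℤ) : ℝ) else 0 := by
      intro r
      refine (Matrix.det_apply' _).trans ?_
      refine Finset.sum_congr rfl fun σ _ ↦ ?_
      have h2 : ∀ i, (LinearMap.pi (fun i ↦ b.coord (s i)) (b (r (σ i))) : Fin p → ℝ) i =
          if r (σ i) = s i then 1 else 0 := by
        intro i
        simp [Finsupp.single_apply]
      simp only [h2]
      rw [Finset.prod_ite_zero]
      by_cases h : r ∘ σ = s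
      · have h' : ∀ i, r (σ i) = s i := fun i ↦ congrFun h i
        simp [h, h']
      · have h' : ¬ ∀ i, r (σ i) = s i := fun h' ↦ h (funext h')
        simp [h, h']
    simp only [h1, Finset.sum_smul]
    rw [Finset.sum_comm]
    -- For each `σ` only `r = s ∘ σ⁻¹` survives, and the sign from the determinant cancels the one
    -- from permuting the arguments of `f`. The `p!` equal terms then absorb the factor `1 / p!`.
    have h3 : ∀ σ : Equiv.Perm (Fin p), ∑ r : Fin p → Fin m,
        (if r ∘ σ = s then ((Equiv.Perm.sign σ : ℤ) : ℝ) else 0) • f (fun i ↦ b (r i)) =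
        f (fun i ↦ b (s i)) := by
      intro σ
      have h4 : ∀ r : Fin p → Fin m, r ∘ σ = s ↔ r = s ∘ σ.symm := fun r ↦
        ⟨fun h ↦ by rw [← h]; ext; simp, fun h ↦ by rw [h]; ext; simp⟩
      simp only [h4, ite_smul, zero_smul]
      rw [Finset.sum_ite_eq' Finset.univ]
      have h5 := f.map_perm (fun i ↦ b (s i)) σ.symm
      have h6 : (fun i ↦ b ((s ∘ σ.symm) i)) = (fun i ↦ b (s i)) ∘ σ.symm := rfl
      rw [h6, h5, if_pos (Finset.mem_univ _), Equiv.Perm.sign_symm]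
      rcases Int.units_eq_one_or (Equiv.Perm.sign σ) with hs | hs <;> simp [hs]
    simp only [h3]
    rw [Finset.sum_const, Finset.card_univ, Fintype.card_perm, Fintype.card_fin,
      Nat.cast_smul_eq_nsmul]
  refine Module.Basis.ext_alternating b fun s _ ↦ ?_
  rw [← key f s, hff, key]

/-- Left multiplication by a vector in `Λ E ⊗ A`. -/
lemma toGr_alternatizeUncurryFin (f : E →ₗ[ℝ] E [⋀^Fin p]→ₗ[ℝ] A) :
    toGr b (AlternatingMap.alternatizeUncurryFin f) =
      ∑ i : Fin m, (ExteriorAlgebra.ι ℝ (b i) ⊗ₜ[ℝ] (1 : A)) * toGr b (f (b i)) := by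
  have hne : ((p + 1 : ℕ) : ℝ) ≠ 0 := by positivity
  set G : (Fin (p + 1) → Fin m) → A := fun r ↦ f (b (r 0)) (fun i ↦ b (r i.succ)) with hG
  -- The cycle bringing position `j` to the front has sign `(-1)ʲ`, exactly the sign in the
  -- alternating sum. All `p + 1` terms therefore agree with the one for `j = 0`, which turns `1 /
  -- (p + 1)!` into `1 / p!`.
  have h1 : ∀ (j : Fin (p + 1)), ∑ r : Fin (p + 1) → Fin m,
      ExteriorAlgebra.ιMulti ℝ (p + 1) (fun i ↦ b (r i)) ⊗ₜ[ℝ] ((-1 : ℤ) ^ (j : ℕ) •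
        f (b (r j)) (Fin.removeNth j fun i ↦ b (r i))) =
      ∑ r : Fin (p + 1) → Fin m,
        ExteriorAlgebra.ιMulti ℝ (p + 1) (fun i ↦ b (r i)) ⊗ₜ[ℝ] G r := by
    intro j
    rw [← sum_ιMulti_tmul_perm b G (Fin.cycleRange j).symm]
    refine Finset.sum_congr rfl fun r _ ↦ ?_
    congr 1
    simp only [hG, Function.comp_apply, Fin.cycleRange_symm_zero, Fin.cycleRange_symm_succ,
      Equiv.Perm.sign_symm, Fin.sign_cycleRange]
    rcases neg_one_pow_eq_or ℤ (j : ℕ) with h | h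
    · have : ((-1 : ℤˣ) ^ (j : ℕ)) = 1 := by ext; simpa using h
      rw [h, this]; simp; rfl
    · have : ((-1 : ℤˣ) ^ (j : ℕ)) = -1 := by ext; simpa using h
      rw [h, this]; simp; rfl
  have h2 : toGr b (AlternatingMap.alternatizeUncurryFin f) = ((p ! : ℕ) : ℝ)⁻¹ •
      ∑ r : Fin (p + 1) → Fin m,
        ExteriorAlgebra.ιMulti ℝ (p + 1) (fun i ↦ b (r i)) ⊗ₜ[ℝ] G r := by
    rw [toGr]
    simp only [AlternatingMap.alternatizeUncurryFin_apply, TensorProduct.tmul_sum]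
    rw [Finset.sum_comm]
    simp only [h1]
    rw [Finset.sum_const, Finset.card_univ, Fintype.card_fin, ← Nat.cast_smul_eq_nsmul ℝ,
      Nat.factorial_succ, Nat.cast_mul, mul_inv, mul_comm, mul_smul, inv_smul_smul₀ hne]
  rw [h2]
  simp only [toGr, mul_smul_comm, ← Finset.smul_sum, Finset.mul_sum]
  congr 1
  rw [← Fintype.sum_prod_type']
  refine (Fintype.sum_equiv (Fin.consEquiv fun _ ↦ Fin m) _ _ fun r ↦ ?_).symm
  rw [Algebra.TensorProduct.tmul_mul_tmul, one_mul, ExteriorAlgebra.ιMulti_succ_apply]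
  simp [hG, Fin.consEquiv, Matrix.vecTail, Function.comp_def]

end Algebra

lemma two_le_smoothness : minSmoothness ℝ 2 ≤ (∞ : ℕ∞ω) := by
  rw [minSmoothness_of_isRCLikeNormedField]
  exact WithTop.coe_le_coe.2 (le_top : (2 : ℕ∞) ≤ ⊤)


/-! ### Chart transitions and coordinate vector fields -/

section Charts

variable {m : ℕ} {M : Type*} [TopologicalSpace M] [ChartedSpace (EuclideanSpace ℝ (Fin m)) M]

/-- The transition map from the preferred chart at `x` to the one at `x'`. -/
def chTr (x x' : M) : EuclideanSpace ℝ (Fin m) → EuclideanSpace ℝ (Fin m) :=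
  extChartAt (𝓡 m) x' ∘ (extChartAt (𝓡 m) x).symm

lemma isOpen_target (x : M) : IsOpen (extChartAt (𝓡 m) x).target := isOpen_extChartAt_target x

lemma isOpen_inter_preimage (x : M) {u : Set M} (hu : IsOpen u) :
    IsOpen ((extChartAt (𝓡 m) x).target ∩ (extChartAt (𝓡 m) x).symm ⁻¹' u) :=
  (continuousOn_extChartAt_symm x).isOpen_inter_preimage (isOpen_target x) hu

lemma eventually_symm_mem (x : M) {u : Set M} (hu : IsOpen u) {z : EuclideanSpace ℝ (Fin m)}
    (hz : z ∈ (extChartAt (𝓡 m) x).target) (hz' : (extChartAt (𝓡 m) x).symm z ∈ u) :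
    ∀ᶠ z' in 𝓝 z, z' ∈ (extChartAt (𝓡 m) x).target ∧ (extChartAt (𝓡 m) x).symm z' ∈ u :=
  (isOpen_inter_preimage x hu).mem_nhds ⟨hz, hz'⟩

lemma isOpen_source (x : M) : IsOpen (extChartAt (𝓡 m) x).source := isOpen_extChartAt_source x

variable {x x' : M} {z : EuclideanSpace ℝ (Fin m)}

lemma chTr_symm_apply (hz : z ∈ (extChartAt (𝓡 m) x).target)
    (hz' : (extChartAt (𝓡 m) x).symm z ∈ (extChartAt (𝓡 m) x').source) :
    chTr x' x (chTr x x' z) = z := by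
  rw [chTr, chTr, Function.comp_apply, Function.comp_apply, (extChartAt (𝓡 m) x').left_inv hz',
    (extChartAt (𝓡 m) x).right_inv hz]

lemma chTr_mem_target (hz' : (extChartAt (𝓡 m) x).symm z ∈ (extChartAt (𝓡 m) x').source) :
    chTr x x' z ∈ (extChartAt (𝓡 m) x').target :=
  (extChartAt (𝓡 m) x').map_source hz'

lemma symm_chTr (hz' : (extChartAt (𝓡 m) x).symm z ∈ (extChartAt (𝓡 m) x').source) :
    (extChartAt (𝓡 m) x').symm (chTr x x' z) = (extChartAt (𝓡 m) x).symm z :=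
  (extChartAt (𝓡 m) x').left_inv hz'

variable [IsManifold (𝓡 m) ∞ M]

lemma contDiffAt_chTr (hz : z ∈ (extChartAt (𝓡 m) x).target)
    (hz' : (extChartAt (𝓡 m) x).symm z ∈ (extChartAt (𝓡 m) x').source) :
    ContDiffAt ℝ ∞ (chTr x x') z := by
  have h := contDiffWithinAt_ext_coord_change (n := ∞) (I := 𝓡 m) x' x (y := z)
    ⟨hz, hz'⟩
  simpa [contDiffWithinAt_univ] using! h

lemma mdifferentiableAt_extChartAt_symm (hz : z ∈ (extChartAt (𝓡 m) x).target) :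
    MDifferentiableAt 𝓘(ℝ, EuclideanSpace ℝ (Fin m)) (𝓡 m) (extChartAt (𝓡 m) x).symm z :=
  (((contMDiffOn_extChartAt_symm (I := 𝓡 m) (n := ∞) x).contMDiffAt
    ((isOpen_target x).mem_nhds hz)).mdifferentiableAt (by simp))

variable (x z) in
/-- The derivative of the inverse of the preferred chart at `x`. -/
def chartD : EuclideanSpace ℝ (Fin m) →L[ℝ] EuclideanSpace ℝ (Fin m) :=
  mfderiv 𝓘(ℝ, EuclideanSpace ℝ (Fin m)) (𝓡 m) (extChartAt (𝓡 m) x).symm z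

lemma chartD_eq_comp (hz : z ∈ (extChartAt (𝓡 m) x).target)
    (hz' : (extChartAt (𝓡 m) x).symm z ∈ (extChartAt (𝓡 m) x').source) :
    chartD x z = (chartD x' (chTr x x' z)).comp (fderiv ℝ (chTr x x') z) := by
  have h1 : (extChartAt (𝓡 m) x).symm =ᶠ[𝓝 z] (extChartAt (𝓡 m) x').symm ∘ chTr x x' := by
    filter_upwards [eventually_symm_mem x (isOpen_source x') hz hz'] with z' h
    exact (symm_chTr h.2).symm
  rw [chartD, h1.mfderiv_eq, mfderiv_comp z
    (mdifferentiableAt_extChartAt_symm (chTr_mem_target hz'))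
    ((contDiffAt_chTr hz hz').differentiableAt (by simp)).mdifferentiableAt, mfderiv_eq_fderiv]
  rfl

/-- The tangent space at `x` is identified with the model space through the preferred chart at `x`
itself, so the derivative there is a coordinate change of the tangent bundle from a chart to itself.
-/
lemma chartD_self (x : M) : chartD x (extChartAt (𝓡 m) x x) = ContinuousLinearMap.id ℝ _ := by
  have h := TangentBundle.symmL_trivializationAt (I := 𝓡 m) (x₀ := x) (x := x)
    (mem_chart_source _ x)
  rw [TangentBundle.symmL_trivializationAt_eq_core (mem_chart_source _ x)] at h
  have h2 : chartD x (extChartAt (𝓡 m) x x) = mfderivWithin 𝓘(ℝ, EuclideanSpace ℝ (Fin m)) (𝓡 m)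
      (extChartAt (𝓡 m) x).symm (range (𝓡 m)) (extChartAt (𝓡 m) x x) := by
    rw [(𝓡 m).range_eq_univ, mfderivWithin_univ]
    rfl
  rw [h2]
  refine h.symm.trans ?_
  ext1 v
  exact (tangentBundleCore (𝓡 m) M).coordChange_self _ x (mem_chart_source _ x) v

lemma mfderiv_extChartAt_self (x : M) :
    mfderiv (𝓡 m) 𝓘(ℝ, EuclideanSpace ℝ (Fin m)) (extChartAt (𝓡 m) x) x =
      ContinuousLinearMap.id ℝ (EuclideanSpace ℝ (Fin m)) := by
  have h := TangentBundle.continuousLinearMapAt_trivializationAt (I := 𝓡 m) (x₀ := x) (x := x)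
    (mem_chart_source _ x)
  rw [TangentBundle.continuousLinearMapAt_trivializationAt_eq_core (mem_chart_source _ x)] at h
  refine h.symm.trans ?_
  ext1 v
  exact (tangentBundleCore (𝓡 m) M).coordChange_self _ x (mem_chart_source _ x) v

/-- The preferred trivialization of the tangent bundle is the derivative of the chart, and it is the
identity over the base point, so `extVec x w` is the coordinate field of the constant vector `w`. -/
lemma extVec_eq {y : M} (hy : y ∈ (extChartAt (𝓡 m) x).source) (w : EuclideanSpace ℝ (Fin m)) :
    extVec x w y = chartD x (extChartAt (𝓡 m) x y) w := by
  rw [extChartAt_source] at hy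
  have h := TangentBundle.symmL_trivializationAt (I := 𝓡 m) (x₀ := x) (x := y) hy
  have h2 : chartD x (extChartAt (𝓡 m) x y) = mfderivWithin 𝓘(ℝ, EuclideanSpace ℝ (Fin m)) (𝓡 m)
      (extChartAt (𝓡 m) x).symm (range (𝓡 m)) (extChartAt (𝓡 m) x y) := by
    rw [(𝓡 m).range_eq_univ, mfderivWithin_univ]
    rfl
  have h3 : (trivializationAt (EuclideanSpace ℝ (Fin m)) (TangentSpace (𝓡 m) : M → Type _)
      x).linearMapAt ℝ x w = w := by
    have h4 := TangentBundle.continuousLinearMapAt_trivializationAt_eq_core (I := 𝓡 m) (b₀ := x)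
      (b := x) (mem_chart_source _ x)
    exact (DFunLike.congr_fun h4 w).trans
      ((tangentBundleCore (𝓡 m) M).coordChange_self _ x (mem_chart_source _ x) w)
  rw [extVec, h3, h2]
  exact DFunLike.congr_fun h w

lemma extVec_self (x : M) (w : EuclideanSpace ℝ (Fin m)) : extVec x w x = w := by
  rw [extVec_eq (mem_extChartAt_source x), chartD_self]
  rfl

variable (x x' z) in
/-- The coordinates in the chart at `x'` of the vector field which is constant in the chart
at `x`. -/
def transD (w : EuclideanSpace ℝ (Fin m)) : EuclideanSpace ℝ (Fin m) :=
  fderiv ℝ (chTr x x') (chTr x' x z) w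

/-- The chain rule for `chartD`. It re-expands the coordinate fields centred at one point in those
of another, which is what moving the pointwise definitions to a fixed chart requires. -/
lemma extVec_eq_extVec_transD {y : M} (hy : y ∈ (extChartAt (𝓡 m) x).source)
    (hy' : y ∈ (extChartAt (𝓡 m) x').source) (w : EuclideanSpace ℝ (Fin m)) :
    extVec x w y = extVec x' (transD x x' (extChartAt (𝓡 m) x' y) w) y := by
  have h1 : chTr x' x (extChartAt (𝓡 m) x' y) = extChartAt (𝓡 m) x y := by
    rw [chTr, Function.comp_apply, (extChartAt (𝓡 m) x').left_inv hy']
  have h2 : chTr x x' (extChartAt (𝓡 m) x y) = extChartAt (𝓡 m) x' y := by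
    rw [chTr, Function.comp_apply, (extChartAt (𝓡 m) x).left_inv hy]
  rw [extVec_eq hy, extVec_eq hy', chartD_eq_comp (x' := x') ((extChartAt (𝓡 m) x).map_source hy)
    (by rwa [(extChartAt (𝓡 m) x).left_inv hy]), transD, h1, h2]
  rfl

lemma contDiffAt_transD (hz : z ∈ (extChartAt (𝓡 m) x').target)
    (hz' : (extChartAt (𝓡 m) x').symm z ∈ (extChartAt (𝓡 m) x).source)
    (w : EuclideanSpace ℝ (Fin m)) : ContDiffAt ℝ ∞ (fun z ↦ transD x x' z w) z := by
  have h1 := contDiffAt_chTr hz hz'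
  have h2 : ContDiffAt ℝ ∞ (chTr x x') (chTr x' x z) :=
    contDiffAt_chTr (chTr_mem_target hz')
      (by rw [symm_chTr hz']; exact (extChartAt (𝓡 m) x').map_target hz)
  have h3 : ContDiffAt ℝ ∞ (fderiv ℝ (chTr x x')) (chTr x' x z) := h2.fderiv_right le_rfl
  exact (h3.comp z h1).clm_apply contDiffAt_const

/-- The coordinate fields of a chart commute. -/
lemma fderiv_transD_comm (hz : z ∈ (extChartAt (𝓡 m) x').target)
    (hz' : (extChartAt (𝓡 m) x').symm z ∈ (extChartAt (𝓡 m) x).source)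
    (v w : EuclideanSpace ℝ (Fin m)) :
    fderiv ℝ (fun z ↦ transD x x' z w) z (transD x x' z v) =
      fderiv ℝ (fun z ↦ transD x x' z v) z (transD x x' z w) := by
  set z₀ := chTr x' x z with hz₀
  have h1 := contDiffAt_chTr hz hz'
  have h2 : ContDiffAt ℝ ∞ (chTr x x') z₀ :=
    contDiffAt_chTr (chTr_mem_target hz')
      (by rw [symm_chTr hz']; exact (extChartAt (𝓡 m) x').map_target hz)
  have h3 : DifferentiableAt ℝ (fderiv ℝ (chTr x x')) z₀ :=
    (h2.fderiv_right (m := ∞) le_rfl).differentiableAt (by simp)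
  -- The two transition maps are mutually inverse near `z₀`, hence so are their derivatives.
  have h4 : (fderiv ℝ (chTr x' x) z).comp (fderiv ℝ (chTr x x') z₀) =
      ContinuousLinearMap.id ℝ _ := by
    have h5 : chTr x' x ∘ chTr x x' =ᶠ[𝓝 z₀] id := by
      filter_upwards [eventually_symm_mem x (isOpen_source x') (chTr_mem_target hz')
        (by rw [symm_chTr hz']; exact (extChartAt (𝓡 m) x').map_target hz)] with z' h
      exact chTr_symm_apply h.1 h.2
    have h6 : chTr x x' z₀ = z := chTr_symm_apply hz hz'
    have h7 := h5.fderiv_eq (𝕜 := ℝ)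
    rw [fderiv_comp z₀ (by rw [h6]; exact h1.differentiableAt (by simp))
      (h2.differentiableAt (by simp)), h6, fderiv_id] at h7
    exact h7
  -- Differentiating gives `D²τ(Dτ⁻¹ ·, u)` for the transition map `τ`. Inserting `transD x x' z v =
  -- Dτ(v)` cancels `Dτ⁻¹`, and symmetry of `D²τ` finishes.
  have h8 : ∀ u, HasFDerivAt (fun z ↦ transD x x' z u)
      (((fderiv ℝ (fderiv ℝ (chTr x x')) z₀).comp (fderiv ℝ (chTr x' x) z)).flip u) z := by
    intro u
    have := (h3.hasFDerivAt.comp z (h1.differentiableAt (by simp)).hasFDerivAt).clm_apply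
      (hasFDerivAt_const u z)
    simpa using! this
  have hsymm : IsSymmSndFDerivAt ℝ (chTr x x') z₀ := h2.isSymmSndFDerivAt two_le_smoothness
  rw [(h8 w).fderiv, (h8 v).fderiv]
  have h9 : ∀ u, fderiv ℝ (chTr x' x) z (transD x x' z u) = u := fun u ↦ DFunLike.congr_fun h4 u
  simp only [ContinuousLinearMap.flip_apply, ContinuousLinearMap.comp_apply, h9]
  exact hsymm v w

/-! ### Functions and scalar forms in charts -/

variable {G : Type*} [NormedAddCommGroup G] [NormedSpace ℝ G] {p : ℕ}

lemma contMDiffAt_iff_comp_symm {f : M → G} {k : ℕ∞ω} [IsManifold (𝓡 m) k M]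
    (hz : z ∈ (extChartAt (𝓡 m) x).target) :
    ContMDiffAt (𝓡 m) 𝓘(ℝ, G) k f ((extChartAt (𝓡 m) x).symm z) ↔
      ContDiffAt ℝ k (f ∘ (extChartAt (𝓡 m) x).symm) z := by
  have h := (extChartAt (𝓡 m) x).map_target hz
  rw [extChartAt_source] at h
  rw [contMDiffAt_iff_source_of_mem_source h, (extChartAt (𝓡 m) x).right_inv hz]
  simp [contMDiffWithinAt_univ, contMDiffAt_iff_contDiffAt]

lemma mdifferentiableAt_iff_comp_symm {f : M → G} (hz : z ∈ (extChartAt (𝓡 m) x).target) :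
    MDifferentiableAt (𝓡 m) 𝓘(ℝ, G) f ((extChartAt (𝓡 m) x).symm z) ↔
      DifferentiableAt ℝ (f ∘ (extChartAt (𝓡 m) x).symm) z := by
  have h := (extChartAt (𝓡 m) x).map_target hz
  rw [extChartAt_source] at h
  rw [mdifferentiableAt_iff_source_of_mem_source h, (extChartAt (𝓡 m) x).right_inv hz]
  simp [mdifferentiableWithinAt_univ, mdifferentiableAt_iff_differentiableAt]

lemma DForm.rep_apply (α : DForm G m M p) (w : Fin p → EuclideanSpace ℝ (Fin m)) :
    α.rep x z w = α ((extChartAt (𝓡 m) x).symm z) (fun i ↦ chartD x z (w i)) := rfl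

lemma DForm.rep_eq_pullback (α : DForm G m M p) (hz : z ∈ (extChartAt (𝓡 m) x).target)
    (hz' : (extChartAt (𝓡 m) x).symm z ∈ (extChartAt (𝓡 m) x').source) :
    α.rep x z = (α.rep x' (chTr x x' z)).compContinuousLinearMap (fderiv ℝ (chTr x x') z) := by
  ext w
  rw [ContinuousAlternatingMap.compContinuousLinearMap_apply, DForm.rep_apply, DForm.rep_apply,
    symm_chTr hz', chartD_eq_comp hz hz']
  rfl

/-- The form `α.d` is computed at every point in a different chart. That a single chart suffices is
the naturality of `extDeriv` under the transition map. -/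
lemma DForm.rep_d (α : DForm G m M p) (hα : α.IsSmooth) (hz : z ∈ (extChartAt (𝓡 m) x).target) :
    α.d.rep x z = extDeriv (α.rep x) z := by
  set y := (extChartAt (𝓡 m) x).symm z with hy
  have hz' : (extChartAt (𝓡 m) x).symm z ∈ (extChartAt (𝓡 m) y).source := mem_extChartAt_source y
  have h1 : α.rep x =ᶠ[𝓝 z] fun z ↦
      (α.rep y (chTr x y z)).compContinuousLinearMap (fderiv ℝ (chTr x y) z) := by
    filter_upwards [eventually_symm_mem x (isOpen_source y) hz hz'] with z' h
    exact α.rep_eq_pullback h.1 h.2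
  have h2 : chTr x y z = extChartAt (𝓡 m) y y := rfl
  rw [h1.extDeriv_eq, extDeriv_pullback (r := ∞) (h2 ▸ hα.differentiableAt y)
    (contDiffAt_chTr hz hz') two_le_smoothness, α.d.rep_eq_pullback hz hz', h2]
  congr 1
  ext w
  have h3 : (extChartAt (𝓡 m) y).symm (extChartAt (𝓡 m) y y) = y := extChartAt_to_inv y
  rw [DForm.rep_apply, chartD_self, h3, DForm.d, mfderiv_extChartAt_self]
  rfl

end Charts

/-! ### Calculus for maps into finite dimensional spaces, tested on components -/

section FiniteDim

variable {H X Y Z : Type*} [NormedAddCommGroup H] [NormedSpace ℝ H] [NormedAddCommGroup X]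
  [NormedSpace ℝ X] [NormedAddCommGroup Y] [NormedSpace ℝ Y] [FiniteDimensional ℝ Y]
  [NormedAddCommGroup Z] [NormedSpace ℝ Z]

/-- Smoothness can be tested after composition with a separating finite family of linear maps to a
finite dimensional space. -/
lemma contDiffAt_of_separating {ι : Type*} [Finite ι] (L : ι → X →ₗ[ℝ] Y)
    (hL : ∀ a, (∀ i, L i a = 0) → a = 0) {k : ℕ∞ω} {f : H → X} {z : H}
    (hf : ∀ i, ContDiffAt ℝ k (fun z ↦ L i (f z)) z) : ContDiffAt ℝ k f z := by
  have := Fintype.ofFinite ι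
  have hinj : Function.Injective (LinearMap.pi L) := by
    rw [injective_iff_map_eq_zero]
    intro a ha
    exact hL a fun i ↦ congrFun ha i
  -- An injective linear map has a linear left inverse, which is continuous because its domain is
  -- finite dimensional; it rebuilds `f` from its components.
  obtain ⟨R, hR⟩ := (LinearMap.pi L).exists_leftInverse_of_injective (LinearMap.ker_eq_bot.2 hinj)
  have h1 : f = LinearMap.toContinuousLinearMap R ∘ fun z i ↦ L i (f z) := by
    funext z
    exact (DFunLike.congr_fun hR (f z)).symm
  rw [h1]
  exact (LinearMap.toContinuousLinearMap R).contDiff.contDiffAt.comp z (contDiffAt_pi.2 hf)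

/-- A bilinear map between finite dimensional spaces as a continuous bilinear map. -/
def bilinCLM [FiniteDimensional ℝ X] (B : X →ₗ[ℝ] Y →ₗ[ℝ] Z) : X →L[ℝ] Y →L[ℝ] Z :=
  LinearMap.toContinuousLinearMap
    ((LinearMap.toContinuousLinearMap : (Y →ₗ[ℝ] Z) ≃ₗ[ℝ] (Y →L[ℝ] Z)).toLinearMap ∘ₗ B)

lemma contDiffAt_bilin [FiniteDimensional ℝ X] (B : X →ₗ[ℝ] Y →ₗ[ℝ] Z) {k : ℕ∞ω} {f : H → X}
    {g : H → Y} {z : H} (hf : ContDiffAt ℝ k f z) (hg : ContDiffAt ℝ k g z) :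
    ContDiffAt ℝ k (fun z ↦ B (f z) (g z)) z :=
  ((bilinCLM B).contDiff.contDiffAt.comp z hf).clm_apply hg

lemma differentiableAt_bilin [FiniteDimensional ℝ X] (B : X →ₗ[ℝ] Y →ₗ[ℝ] Z) {f : H → X}
    {g : H → Y} {z : H} (hf : DifferentiableAt ℝ f z) (hg : DifferentiableAt ℝ g z) :
    DifferentiableAt ℝ (fun z ↦ B (f z) (g z)) z :=
  ((bilinCLM B).hasFDerivAt_of_bilinear hf.hasFDerivAt hg.hasFDerivAt).differentiableAt

lemma fderiv_bilin [FiniteDimensional ℝ X] (B : X →ₗ[ℝ] Y →ₗ[ℝ] Z) {f : H → X}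
    {g : H → Y} {z : H} (hf : DifferentiableAt ℝ f z) (hg : DifferentiableAt ℝ g z) (v : H) :
    fderiv ℝ (fun z ↦ B (f z) (g z)) z v = B (fderiv ℝ f z v) (g z) + B (f z) (fderiv ℝ g z v) := by
  have h := (bilinCLM B).hasFDerivAt_of_bilinear hf.hasFDerivAt hg.hasFDerivAt
  have h2 : fderiv ℝ (fun z ↦ B (f z) (g z)) z = _ := h.fderiv
  rw [h2, add_comm]
  rfl

lemma contDiffAt_alternatingMap {m p : ℕ} {k : ℕ∞ω} {z : H}
    {f : H → EuclideanSpace ℝ (Fin m) [⋀^Fin p]→L[ℝ] Y}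
    (hf : ∀ w, ContDiffAt ℝ k (fun z ↦ f z w) z) : ContDiffAt ℝ k f z := by
  let b := (EuclideanSpace.basisFun (Fin m) ℝ).toBasis
  refine contDiffAt_of_separating (ι := Fin p → Fin m)
    (fun r ↦ { toFun := fun a ↦ a fun i ↦ b (r i), map_add' := fun _ _ ↦ rfl,
               map_smul' := fun _ _ ↦ rfl }) (fun a ha ↦ ?_) (fun r ↦ hf _)
  have h : a.toAlternatingMap = 0 := Module.Basis.ext_alternating b fun r _ ↦ ha r
  ext w
  exact DFunLike.congr_fun h w

/-- Evaluation of a smooth family of alternating maps on smooth vector fields. -/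
lemma contDiffAt_alternatingMap_apply {m p : ℕ} {k : ℕ∞ω} {z : H}
    {f : H → EuclideanSpace ℝ (Fin m) [⋀^Fin p]→ₗ[ℝ] Z} {W : H → Fin p → EuclideanSpace ℝ (Fin m)}
    (hf : ∀ w, ContDiffAt ℝ k (fun z ↦ f z w) z) (hW : ∀ i, ContDiffAt ℝ k (fun z ↦ W z i) z) :
    ContDiffAt ℝ k (fun z ↦ f z (W z)) z := by
  have h : (fun z ↦ f z (W z)) = fun z ↦ ∑ r : Fin p → Fin m,
      (∏ i, W z i (r i)) • f z (fun i ↦ EuclideanSpace.single (r i) (1 : ℝ)) := by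
    funext z
    have hv : W z = fun i ↦ ∑ j, W z i j • EuclideanSpace.single j (1 : ℝ) := by
      funext i
      ext l
      simp [Finset.sum_apply, Pi.single_apply]
    conv_lhs => rw [hv]
    rw [← AlternatingMap.coe_multilinearMap, MultilinearMap.map_sum]
    refine Finset.sum_congr rfl fun r _ ↦ ?_
    rw [MultilinearMap.map_smul_univ]
  rw [h]
  refine ContDiffAt.sum fun r _ ↦ ContDiffAt.smul (contDiffAt_prod fun i _ ↦ ?_) (hf _)
  exact (EuclideanSpace.proj (𝕜 := ℝ) (r i)).contDiff.contDiffAt.comp z (hW i)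

end FiniteDim

/-! ### Coordinates in a vector bundle -/

section Coordinates

attribute [local instance] Matrix.linftyOpNormedRing Matrix.linftyOpNormedAlgebra

variable (𝕜 : Type*) [RCLike 𝕜] {m : ℕ}
  {M : Type*} [TopologicalSpace M] [ChartedSpace (EuclideanSpace ℝ (Fin m)) M]
  [IsManifold (𝓡 m) ∞ M]
  (F : Type*) [NormedAddCommGroup F] [NormedSpace ℝ F] [NormedSpace 𝕜 F]
  [IsScalarTower ℝ 𝕜 F] [FiniteDimensional 𝕜 F]
  {V : M → Type*} [TopologicalSpace (TotalSpace F V)]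
  [∀ x, AddCommGroup (V x)] [∀ x, Module ℝ (V x)] [∀ x, Module 𝕜 (V x)]
  [∀ x, IsScalarTower ℝ 𝕜 (V x)]
  [∀ x, TopologicalSpace (V x)] [∀ x, IsTopologicalAddGroup (V x)]
  [∀ x, ContinuousSMul ℝ (V x)]
  [FiberBundle F V] [VectorBundle ℝ F V] [VectorBundle 𝕜 F V] [ContMDiffVectorBundle ∞ F V (𝓡 m)]

/-- The index set of a basis of the model fibre. -/
abbrev Ix : Type := Fin (Module.finrank 𝕜 F)

/-- The coordinates of a vector in the fibre over `y`, in the preferred local frame at `x`. -/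
def coord (x y : M) : V y →ₗ[𝕜] (Ix 𝕜 F → 𝕜) :=
  (Module.finBasis 𝕜 F).equivFun.toLinearMap ∘ₗ (trivializationAt F V x).linearMapAt 𝕜 y

/-- The vector in the fibre over `y` with given coordinates in the preferred local frame at `x`. -/
def frame (x y : M) : (Ix 𝕜 F → 𝕜) →ₗ[𝕜] V y :=
  (trivializationAt F V x).symmₗ 𝕜 y ∘ₗ (Module.finBasis 𝕜 F).equivFun.symm.toLinearMap

variable {x y : M}

lemma coord_frame (hy : y ∈ (trivializationAt F V x).baseSet) (c : Ix 𝕜 F → 𝕜) :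
    coord 𝕜 F x y (frame 𝕜 F x y c : V y) = c := by
  simp only [coord, frame, LinearMap.comp_apply, LinearEquiv.coe_coe,
    Trivialization.linearMapAt_symmₗ _ hy, LinearEquiv.apply_symm_apply]

lemma frame_coord (hy : y ∈ (trivializationAt F V x).baseSet) (s : V y) :
    frame 𝕜 F x y (coord 𝕜 F x y s) = s := by
  simp [coord, frame, Trivialization.symmₗ_linearMapAt _ hy]

lemma coord_injective (hy : y ∈ (trivializationAt F V x).baseSet) :
    Function.Injective (coord 𝕜 F x y : V y → _) :=
  Function.LeftInverse.injective (frame_coord 𝕜 F hy)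

lemma extSec_eq_frame (s : V x) (y : M) : extSec F s y = frame 𝕜 F x y (coord 𝕜 F x x s) := by
  have hx := FiberBundle.mem_baseSet_trivializationAt' (F := F) (E := V) x
  simp only [frame, coord, LinearMap.comp_apply, LinearEquiv.coe_coe,
    LinearEquiv.symm_apply_apply]
  by_cases hy : y ∈ (trivializationAt F V x).baseSet
  · simp [extSec, hx, hy, Trivialization.linearMapAt_apply]
  · simp [extSec, hy]

/-- The matrix of an endomorphism of the fibre over `y` in the preferred local frame at `x`. -/
def matL (x y : M) : Module.End 𝕜 (V y) →ₗ[ℝ] Matrix (Ix 𝕜 F) (Ix 𝕜 F) 𝕜 where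
  toFun f := LinearMap.toMatrix' (coord 𝕜 F x y ∘ₗ f ∘ₗ frame 𝕜 F x y)
  map_add' f g := by
    rw [LinearMap.add_comp, LinearMap.comp_add, map_add]
  map_smul' c f := by
    ext i j
    simp only [LinearMap.toMatrix'_apply, LinearMap.comp_apply, LinearMap.smul_apply,
      RingHom.id_apply, Matrix.smul_apply]
    rw [LinearMap.map_smul_of_tower]
    rfl

lemma matL_mulVec (f : Module.End 𝕜 (V y)) (c : Ix 𝕜 F → 𝕜) :
    (matL 𝕜 F x y f).mulVec c = coord 𝕜 F x y (f (frame 𝕜 F x y c)) := by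
  exact LinearMap.toMatrix'_mulVec (coord 𝕜 F x y ∘ₗ f ∘ₗ frame 𝕜 F x y) c

lemma matL_mulVec_coord (hy : y ∈ (trivializationAt F V x).baseSet) (f : Module.End 𝕜 (V y))
    (s : V y) : (matL 𝕜 F x y f).mulVec (coord 𝕜 F x y s) = coord 𝕜 F x y (f s) := by
  rw [matL_mulVec, frame_coord 𝕜 F hy]

lemma matL_mul (hy : y ∈ (trivializationAt F V x).baseSet) (f g : Module.End 𝕜 (V y)) :
    matL 𝕜 F x y (f * g) = matL 𝕜 F x y f * matL 𝕜 F x y g := by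
  refine Matrix.ext_of_mulVec_single fun i ↦ ?_
  rw [← Matrix.mulVec_mulVec, matL_mulVec, matL_mulVec _ _ g, matL_mulVec_coord 𝕜 F hy]
  rfl

lemma matL_one (hy : y ∈ (trivializationAt F V x).baseSet) :
    matL 𝕜 F x y (1 : Module.End 𝕜 (V y)) = 1 := by
  refine Matrix.ext_of_mulVec_single fun i ↦ ?_
  rw [matL_mulVec, Module.End.one_apply, coord_frame 𝕜 F hy, Matrix.one_mulVec]

lemma matL_injective (hy : y ∈ (trivializationAt F V x).baseSet) :
    Function.Injective (matL 𝕜 F x y : Module.End 𝕜 (V y) → _) := by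
  intro f g hfg
  ext s
  apply coord_injective 𝕜 F hy
  rw [← matL_mulVec_coord 𝕜 F hy, hfg, matL_mulVec_coord 𝕜 F hy]

/-- Over the base set the frame gives a linear isomorphism, and the trace is invariant under
conjugation. -/
lemma trace_matL (hy : y ∈ (trivializationAt F V x).baseSet) (f : Module.End 𝕜 (V y)) :
    (matL 𝕜 F x y f).trace = LinearMap.trace 𝕜 (V y) f := by
  let e : V y ≃ₗ[𝕜] (Ix 𝕜 F → 𝕜) := LinearEquiv.ofLinearMap (coord 𝕜 F x y) (frame 𝕜 F x y)
    (LinearMap.ext (coord_frame 𝕜 F hy)) (LinearMap.ext (frame_coord 𝕜 F hy))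
  rw [← LinearMap.trace_conj' f e]
  refine (Matrix.trace_toLin'_eq (LinearMap.toMatrix' (coord 𝕜 F x y ∘ₗ f ∘ₗ frame 𝕜 F x y))).symm.trans ?_
  congr 1
  exact Matrix.toLin'_toMatrix' _

/-- The part of the target of the preferred chart at `x` over which the preferred local
trivialization at `x` is defined. -/
def dom (V : M → Type*) [TopologicalSpace (TotalSpace F V)] [∀ x, TopologicalSpace (V x)]
    [FiberBundle F V] (x : M) : Set (EuclideanSpace ℝ (Fin m)) :=
  (extChartAt (𝓡 m) x).target ∩ (extChartAt (𝓡 m) x).symm ⁻¹' (trivializationAt F V x).baseSet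

lemma isOpen_dom (x : M) : IsOpen (dom F V x : Set (EuclideanSpace ℝ (Fin m))) :=
  isOpen_inter_preimage x (trivializationAt F V x).open_baseSet

lemma mem_dom_self (x : M) : extChartAt (𝓡 m) x x ∈ dom F V x := by
  refine ⟨mem_extChartAt_target x, ?_⟩
  rw [mem_preimage, extChartAt_to_inv]
  exact FiberBundle.mem_baseSet_trivializationAt' x

/-- The coordinates of a section, in the preferred chart and the preferred local frame at `x`. -/
def secAt (x : M) (σ : Π y, V y) (z : EuclideanSpace ℝ (Fin m)) : Ix 𝕜 F → 𝕜 :=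
  coord 𝕜 F x ((extChartAt (𝓡 m) x).symm z) (σ ((extChartAt (𝓡 m) x).symm z))

/-- The coordinate isomorphism of the model fibre, as a continuous real linear map. -/
def fibreCLE : F ≃L[ℝ] (Ix 𝕜 F → 𝕜) :=
  haveI : FiniteDimensional ℝ F := FiniteDimensional.trans ℝ 𝕜 F
  ((Module.finBasis 𝕜 F).equivFun.restrictScalars ℝ).toContinuousLinearEquiv

lemma secAt_eventuallyEq {z : EuclideanSpace ℝ (Fin m)} (hz : z ∈ dom F V x) (σ : Π y, V y) :
    secAt 𝕜 F x σ =ᶠ[𝓝 z] fibreCLE 𝕜 F ∘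
      (fun y ↦ (trivializationAt F V x ⟨y, σ y⟩).2) ∘ (extChartAt (𝓡 m) x).symm := by
  filter_upwards [(isOpen_dom F x).mem_nhds hz] with z' hz'
  have h := hz'.2
  rw [mem_preimage] at h
  simp only [secAt, coord, LinearMap.comp_apply, Trivialization.linearMapAt_apply, if_pos h]
  rfl

/-- The bridge from the bundle to ordinary calculus: a trivialization, a chart and a linear
isomorphism of the model fibre all preserve smoothness in both directions. -/
lemma contMDiffAt_iff_secAt {k : ℕ∞ω} [IsManifold (𝓡 m) k M] [ContMDiffVectorBundle k F V (𝓡 m)]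
    {z : EuclideanSpace ℝ (Fin m)} (hz : z ∈ dom F V x) (σ : Π y, V y) :
    ContMDiffAt (𝓡 m) ((𝓡 m).prod 𝓘(ℝ, F)) k (fun y ↦ TotalSpace.mk' F y (σ y))
      ((extChartAt (𝓡 m) x).symm z) ↔ ContDiffAt ℝ k (secAt 𝕜 F x σ) z := by
  rw [(trivializationAt F V x).contMDiffAt_section_iff hz.2, contMDiffAt_iff_comp_symm hz.1,
    ← ContinuousLinearEquiv.comp_contDiffAt_iff (fibreCLE 𝕜 F)]
  exact ⟨fun h ↦ h.congr_of_eventuallyEq (secAt_eventuallyEq 𝕜 F hz σ),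
    fun h ↦ h.congr_of_eventuallyEq (secAt_eventuallyEq 𝕜 F hz σ).symm⟩

lemma mdifferentiableAt_iff_secAt {z : EuclideanSpace ℝ (Fin m)} (hz : z ∈ dom F V x)
    (σ : Π y, V y) :
    MDifferentiableAt (𝓡 m) ((𝓡 m).prod 𝓘(ℝ, F)) (fun y ↦ TotalSpace.mk' F y (σ y))
      ((extChartAt (𝓡 m) x).symm z) ↔ DifferentiableAt ℝ (secAt 𝕜 F x σ) z := by
  have : ContMDiffVectorBundle 1 F V (𝓡 m) := ContMDiffVectorBundle.of_le (n := ∞) (by simp)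
  rw [(trivializationAt F V x).mdifferentiableAt_section_iff _ _ hz.2,
    mdifferentiableAt_iff_comp_symm hz.1, (secAt_eventuallyEq 𝕜 F hz σ).differentiableAt_iff,
    ContinuousLinearEquiv.comp_differentiableAt_iff]

lemma secAt_frame_eventuallyEq {z : EuclideanSpace ℝ (Fin m)} (hz : z ∈ dom F V x)
    (c : Ix 𝕜 F → 𝕜) :
    secAt 𝕜 F x (fun y ↦ (frame 𝕜 F x y c : V y)) =ᶠ[𝓝 z] fun _ ↦ c := by
  filter_upwards [(isOpen_dom F x).mem_nhds hz] with z' hz'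
  exact coord_frame 𝕜 F hz'.2 c

lemma contMDiffAt_frame {k : ℕ∞ω} [IsManifold (𝓡 m) k M] [ContMDiffVectorBundle k F V (𝓡 m)]
    {z : EuclideanSpace ℝ (Fin m)} (hz : z ∈ dom F V x) (c : Ix 𝕜 F → 𝕜) :
    ContMDiffAt (𝓡 m) ((𝓡 m).prod 𝓘(ℝ, F)) k (fun y ↦ TotalSpace.mk' F y (frame 𝕜 F x y c : V y))
      ((extChartAt (𝓡 m) x).symm z) := by
  rw [contMDiffAt_iff_secAt 𝕜 F hz]
  exact contDiffAt_const.congr_of_eventuallyEq (secAt_frame_eventuallyEq 𝕜 F hz c)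

lemma mdifferentiableAt_frame {z : EuclideanSpace ℝ (Fin m)} (hz : z ∈ dom F V x)
    (c : Ix 𝕜 F → 𝕜) :
    MDifferentiableAt (𝓡 m) ((𝓡 m).prod 𝓘(ℝ, F))
      (fun y ↦ TotalSpace.mk' F y (frame 𝕜 F x y c : V y)) ((extChartAt (𝓡 m) x).symm z) :=
  (contMDiffAt_frame 𝕜 F (k := ∞) hz c).mdifferentiableAt (by simp)

/-- Multiplication of a matrix with a vector as a real bilinear map. -/
def mulVecₗ : Matrix (Ix 𝕜 F) (Ix 𝕜 F) 𝕜 →ₗ[ℝ] (Ix 𝕜 F → 𝕜) →ₗ[ℝ] (Ix 𝕜 F → 𝕜) :=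
  LinearMap.mk₂ ℝ (fun A c ↦ A.mulVec c) (fun A B c ↦ Matrix.add_mulVec A B c)
    (fun r A c ↦ Matrix.smul_mulVec r A c) (fun A c d ↦ Matrix.mulVec_add A c d)
    (fun r A c ↦ Matrix.mulVec_smul A r c)

variable {H : Type*} [NormedAddCommGroup H] [NormedSpace ℝ H] {z : H}
  {A : H → Matrix (Ix 𝕜 F) (Ix 𝕜 F) 𝕜} {c : H → Ix 𝕜 F → 𝕜}

lemma contDiffAt_matrix {k : ℕ∞ω} (hA : ∀ c, ContDiffAt ℝ k (fun z ↦ (A z).mulVec c) z) :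
    ContDiffAt ℝ k A z := by
  refine contDiffAt_of_separating (ι := Ix 𝕜 F)
    (fun j ↦ (mulVecₗ 𝕜 F).flip (Pi.single j 1)) (fun B hB ↦ ?_) (fun j ↦ hA _)
  refine Matrix.ext_of_mulVec_single fun i ↦ ?_
  rw [Matrix.zero_mulVec]
  exact hB i

lemma contDiffAt_mulVec {k : ℕ∞ω} (hA : ContDiffAt ℝ k A z) (hc : ContDiffAt ℝ k c z) :
    ContDiffAt ℝ k (fun z ↦ (A z).mulVec (c z)) z :=
  contDiffAt_bilin (mulVecₗ 𝕜 F) hA hc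

lemma fderiv_mulVec (hA : DifferentiableAt ℝ A z) (hc : DifferentiableAt ℝ c z) (v : H) :
    fderiv ℝ (fun z ↦ (A z).mulVec (c z)) z v =
      (fderiv ℝ A z v).mulVec (c z) + (A z).mulVec (fderiv ℝ c z v) :=
  fderiv_bilin (mulVecₗ 𝕜 F) hA hc v

end Coordinates

/-! ### Forms in coordinates -/

section FormCoordinates

attribute [local instance] Matrix.linftyOpNormedRing Matrix.linftyOpNormedAlgebra

variable {𝕜 : Type*} [RCLike 𝕜] {m : ℕ}
  {M : Type*} [TopologicalSpace M] [ChartedSpace (EuclideanSpace ℝ (Fin m)) M]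
  [IsManifold (𝓡 m) ∞ M]
  (F : Type*) [NormedAddCommGroup F] [NormedSpace ℝ F] [NormedSpace 𝕜 F]
  [IsScalarTower ℝ 𝕜 F] [FiniteDimensional 𝕜 F]
  {V : M → Type*} [TopologicalSpace (TotalSpace F V)]
  [∀ x, AddCommGroup (V x)] [∀ x, Module ℝ (V x)] [∀ x, Module 𝕜 (V x)]
  [∀ x, IsScalarTower ℝ 𝕜 (V x)]
  [∀ x, TopologicalSpace (V x)] [∀ x, IsTopologicalAddGroup (V x)]
  [∀ x, ContinuousSMul ℝ (V x)]
  [FiberBundle F V] [VectorBundle ℝ F V] [VectorBundle 𝕜 F V] [ContMDiffVectorBundle ∞ F V (𝓡 m)]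

variable {x : M} {p : ℕ} {z : EuclideanSpace ℝ (Fin m)}

/-- `extVec` as a linear map. -/
def extVecₗ (x y : M) : EuclideanSpace ℝ (Fin m) →ₗ[ℝ] EuclideanSpace ℝ (Fin m) where
  toFun v := extVec x v y
  map_add' v w := extVec_add x v w y
  map_smul' c v := extVec_smul x c v y

/-- The matrix-valued form which expresses an `End(V)`-valued form in the preferred chart and the
preferred local frame at `x`. -/
def formAt (lam : EndForm 𝕜 m V p) (x : M) (z : EuclideanSpace ℝ (Fin m)) :
    EuclideanSpace ℝ (Fin m) [⋀^Fin p]→ₗ[ℝ] Matrix (Ix 𝕜 F) (Ix 𝕜 F) 𝕜 :=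
  (matL 𝕜 F x ((extChartAt (𝓡 m) x).symm z)).compAlternatingMap
    ((lam ((extChartAt (𝓡 m) x).symm z)).compLinearMap (extVecₗ x ((extChartAt (𝓡 m) x).symm z)))

lemma formAt_apply (lam : EndForm 𝕜 m V p) (x : M) (z : EuclideanSpace ℝ (Fin m))
    (w : Fin p → EuclideanSpace ℝ (Fin m)) :
    formAt F lam x z w = matL 𝕜 F x ((extChartAt (𝓡 m) x).symm z)
      (lam ((extChartAt (𝓡 m) x).symm z)
        (fun i ↦ extVec x (w i) ((extChartAt (𝓡 m) x).symm z))) := rfl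

lemma formAt_self (lam : EndForm 𝕜 m V p) (x : M) (w : Fin p → EuclideanSpace ℝ (Fin m)) :
    formAt F lam x (extChartAt (𝓡 m) x x) w = matL 𝕜 F x x (lam x w) := by
  have h : (extChartAt (𝓡 m) x).symm (extChartAt (𝓡 m) x x) = x := extChartAt_to_inv x
  rw [formAt_apply, h]
  simp only [extVec_self]

lemma secAt_evalExt (lam : EndForm 𝕜 m V p) (x : M) (w : Fin p → EuclideanSpace ℝ (Fin m))
    (s : V x) (z : EuclideanSpace ℝ (Fin m)) :
    secAt 𝕜 F x (lam.evalExt F x w s) z = (formAt F lam x z w).mulVec (coord 𝕜 F x x s) := by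
  rw [formAt_apply, matL_mulVec, ← extSec_eq_frame]
  rfl

/-- Smoothness of `End(V)`-valued forms in terms of their coordinates. -/
lemma EndForm.isSmooth_iff (lam : EndForm 𝕜 m V p) : lam.IsSmooth F ↔
    ∀ (x : M) (w : Fin p → EuclideanSpace ℝ (Fin m)),
      ContDiffAt ℝ ∞ (fun z ↦ formAt F lam x z w) (extChartAt (𝓡 m) x x) := by
  have key : ∀ (x : M) (w : Fin p → EuclideanSpace ℝ (Fin m)) (s : V x),
      ContMDiffAt (𝓡 m) ((𝓡 m).prod 𝓘(ℝ, F)) ∞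
        (fun y ↦ TotalSpace.mk' F y (lam.evalExt F x w s y)) x ↔
      ContDiffAt ℝ ∞ (fun z ↦ (formAt F lam x z w).mulVec (coord 𝕜 F x x s))
        (extChartAt (𝓡 m) x x) := by
    intro x w s
    have h := contMDiffAt_iff_secAt 𝕜 F (m := m) (k := ∞) (mem_dom_self F (V := V) x) (lam.evalExt F x w s)
    rw [extChartAt_to_inv] at h
    rw [h]
    simp only [← secAt_evalExt]
  refine ⟨fun h x w ↦ contDiffAt_matrix 𝕜 F fun c ↦ ?_, fun h x w s ↦ ?_⟩
  · have h1 := (key x w (frame 𝕜 F x x c)).1 (h x w _)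
    rwa [coord_frame 𝕜 F (FiberBundle.mem_baseSet_trivializationAt' x)] at h1
  · exact (key x w s).2 (contDiffAt_mulVec 𝕜 F (h x w) contDiffAt_const)

lemma EndForm.IsSmooth.isDiffAt {lam : EndForm 𝕜 m V p} (h : lam.IsSmooth F) (x : M) :
    lam.IsDiffAt F x := fun w s ↦ (h x w s).mdifferentiableAt (by simp)

/-- `EndForm.IsSmooth` tests each point only in the chart and frame centred there. Off the centre of
the chart at `x`, the fields and sections constant at `x` are expanded in those constant at the new
point `y₀`, with smooth coefficients. -/
lemma EndForm.IsSmooth.contDiffAt_formAt {lam : EndForm 𝕜 m V p} (h : lam.IsSmooth F)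
    (hz : z ∈ dom F V x) (w : Fin p → EuclideanSpace ℝ (Fin m)) :
    ContDiffAt ℝ ∞ (fun z ↦ formAt F lam x z w) z := by
  set y₀ := (extChartAt (𝓡 m) x).symm z with hy₀
  have hx₀ : y₀ ∈ (extChartAt (𝓡 m) x).source := (extChartAt (𝓡 m) x).map_target hz.1
  have hinv : (extChartAt (𝓡 m) y₀).symm (extChartAt (𝓡 m) y₀ y₀) = y₀ := extChartAt_to_inv y₀
  refine contDiffAt_matrix 𝕜 F fun c ↦ ?_
  set σ : Π y, V y := fun y ↦ lam y (fun i ↦ extVec x (w i) y) (frame 𝕜 F x y c) with hσ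
  have h1 : (fun z ↦ (formAt F lam x z w).mulVec c) = secAt 𝕜 F x σ := by
    funext z'
    rw [formAt_apply, matL_mulVec]
    rfl
  rw [h1, ← contMDiffAt_iff_secAt 𝕜 F hz]
  have h2 := contMDiffAt_iff_secAt 𝕜 F (m := m) (k := ∞) (mem_dom_self F (V := V) y₀) σ
  rw [hinv] at h2
  rw [← hy₀, h2]
  have h3 := contMDiffAt_iff_secAt 𝕜 F (m := m) (k := ∞) (mem_dom_self F (V := V) y₀)
    (fun y ↦ frame 𝕜 F x y c)
  rw [hinv] at h3
  have h4 := h3.1 (contMDiffAt_frame 𝕜 F (k := ∞) hz c)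
  -- In the frame at `y₀` the section is a smooth family of matrices, evaluated on the smooth fields
  -- `transD` and applied to the smooth coordinates of the frame section at `x`.
  have h5 : secAt 𝕜 F y₀ σ =ᶠ[𝓝 (extChartAt (𝓡 m) y₀ y₀)] fun ζ ↦
      (formAt F lam y₀ ζ (fun i ↦ transD x y₀ ζ (w i))).mulVec
        (secAt 𝕜 F y₀ (fun y ↦ (frame 𝕜 F x y c : V y)) ζ) := by
    filter_upwards [(isOpen_dom F y₀).mem_nhds (mem_dom_self F (V := V) y₀),
      eventually_symm_mem y₀ (isOpen_source x) (mem_extChartAt_target y₀) (by rwa [hinv])]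
      with ζ hζ hζ'
    have h6 : (extChartAt (𝓡 m) y₀) ((extChartAt (𝓡 m) y₀).symm ζ) = ζ :=
      (extChartAt (𝓡 m) y₀).right_inv hζ'.1
    have h7 : ∀ i, extVec x (w i) ((extChartAt (𝓡 m) y₀).symm ζ) =
        extVec y₀ (transD x y₀ ζ (w i)) ((extChartAt (𝓡 m) y₀).symm ζ) := fun i ↦ by
      conv_rhs => rw [← h6]
      rw [h6]
      have := extVec_eq_extVec_transD (x' := y₀) hζ'.2
        ((extChartAt (𝓡 m) y₀).map_target hζ'.1) (w i)
      rwa [h6] at this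
    rw [formAt_apply, secAt, secAt, matL_mulVec_coord 𝕜 F hζ.2, hσ]
    simp only [h7]
  refine ContDiffAt.congr_of_eventuallyEq (contDiffAt_mulVec 𝕜 F ?_ h4) h5
  exact contDiffAt_alternatingMap_apply (fun w ↦ (EndForm.isSmooth_iff F lam).1 h y₀ w)
    fun i ↦ contDiffAt_transD (mem_extChartAt_target y₀) (by rwa [hinv]) (w i)

variable (𝕜) in
/-- The trace of matrices as a real linear map. -/
def traceₗ : Matrix (Ix 𝕜 F) (Ix 𝕜 F) 𝕜 →ₗ[ℝ] 𝕜 := Matrix.traceLinearMap _ ℝ 𝕜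

/-- A form is smooth if its expression in the preferred chart at each point is smooth at the
point. -/
lemma DForm.isSmooth_of_contDiffAt {G : Type*} [NormedAddCommGroup G] [NormedSpace ℝ G]
    [FiniteDimensional ℝ G] {α : DForm G m M p}
    (h : ∀ x, ContDiffAt ℝ ∞ (α.rep x) (extChartAt (𝓡 m) x x)) : α.IsSmooth := by
  intro x z hz
  refine ContDiffAt.contDiffWithinAt (contDiffAt_alternatingMap fun w ↦ ?_)
  set y := (extChartAt (𝓡 m) x).symm z with hy
  have hz' : (extChartAt (𝓡 m) x).symm z ∈ (extChartAt (𝓡 m) y).source := mem_extChartAt_source y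
  -- Near `z` the form is the pullback of its expression in the chart centred at `y`, where
  -- smoothness is known by assumption.
  have h1 : (fun z ↦ α.rep x z w) =ᶠ[𝓝 z] fun z ↦
      (α.rep y (chTr x y z)).toAlternatingMap (fun i ↦ fderiv ℝ (chTr x y) z (w i)) := by
    filter_upwards [eventually_symm_mem x (isOpen_source y) hz hz'] with z' h
    rw [α.rep_eq_pullback h.1 h.2]
    rfl
  refine ContDiffAt.congr_of_eventuallyEq (contDiffAt_alternatingMap_apply
    (f := fun z ↦ (α.rep y (chTr x y z)).toAlternatingMap)
    (W := fun z i ↦ fderiv ℝ (chTr x y) z (w i)) (fun w ↦ ?_) fun i ↦ ?_) h1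
  · have h2 : ContDiffAt ℝ ∞ (fun z ↦ α.rep y (chTr x y z)) z :=
      ContDiffAt.comp (g := α.rep y) (f := chTr x y) z (h y) (contDiffAt_chTr hz hz')
    exact (ContinuousAlternatingMap.apply ℝ _ G w).contDiff.contDiffAt.comp z h2
  · exact ((contDiffAt_chTr hz hz').fderiv_right (m := ∞) le_rfl).clm_apply contDiffAt_const

lemma EndForm.rep_tr (lam : EndForm 𝕜 m V p) (hz : z ∈ dom F V x)
    (w : Fin p → EuclideanSpace ℝ (Fin m)) :
    lam.tr.rep x z w = traceₗ 𝕜 F (formAt F lam x z w) := by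
  have h1 : (extChartAt (𝓡 m) x) ((extChartAt (𝓡 m) x).symm z) = z :=
    (extChartAt (𝓡 m) x).right_inv hz.1
  have h2 : ∀ i, extVec x (w i) ((extChartAt (𝓡 m) x).symm z) = chartD x z (w i) := fun i ↦ by
    rw [extVec_eq ((extChartAt (𝓡 m) x).map_target hz.1), h1]
  rw [DForm.rep_apply, formAt_apply]
  simp only [h2]
  exact (trace_matL 𝕜 F hz.2 _).symm

lemma rep_tr_eventuallyEq (lam : EndForm 𝕜 m V p) (hz : z ∈ dom F V x)
    (w : Fin p → EuclideanSpace ℝ (Fin m)) :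
    (fun z ↦ lam.tr.rep x z w) =ᶠ[𝓝 z] fun z ↦ traceₗ 𝕜 F (formAt F lam x z w) := by
  filter_upwards [(isOpen_dom F x).mem_nhds hz] with z' hz'
  exact lam.rep_tr F hz' w

lemma EndForm.IsSmooth.tr {lam : EndForm 𝕜 m V p} (h : lam.IsSmooth F) : lam.tr.IsSmooth := by
  refine DForm.isSmooth_of_contDiffAt fun x ↦ contDiffAt_alternatingMap fun w ↦ ?_
  refine ContDiffAt.congr_of_eventuallyEq ?_ (rep_tr_eventuallyEq F lam (mem_dom_self F x) w)
  exact (LinearMap.toContinuousLinearMap (traceₗ 𝕜 F)).contDiff.contDiffAt.comp _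
    ((EndForm.isSmooth_iff F lam).1 h x w)

end FormCoordinates

/-! ### Connections in coordinates -/

section ConnectionCoordinates

attribute [local instance] Matrix.linftyOpNormedRing Matrix.linftyOpNormedAlgebra

variable {𝕜 : Type*} [RCLike 𝕜] {m : ℕ}
  {M : Type*} [TopologicalSpace M] [ChartedSpace (EuclideanSpace ℝ (Fin m)) M]
  [IsManifold (𝓡 m) ∞ M]
  (F : Type*) [NormedAddCommGroup F] [NormedSpace ℝ F] [NormedSpace 𝕜 F]
  [IsScalarTower ℝ 𝕜 F] [FiniteDimensional 𝕜 F]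
  {V : M → Type*} [TopologicalSpace (TotalSpace F V)]
  [∀ x, AddCommGroup (V x)] [∀ x, Module ℝ (V x)] [∀ x, Module 𝕜 (V x)]
  [∀ x, IsScalarTower ℝ 𝕜 (V x)]
  [∀ x, TopologicalSpace (V x)] [∀ x, IsTopologicalAddGroup (V x)]
  [∀ x, ContinuousSMul ℝ (V x)]
  [FiberBundle F V] [VectorBundle ℝ F V] [VectorBundle 𝕜 F V] [ContMDiffVectorBundle ∞ F V (𝓡 m)]

variable {x : M} {p : ℕ} {z : EuclideanSpace ℝ (Fin m)}

/-- The connection matrix of a connection in the preferred chart and the preferred local frame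
at `x`. -/
def Connection.gam (D : Connection 𝕜 m F V) (x : M) (z w : EuclideanSpace ℝ (Fin m)) :
    Matrix (Ix 𝕜 F) (Ix 𝕜 F) 𝕜 :=
  Matrix.of fun i j ↦ coord 𝕜 F x ((extChartAt (𝓡 m) x).symm z)
    (D.cov (fun y ↦ frame 𝕜 F x y (Pi.single j 1)) ((extChartAt (𝓡 m) x).symm z)
      (extVec x w ((extChartAt (𝓡 m) x).symm z))) i

lemma coord_smul_real {y : M} (r : ℝ) (s : V y) : coord 𝕜 F x y (r • s) = r • coord 𝕜 F x y s :=
  LinearMap.map_smul_of_tower _ r s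

/-- The derivative of a function along a vector given by its coordinates in a chart. -/
lemma mfderiv_extVec {g : M → ℝ} (hz : z ∈ (extChartAt (𝓡 m) x).target)
    (hg : MDifferentiableAt (𝓡 m) 𝓘(ℝ, ℝ) g ((extChartAt (𝓡 m) x).symm z))
    (w : EuclideanSpace ℝ (Fin m)) :
    mvfderiv (𝓡 m) g ((extChartAt (𝓡 m) x).symm z) (extVec x w ((extChartAt (𝓡 m) x).symm z)) =
      fderiv ℝ (g ∘ (extChartAt (𝓡 m) x).symm) z w := by
  have h := mfderiv_comp z hg (mdifferentiableAt_extChartAt_symm hz)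
  rw [mfderiv_eq_fderiv] at h
  rw [h, extVec_eq ((extChartAt (𝓡 m) x).map_target hz), (extChartAt (𝓡 m) x).right_inv hz]
  rfl

/-- The local expression of a connection: `∇_w σ = ∂_w σ + Γ(w) σ`. -/
lemma Connection.coord_cov (D : Connection 𝕜 m F V) (hz : z ∈ dom F V x) {σ : Π y, V y}
    (hσ : MDifferentiableAt (𝓡 m) ((𝓡 m).prod 𝓘(ℝ, F)) (fun y ↦ TotalSpace.mk' F y (σ y))
      ((extChartAt (𝓡 m) x).symm z)) (w : EuclideanSpace ℝ (Fin m)) :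
    coord 𝕜 F x ((extChartAt (𝓡 m) x).symm z) (D.cov σ ((extChartAt (𝓡 m) x).symm z)
      (extVec x w ((extChartAt (𝓡 m) x).symm z))) =
      fderiv ℝ (secAt 𝕜 F x σ) z w + (D.gam F x z w).mulVec (secAt 𝕜 F x σ z) := by
  set y₀ := (extChartAt (𝓡 m) x).symm z with hy₀
  set u := extVec x w y₀ with hu
  let MD (σ : Π y, V y) : Prop := MDifferentiableAt (𝓡 m) ((𝓡 m).prod 𝓘(ℝ, F))
    (fun y ↦ TotalSpace.mk' F y (σ y)) y₀
  -- The formula is shown to be stable under sums, `𝕜`-scalars and real differentiable coefficients,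
  -- and to hold on the frame by definition of `gam`. Differentiability is carried along because the
  -- rules for `∇` require it.
  let P (σ : Π y, V y) : Prop := MD σ ∧ coord 𝕜 F x y₀ (D.cov σ y₀ u) =
    fderiv ℝ (secAt 𝕜 F x σ) z w + (D.gam F x z w).mulVec (secAt 𝕜 F x σ z)
  have hMD : ∀ σ : Π y, V y, MD σ ↔ DifferentiableAt ℝ (secAt 𝕜 F x σ) z :=
    mdifferentiableAt_iff_secAt 𝕜 F hz
  have Padd : ∀ σ τ : Π y, V y, P σ → P τ → P (fun y ↦ σ y + τ y) := by
    rintro σ τ ⟨h1, h2⟩ ⟨h3, h4⟩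
    have h5 : secAt 𝕜 F x (m := m) (fun y ↦ σ y + τ y) = secAt 𝕜 F x σ + secAt 𝕜 F x τ := by
      funext z; exact _root_.map_add _ _ _
    have h1' := (hMD _).1 h1
    have h3' := (hMD _).1 h3
    refine ⟨(hMD _).2 (h5 ▸ h1'.add h3'), ?_⟩
    rw [D.map_add F h1 h3, _root_.map_add, h2, h4, h5, fderiv_add h1' h3', Pi.add_apply,
      Matrix.mulVec_add, add_apply]
    abel
  have Psmul : ∀ (c : 𝕜) (σ : Π y, V y), P σ → P (fun y ↦ c • σ y) := by
    rintro c σ ⟨h1, h2⟩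
    have h5 : secAt 𝕜 F x (m := m) (fun y ↦ c • σ y) = c • secAt 𝕜 F x σ := by
      funext z; exact _root_.map_smul _ _ _
    have h1' := (hMD _).1 h1
    refine ⟨(hMD _).2 (h5 ▸ h1'.const_smul c), ?_⟩
    rw [D.map_smul_cov F c h1, _root_.map_smul, h2, h5, fderiv_const_smul h1', Pi.smul_apply,
      Matrix.mulVec_smul, smul_add]
    rfl
  have Pfun : ∀ (g : M → ℝ) (σ : Π y, V y),
      DifferentiableAt ℝ (g ∘ (extChartAt (𝓡 m) x).symm) z → P σ → P (fun y ↦ g y • σ y) := by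
    rintro g σ hg ⟨h1, h2⟩
    have h5 : secAt 𝕜 F x (fun y ↦ g y • σ y) =
        fun z ↦ (g ∘ (extChartAt (𝓡 m) x).symm) z • secAt 𝕜 F x σ z := by
      funext z; exact coord_smul_real F _ _
    have h1' := (hMD _).1 h1
    have hg' : MDifferentiableAt (𝓡 m) 𝓘(ℝ, ℝ) g y₀ :=
      (mdifferentiableAt_iff_comp_symm hz.1).2 hg
    refine ⟨(hMD _).2 (h5 ▸ hg.smul h1'), ?_⟩
    have h7 := mfderiv_extVec hz.1 hg' w
    have h6 : D.cov (fun y ↦ g y • σ y) y₀ u =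
        g y₀ • D.cov σ y₀ u + (fderiv ℝ (g ∘ (extChartAt (𝓡 m) x).symm) z w) • σ y₀ := by
      rw [← h7]
      exact DFunLike.congr_fun (D.isCovariantDerivativeOnUniv.leibniz h1 hg') u
    rw [h6, _root_.map_add, coord_smul_real, coord_smul_real, h2, h5, fderiv_fun_smul hg h1',
      smul_add, Matrix.mulVec_smul]
    simp only [add_apply, smul_apply, ContinuousLinearMap.smulRight_apply,
      Function.comp_apply]
    rw [add_right_comm]
    rfl
  have Pframe : ∀ j, P (fun y ↦ frame 𝕜 F x y (Pi.single j 1)) := by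
    intro j
    have h1 := secAt_frame_eventuallyEq 𝕜 F hz (Pi.single j 1)
    refine ⟨mdifferentiableAt_frame 𝕜 F hz _, ?_⟩
    rw [h1.fderiv_eq, h1.eq_of_nhds, fderiv_fun_const, Matrix.mulVec_single_one]
    simp only [Pi.zero_apply, zero_apply, zero_add]
    rfl
  have Psum : ∀ (s : Finset (Ix 𝕜 F)) (τ : Ix 𝕜 F → Π y, V y), (∀ j, P (τ j)) →
      P (fun y ↦ ∑ j ∈ s, τ j y) := by
    intro s τ hτ
    induction s using Finset.cons_induction with
    | empty =>
      have h5 : secAt 𝕜 F x (m := m) (fun y ↦ (0 : V y)) = fun _ ↦ 0 := by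
        funext z; exact _root_.map_zero _
      simp only [Finset.sum_empty]
      refine ⟨(hMD _).2 (h5 ▸ differentiableAt_const _), ?_⟩
      rw [D.map_zero, h5]
      simp
    | cons a s ha ih =>
      simp only [Finset.sum_cons]
      exact Padd _ _ (hτ a) ih
  have hσ' := (hMD σ).1 hσ
  have hcomp : ∀ j, DifferentiableAt ℝ (fun z ↦ secAt 𝕜 F x σ z j) z := differentiableAt_pi.1 hσ'
  let f (j : Ix 𝕜 F) (y : M) : 𝕜 := coord 𝕜 F x y (σ y) j
  -- The Leibniz rule of `∇` is stated for real functions only, so each coefficient is split into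
  -- real and imaginary parts and the constant `I` is moved through by `𝕜`-linearity.
  let τ : Π y, V y := fun y ↦ ∑ j, (RCLike.re (f j y) • frame 𝕜 F x y (Pi.single j 1) +
    RCLike.im (f j y) • ((RCLike.I : 𝕜) • frame 𝕜 F x y (Pi.single j 1)))
  have hP : P τ := by
    refine Psum Finset.univ _ fun j ↦ Padd _ _ (Pfun _ _ ?_ (Pframe j))
      (Pfun _ _ ?_ (Psmul _ _ (Pframe j)))
    · exact (RCLike.reCLM (K := 𝕜)).differentiableAt.comp z (hcomp j)
    · exact (RCLike.imCLM (K := 𝕜)).differentiableAt.comp z (hcomp j)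
  have hτ : ∀ y ∈ (trivializationAt F V x).baseSet, σ y = τ y := by
    intro y hy
    have h1 : ∀ (r : ℝ) (s : V y), r • s = (r : 𝕜) • s := fun r s ↦ by
      rw [← algebraMap_smul 𝕜 r s, RCLike.algebraMap_eq_ofReal]
    simp only [τ, h1, smul_smul, ← add_smul, RCLike.re_add_im]
    rw [← frame_coord 𝕜 F hy (σ y)]
    conv_lhs => rw [pi_eq_sum_univ' (coord 𝕜 F x y (σ y)), _root_.map_sum]
    refine Finset.sum_congr rfl fun j _ ↦ ?_
    rw [_root_.map_smul]
  have h1 : ∀ᶠ y in 𝓝 y₀, σ y = τ y := by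
    filter_upwards [(trivializationAt F V x).open_baseSet.mem_nhds hz.2] with y hy
    exact hτ y hy
  have h2 : secAt 𝕜 F x σ =ᶠ[𝓝 z] secAt 𝕜 F x τ := by
    filter_upwards [(isOpen_dom F x).mem_nhds hz] with z' hz'
    rw [secAt, secAt, hτ _ hz'.2]
  rw [D.cov_congr F hσ h1, h2.fderiv_eq, h2.eq_of_nhds]
  exact hP.2

end ConnectionCoordinates

/-! ### Smooth connections -/

section SmoothConnections

attribute [local instance] Matrix.linftyOpNormedRing Matrix.linftyOpNormedAlgebra

variable {𝕜 : Type*} [RCLike 𝕜] {m : ℕ}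
  {M : Type*} [TopologicalSpace M] [ChartedSpace (EuclideanSpace ℝ (Fin m)) M]
  [IsManifold (𝓡 m) ∞ M]
  (F : Type*) [NormedAddCommGroup F] [NormedSpace ℝ F] [NormedSpace 𝕜 F]
  [IsScalarTower ℝ 𝕜 F] [FiniteDimensional 𝕜 F]
  {V : M → Type*} [TopologicalSpace (TotalSpace F V)]
  [∀ x, AddCommGroup (V x)] [∀ x, Module ℝ (V x)] [∀ x, Module 𝕜 (V x)]
  [∀ x, IsScalarTower ℝ 𝕜 (V x)]
  [∀ x, TopologicalSpace (V x)] [∀ x, IsTopologicalAddGroup (V x)]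
  [∀ x, ContinuousSMul ℝ (V x)]
  [FiberBundle F V] [VectorBundle ℝ F V] [VectorBundle 𝕜 F V] [ContMDiffVectorBundle ∞ F V (𝓡 m)]

variable {x : M} {p : ℕ} {z : EuclideanSpace ℝ (Fin m)}

lemma contMDiffAt_symmₗ (c : F) {y : M}
    (hy : y ∈ (trivializationAt F V x).baseSet) :
    ContMDiffAt (𝓡 m) ((𝓡 m).prod 𝓘(ℝ, F)) ∞
      (fun y ↦ TotalSpace.mk' F y ((trivializationAt F V x).symmₗ ℝ y c)) y := by
  refine ((trivializationAt F V x).contMDiffAt_section_iff (IB := 𝓡 m)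
    (s := fun y ↦ (trivializationAt F V x).symmₗ ℝ y c) hy).2 ?_
  refine (contMDiffAt_const (c := c)).congr_of_eventuallyEq ?_
  filter_upwards [(trivializationAt F V x).open_baseSet.mem_nhds hy] with y' h'
  have h2 := (trivializationAt F V x).linearMapAt_symmₗ (R := ℝ) h' c
  rwa [Trivialization.linearMapAt_apply, if_pos h'] at h2

lemma contMDiffAt_extVec (w : EuclideanSpace ℝ (Fin m)) {y : M}
    (hy : y ∈ (extChartAt (𝓡 m) x).source) :
    ContMDiffAt (𝓡 m) ((𝓡 m).prod 𝓘(ℝ, EuclideanSpace ℝ (Fin m))) ∞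
      (fun y ↦ TotalSpace.mk' (EuclideanSpace ℝ (Fin m)) (E := (TangentSpace (𝓡 m) : M → Type _))
        y (extVec x w y)) y := by
  rw [extChartAt_source] at hy
  exact contMDiffAt_symmₗ (EuclideanSpace ℝ (Fin m)) (V := (TangentSpace (𝓡 m) : M → Type _)) _ hy

lemma linearMapAt_tangent_self (x : M) (w : EuclideanSpace ℝ (Fin m)) :
    (trivializationAt (EuclideanSpace ℝ (Fin m)) (TangentSpace (𝓡 m) : M → Type _) x).linearMapAt
      ℝ x w = w := by
  have h := TangentBundle.continuousLinearMapAt_trivializationAt (I := 𝓡 m) (x₀ := x) (x := x)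
    (mem_chart_source _ x)
  rw [mfderiv_extChartAt_self] at h
  exact DFunLike.congr_fun h w

/-- The sections `∇_W σ` for a smooth connection, a smooth section `σ` and a coordinate field `W`
are smooth. -/
lemma Connection.IsSmooth.contMDiffAt_cov {D : Connection 𝕜 m F V} (hD : D.IsSmooth)
    {σ : Π y, V y} (hσ : ContMDiff (𝓡 m) ((𝓡 m).prod 𝓘(ℝ, F)) ∞
      (fun y ↦ TotalSpace.mk' F y (σ y))) (w : EuclideanSpace ℝ (Fin m)) {y : M}
    (hy : y ∈ (extChartAt (𝓡 m) x).source) :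
    ContMDiffAt (𝓡 m) ((𝓡 m).prod 𝓘(ℝ, F)) ∞
      (fun y ↦ TotalSpace.mk' F y (D.cov σ y (extVec x w y))) y := by
  have h1 := (hD.contMDiff.contMDiff (σ := σ) (contMDiffOn_univ.2 hσ)).contMDiffAt
    (x := y) univ_mem
  exact ContMDiffAt.clm_bundle_apply (F₁ := EuclideanSpace ℝ (Fin m))
    (E₁ := (TangentSpace (𝓡 m) : M → Type _)) h1 (contMDiffAt_extVec w hy)

/-- A smooth connection is known to act well on global smooth sections, whereas the frame is local.
A bump function extends the frame globally without changing it near the point, and `∇` is local. -/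
lemma Connection.IsSmooth.contDiffAt_gam [T2Space M] {D : Connection 𝕜 m F V} (hD : D.IsSmooth)
    (hz : z ∈ dom F V x) (w : EuclideanSpace ℝ (Fin m)) :
    ContDiffAt ℝ ∞ (fun z ↦ D.gam F x z w) z := by
  set y₀ := (extChartAt (𝓡 m) x).symm z with hy₀
  set u := (trivializationAt F V x).baseSet ∩ (extChartAt (𝓡 m) x).source with hu
  have hopen : IsOpen u := (trivializationAt F V x).open_baseSet.inter (isOpen_source x)
  have hy₀u : y₀ ∈ u := ⟨hz.2, (extChartAt (𝓡 m) x).map_target hz.1⟩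
  obtain ⟨ψ, -, hψ⟩ := (SmoothBumpFunction.nhds_basis_tsupport (I := 𝓡 m) y₀).mem_iff.1
    (hopen.mem_nhds hy₀u)
  have hcol : ∀ j, ContDiffAt ℝ ∞ (fun z ↦ (D.gam F x z w).mulVec (Pi.single j 1)) z := by
    intro j
    have hfr : ContMDiffOn (𝓡 m) ((𝓡 m).prod 𝓘(ℝ, F)) ∞
        (fun y ↦ TotalSpace.mk' F y (frame 𝕜 F x y (Pi.single j 1) : V y)) u := by
      intro y hy
      have h1 : (extChartAt (𝓡 m) x).symm (extChartAt (𝓡 m) x y) = y :=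
        (extChartAt (𝓡 m) x).left_inv hy.2
      have h2 := contMDiffAt_frame 𝕜 F (V := V) (k := ∞) (x := x) (z := extChartAt (𝓡 m) x y)
        ⟨(extChartAt (𝓡 m) x).map_source hy.2, by rw [mem_preimage, h1]; exact hy.1⟩
        (Pi.single j 1)
      rw [h1] at h2
      exact h2.contMDiffWithinAt
    have hσ := ContMDiffOn.smul_section_of_tsupport ψ.contMDiff.contMDiffOn hopen hψ hfr
    have h3 := hD.contMDiffAt_cov F hσ w hy₀u.2
    refine ((contMDiffAt_iff_secAt 𝕜 F hz _).1 h3).congr_of_eventuallyEq ?_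
    -- Locality of `∇` at a nearby `y` needs equality of germs at `y`, hence the two nested
    -- neighbourhoods.
    have h4 : ∀ᶠ y in 𝓝 y₀, ∀ᶠ y' in 𝓝 y, frame 𝕜 F x y' (Pi.single j 1) =
        ((ψ : M → ℝ) • fun y ↦ (frame 𝕜 F x y (Pi.single j 1) : V y)) y' := by
      refine eventually_eventually_nhds.2 ?_
      filter_upwards [ψ.eventuallyEq_one] with y hy
      rw [Pi.smul_apply', hy, Pi.one_apply, one_smul]
    filter_upwards [(continuousAt_extChartAt_symm'' hz.1).eventually h4,
      (isOpen_dom F x).mem_nhds hz] with z' hz' hz''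
    rw [Matrix.mulVec_single_one, secAt,
      ← D.cov_congr F (mdifferentiableAt_frame 𝕜 F hz'' _) hz']
    rfl
  refine contDiffAt_matrix 𝕜 F fun c ↦ ?_
  have h5 : (fun z ↦ (D.gam F x z w).mulVec c) = fun z ↦
      ∑ j, (LinearMap.mulLeft ℝ (c j)).compLeft _ ((D.gam F x z w).mulVec (Pi.single j 1)) := by
    funext z'
    conv_lhs => rw [pi_eq_sum_univ' c, Matrix.mulVec_sum]
    refine Finset.sum_congr rfl fun j _ ↦ ?_
    rw [Matrix.mulVec_smul]
    rfl
  rw [h5]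
  exact ContDiffAt.sum fun j _ ↦ (LinearMap.toContinuousLinearMap
    ((LinearMap.mulLeft ℝ (c j)).compLeft (Ix 𝕜 F))).contDiff.contDiffAt.comp z (hcol j)

/-- A connection is smooth if its connection matrices are. -/
lemma Connection.isSmooth_of_gam {D : Connection 𝕜 m F V}
    (h : ∀ (x : M) (w : EuclideanSpace ℝ (Fin m)),
      ContDiffAt ℝ ∞ (fun z ↦ D.gam F x z w) (extChartAt (𝓡 m) x x)) : D.IsSmooth := by
  refine ⟨⟨fun {σ} hσ x _ ↦ ContMDiffAt.contMDiffWithinAt ?_⟩⟩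
  have hσ' : ContMDiff (𝓡 m) ((𝓡 m).prod 𝓘(ℝ, F)) ∞ (fun y ↦ TotalSpace.mk' F y (σ y)) :=
    contMDiffOn_univ.1 hσ
  refine (contMDiffAt_hom_bundle (F₁ := EuclideanSpace ℝ (Fin m))
    (E₁ := (TangentSpace (𝓡 m) : M → Type _)) (E₂ := V) _).2 ⟨contMDiffAt_id, ?_⟩
  have : FiniteDimensional ℝ F := FiniteDimensional.trans ℝ 𝕜 F
  have hx : (extChartAt (𝓡 m) x).symm (extChartAt (𝓡 m) x x) = x := extChartAt_to_inv x
  have h0 := mem_dom_self F (V := V) (m := m) x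
  have h1 : ∀ g : M → EuclideanSpace ℝ (Fin m) →L[ℝ] F, ContMDiffAt (𝓡 m)
      𝓘(ℝ, EuclideanSpace ℝ (Fin m) →L[ℝ] F) ∞ g x ↔
      ContDiffAt ℝ ∞ (g ∘ (extChartAt (𝓡 m) x).symm) (extChartAt (𝓡 m) x x) := fun g ↦ by
    rw [← contMDiffAt_iff_comp_symm (mem_extChartAt_target x), hx]
  -- In the trivialization of `Hom(TM, V)`, smoothness of the linear map `∇σ` is tested on the
  -- standard basis vectors, that is, on the coordinate fields.
  refine (h1 _).2 (contDiffAt_of_separating (ι := Fin m)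
    (fun i ↦ (ContinuousLinearMap.apply ℝ F (EuclideanSpace.single i (1 : ℝ)) :
      (EuclideanSpace ℝ (Fin m) →L[ℝ] F) →ₗ[ℝ] F)) (fun a ha ↦ ?_) fun i ↦ ?_)
  · ext1 v
    have := (EuclideanSpace.basisFun (Fin m) ℝ).toBasis.ext (f₁ := a.toLinearMap) (f₂ := 0)
      (fun i ↦ by simpa using ha i)
    exact DFunLike.congr_fun this v
  · set w := EuclideanSpace.single i (1 : ℝ) with hw
    -- The local formula `∂_w σ + Γ(w) σ` is smooth in `z`; the rest identifies it with the
    -- coordinate expression of `∇σ` in the trivializations.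
    have h2 : ContDiffAt ℝ ∞ (fun z ↦ (fibreCLE 𝕜 F).symm (fderiv ℝ (secAt 𝕜 F x σ) z w +
        (D.gam F x z w).mulVec (secAt 𝕜 F x σ z))) (extChartAt (𝓡 m) x x) := by
      have h3 : ContDiffAt ℝ ∞ (secAt 𝕜 F x σ) (extChartAt (𝓡 m) x x) := by
        rw [← contMDiffAt_iff_secAt 𝕜 F h0]
        exact hσ' _
      exact (fibreCLE 𝕜 F).symm.contDiff.contDiffAt.comp _
        (((h3.fderiv_right (m := ∞) le_rfl).clm_apply contDiffAt_const).add
          (contDiffAt_mulVec 𝕜 F (h x w) h3))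
    refine h2.congr_of_eventuallyEq ?_
    filter_upwards [(isOpen_dom F x).mem_nhds h0] with z hz
    rw [← D.coord_cov F hz ((hσ' _).mdifferentiableAt (by simp)), ContinuousLinearEquiv.eq_symm_apply]
    have hz2 : (extChartAt (𝓡 m) x).symm z ∈ (trivializationAt (EuclideanSpace ℝ (Fin m))
        (TangentSpace (𝓡 m) : M → Type _) x).baseSet := by
      have := (extChartAt (𝓡 m) x).map_target hz.1
      rwa [extChartAt_source] at this
    simp only [Function.comp_apply]
    rw [ContinuousLinearMap.inCoordinates_eq hz2 hz.2]
    have hz3 : (extChartAt (𝓡 m) x).symm z ∈ (trivializationAt F V x).baseSet := hz.2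
    simp only [coord, LinearMap.comp_apply, Trivialization.linearMapAt_apply, if_pos hz3]
    rw [extVec, linearMapAt_tangent_self]
    change (Module.finBasis 𝕜 F).equivFun (Trivialization.continuousLinearEquivAt ℝ
      (trivializationAt F V x) _ hz3 (D.cov σ _ ((Trivialization.continuousLinearEquivAt ℝ
        (trivializationAt (EuclideanSpace ℝ (Fin m)) (TangentSpace (𝓡 m)) x) _ hz2).symm w))) = _
    have h4 := congr_fun (Trivialization.symm_continuousLinearEquivAt_eq (R := ℝ)
      (trivializationAt (EuclideanSpace ℝ (Fin m)) (TangentSpace (𝓡 m) : M → Type _) x) hz2) w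
    exact congrArg (fun u ↦ (Module.finBasis 𝕜 F).equivFun
      (trivializationAt F V x ⟨_, D.cov σ _ u⟩).2) h4

lemma Connection.gam_addForm (D : Connection 𝕜 m F V) (γ : EndForm 𝕜 m V 1)
    (w : EuclideanSpace ℝ (Fin m)) :
    (D.addForm F γ).gam F x z w = D.gam F x z w + formAt F γ x z (fun _ ↦ w) := by
  refine Matrix.ext_of_mulVec_single fun j ↦ ?_
  rw [Matrix.add_mulVec, formAt_apply, matL_mulVec, Matrix.mulVec_single_one,
    Matrix.mulVec_single_one]
  exact _root_.map_add (coord 𝕜 F x ((extChartAt (𝓡 m) x).symm z)) _ _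

lemma Connection.IsSmooth.addForm [T2Space M] {D : Connection 𝕜 m F V} (hD : D.IsSmooth)
    {γ : EndForm 𝕜 m V 1} (hγ : γ.IsSmooth F) : (D.addForm F γ).IsSmooth := by
  refine Connection.isSmooth_of_gam F fun x w ↦ ?_
  have h0 := mem_dom_self F (V := V) (m := m) x
  refine ((hD.contDiffAt_gam F h0 w).add (hγ.contDiffAt_formAt F h0 fun _ ↦ w)).congr_of_eventuallyEq ?_
  filter_upwards [(isOpen_dom F x).mem_nhds h0] with z _
  exact D.gam_addForm F γ w

end SmoothConnections

/-! ### The exterior covariant derivative in coordinates -/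

section AltWedgeDerivative

variable {H E A : Type*} [NormedAddCommGroup H] [NormedSpace ℝ H] [AddCommGroup E] [Module ℝ E]
  [NormedRing A] [NormedAlgebra ℝ A] {p q : ℕ} {z : H}

/-- The Leibniz rule for the exterior product, for `∂_v + [g, ·]`. -/
lemma altWedge_leibniz {f : H → E [⋀^Fin p]→ₗ[ℝ] A} {h : H → E [⋀^Fin q]→ₗ[ℝ] A}
    (hf : ∀ w, DifferentiableAt ℝ (fun z ↦ f z w) z)
    (hh : ∀ w, DifferentiableAt ℝ (fun z ↦ h z w) z) (v : H) (g : A)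
    {f' : E [⋀^Fin p]→ₗ[ℝ] A} {h' : E [⋀^Fin q]→ₗ[ℝ] A}
    (hf' : ∀ w, f' w = fderiv ℝ (fun z ↦ f z w) z v + g * f z w - f z w * g)
    (hh' : ∀ w, h' w = fderiv ℝ (fun z ↦ h z w) z v + g * h z w - h z w * g)
    (w : Fin (p + q) → E) :
    fderiv ℝ (fun z ↦ altWedge (f z) (h z) w) z v + g * altWedge (f z) (h z) w -
      altWedge (f z) (h z) w * g = altWedge f' (h z) w + altWedge (f z) h' w := by
  simp only [altWedge_apply]
  have hd1 := fun σ : Equiv.Perm (Fin p ⊕ Fin q) ↦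
    ((hf fun i ↦ w (finSumFinEquiv (σ (Sum.inl i)))).hasFDerivAt.mul'
      (hh fun i ↦ w (finSumFinEquiv (σ (Sum.inr i)))).hasFDerivAt).fun_const_smul
        (Equiv.Perm.sign σ : ℤ)
  have hd := (HasFDerivAt.fun_sum (u := Finset.univ) fun σ _ ↦ hd1 σ).fun_const_smul
    (((p.factorial * q.factorial : ℕ) : ℝ)⁻¹)
  simp only [Pi.mul_apply] at hd
  have hs : ∀ (u : ℤˣ) (a : A), u • a = (u : ℤ) • a := fun u a ↦ rfl
  simp only [hs]
  rw [hd.fderiv]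
  simp only [smul_apply, sum_apply, add_apply, hf', hh', mul_smul_comm, smul_mul_assoc,
    ← smul_add, ← smul_sub, Finset.mul_sum, Finset.sum_mul, ← Finset.sum_add_distrib,
    ← Finset.sum_sub_distrib]
  congr 1
  refine Finset.sum_congr rfl fun σ _ ↦ ?_
  congr 1
  -- What remains for each permutation is the Leibniz rule of the derivation `∂_v + [g, ·]`: the
  -- terms `-f g h` and `f g h` cancel.
  simp only [smul_eq_mul, MulOpposite.smul_eq_mul_unop, MulOpposite.unop_op]
  noncomm_ring

lemma contDiffAt_altWedge {f : H → E [⋀^Fin p]→ₗ[ℝ] A} {h : H → E [⋀^Fin q]→ₗ[ℝ] A} {k : ℕ∞ω}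
    (hf : ∀ w, ContDiffAt ℝ k (fun z ↦ f z w) z)
    (hh : ∀ w, ContDiffAt ℝ k (fun z ↦ h z w) z) (w : Fin (p + q) → E) :
    ContDiffAt ℝ k (fun z ↦ altWedge (f z) (h z) w) z := by
  simp only [altWedge_apply]
  exact (ContDiffAt.sum fun σ _ ↦ ContDiffAt.const_smul (Equiv.Perm.sign σ : ℤ)
    ((hf _).mul (hh _))).const_smul _

end AltWedgeDerivative

section CovDerivCoordinates

attribute [local instance] Matrix.linftyOpNormedRing Matrix.linftyOpNormedAlgebra

variable {𝕜 : Type*} [RCLike 𝕜] {m : ℕ}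
  {M : Type*} [TopologicalSpace M] [ChartedSpace (EuclideanSpace ℝ (Fin m)) M]
  [IsManifold (𝓡 m) ∞ M]
  (F : Type*) [NormedAddCommGroup F] [NormedSpace ℝ F] [NormedSpace 𝕜 F]
  [IsScalarTower ℝ 𝕜 F] [FiniteDimensional 𝕜 F]
  {V : M → Type*} [TopologicalSpace (TotalSpace F V)]
  [∀ x, AddCommGroup (V x)] [∀ x, Module ℝ (V x)] [∀ x, Module 𝕜 (V x)]
  [∀ x, IsScalarTower ℝ 𝕜 (V x)]
  [∀ x, TopologicalSpace (V x)] [∀ x, IsTopologicalAddGroup (V x)]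
  [∀ x, ContinuousSMul ℝ (V x)]
  [FiberBundle F V] [VectorBundle ℝ F V] [VectorBundle 𝕜 F V] [ContMDiffVectorBundle ∞ F V (𝓡 m)]


variable {x : M} {p q : ℕ} {z : EuclideanSpace ℝ (Fin m)}

lemma Connection.coord_cov_self (D : Connection 𝕜 m F V) {σ : Π y, V y}
    (hσ : MDifferentiableAt (𝓡 m) ((𝓡 m).prod 𝓘(ℝ, F)) (fun y ↦ TotalSpace.mk' F y (σ y)) x)
    (v : EuclideanSpace ℝ (Fin m)) :
    coord 𝕜 F x x (D.cov σ x v) = fderiv ℝ (secAt 𝕜 F x σ) (extChartAt (𝓡 m) x x) v +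
      (D.gam F x (extChartAt (𝓡 m) x x) v).mulVec
        (secAt 𝕜 F x σ (extChartAt (𝓡 m) x x)) := by
  have hx : (extChartAt (𝓡 m) x).symm (extChartAt (𝓡 m) x x) = x := extChartAt_to_inv x
  have h := D.coord_cov F (mem_dom_self F x) (σ := σ) (by rwa [hx]) v
  rwa [hx, extVec_self] at h

/-- The extension has locally constant coordinates in the frame, so only the `Γ` term of `∇`
survives. -/
lemma Connection.coord_cov_extSec (D : Connection 𝕜 m F V) (s : V x)
    (v : EuclideanSpace ℝ (Fin m)) :
    coord 𝕜 F x x (D.cov (extSec F s) x v) =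
      (D.gam F x (extChartAt (𝓡 m) x x) v).mulVec (coord 𝕜 F x x s) := by
  have h : extSec F s = fun y ↦ frame 𝕜 F x y (coord 𝕜 F x x s) :=
    funext (extSec_eq_frame 𝕜 F s)
  have h1 := secAt_frame_eventuallyEq 𝕜 F (V := V) (mem_dom_self F (m := m) x) (coord 𝕜 F x x s)
  rw [D.coord_cov_self F (mdifferentiableAt_extSec F s), h, h1.fderiv_eq, h1.eq_of_nhds]
  simp

lemma Connection.covDeriv_apply (D : Connection 𝕜 m F V) {lam : EndForm 𝕜 m V p}
    (h : lam.IsDiffAt F x) (v : EuclideanSpace ℝ (Fin m)) (w : Fin p → EuclideanSpace ℝ (Fin m))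
    (s : V x) : D.covDeriv F lam x v w s =
      D.cov (lam.evalExt F x w s) x v - lam x w (D.cov (extSec F s) x v) := by
  rw [Connection.covDeriv, dif_pos h]
  rfl

/-- The covariant derivative of an `End(V)`-valued form in coordinates:
`∇_v λ = ∂_v λ + [Γ(v), λ]`. -/
lemma Connection.matL_covDeriv (D : Connection 𝕜 m F V) {lam : EndForm 𝕜 m V p}
    (h : lam.IsSmooth F) (x : M) (v : EuclideanSpace ℝ (Fin m))
    (w : Fin p → EuclideanSpace ℝ (Fin m)) :
    matL 𝕜 F x x (D.covDeriv F lam x v w) =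
      fderiv ℝ (fun z ↦ formAt F lam x z w) (extChartAt (𝓡 m) x x) v +
      D.gam F x (extChartAt (𝓡 m) x x) v * formAt F lam x (extChartAt (𝓡 m) x x) w -
      formAt F lam x (extChartAt (𝓡 m) x x) w * D.gam F x (extChartAt (𝓡 m) x x) v := by
  have hx := FiberBundle.mem_baseSet_trivializationAt' (F := F) (E := V) x
  refine Matrix.ext_of_mulVec_single fun j ↦ ?_
  set c : Ix 𝕜 F → 𝕜 := Pi.single j 1
  have hc : coord 𝕜 F x x (frame 𝕜 F x x c : V x) = c := coord_frame 𝕜 F hx c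
  have h1 : secAt 𝕜 F x (lam.evalExt F x w (frame 𝕜 F x x c)) =
      fun z ↦ (formAt F lam x z w).mulVec c := by
    funext z
    rw [secAt_evalExt, hc]
  rw [matL_mulVec, D.covDeriv_apply F (h.isDiffAt F x), _root_.map_sub,
    D.coord_cov_self F (h.isDiffAt F x _ _), h1, ← matL_mulVec_coord 𝕜 F hx,
    D.coord_cov_extSec F, hc,
    fderiv_mulVec 𝕜 F ((h.contDiffAt_formAt F (mem_dom_self F x) w).differentiableAt (by simp))
      (differentiableAt_const c), Matrix.sub_mulVec, Matrix.add_mulVec, ← Matrix.mulVec_mulVec,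
    ← Matrix.mulVec_mulVec, fderiv_fun_const, Pi.zero_apply, zero_apply, Matrix.mulVec_zero,
    add_zero]
  simp only [formAt_self]

/-- Over the domain of the frame, passing to matrices is multiplicative, so it commutes with the sum
over permutations. -/
lemma formAt_wedge (a : EndForm 𝕜 m V p) (b : EndForm 𝕜 m V q) (hz : z ∈ dom F V x) :
    formAt F (a.wedge b) x z = altWedge (formAt F a x z) (formAt F b x z) := by
  ext1 w
  have h1 : ∀ w, (a.wedge b) ((extChartAt (𝓡 m) x).symm z) w =
    altWedge (a ((extChartAt (𝓡 m) x).symm z)) (b ((extChartAt (𝓡 m) x).symm z)) w := fun w ↦ rfl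
  have hs : ∀ (u : ℤˣ) (f : Module.End 𝕜 (V ((extChartAt (𝓡 m) x).symm z))),
      matL 𝕜 F x ((extChartAt (𝓡 m) x).symm z) (u • f) =
      u • matL 𝕜 F x ((extChartAt (𝓡 m) x).symm z) f := fun u f ↦
    _root_.map_zsmul (matL 𝕜 F x ((extChartAt (𝓡 m) x).symm z)) (u : ℤ) f
  rw [formAt_apply, h1, altWedge_apply, altWedge_apply, map_smul, map_sum]
  simp only [hs, matL_mul 𝕜 F hz.2]
  rfl

lemma formAt_add (a b : EndForm 𝕜 m V p) : formAt F (a + b) x z = formAt F a x z + formAt F b x z := by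
  ext1 w
  exact map_add (matL 𝕜 F x ((extChartAt (𝓡 m) x).symm z)) _ _

lemma formAt_smul (c : ℝ) (a : EndForm 𝕜 m V p) : formAt F (c • a) x z = c • formAt F a x z := by
  ext1 w
  exact map_smul (matL 𝕜 F x ((extChartAt (𝓡 m) x).symm z)) _ _

lemma EndForm.IsSmooth.wedge {a : EndForm 𝕜 m V p} {b : EndForm 𝕜 m V q} (ha : a.IsSmooth F)
    (hb : b.IsSmooth F) : (a.wedge b).IsSmooth F := by
  refine (EndForm.isSmooth_iff F _).2 fun x w ↦ ?_
  refine (contDiffAt_altWedge (ha.contDiffAt_formAt F (mem_dom_self F x))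
    (hb.contDiffAt_formAt F (mem_dom_self F x)) w).congr_of_eventuallyEq ?_
  filter_upwards [(isOpen_dom F x).mem_nhds (mem_dom_self F (V := V) x)] with z hz
  rw [formAt_wedge F a b hz]

lemma EndForm.IsSmooth.add {a b : EndForm 𝕜 m V p} (ha : a.IsSmooth F) (hb : b.IsSmooth F) :
    EndForm.IsSmooth F (a + b) := by
  refine (EndForm.isSmooth_iff F _).2 fun x w ↦ ?_
  simp only [formAt_add]
  exact ((EndForm.isSmooth_iff F _).1 ha x w).add ((EndForm.isSmooth_iff F _).1 hb x w)

lemma EndForm.IsSmooth.smul (c : ℝ) {a : EndForm 𝕜 m V p} (ha : a.IsSmooth F) :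
    EndForm.IsSmooth F (c • a) := by
  refine (EndForm.isSmooth_iff F _).2 fun x w ↦ ?_
  simp only [formAt_smul]
  exact ((EndForm.isSmooth_iff F _).1 ha x w).const_smul c

lemma formAt_zero : formAt F (0 : EndForm 𝕜 m V p) x z = 0 := by
  ext1 w
  exact map_zero (matL 𝕜 F x ((extChartAt (𝓡 m) x).symm z))

lemma EndForm.IsSmooth.pow {a : EndForm 𝕜 m V 2} (ha : a.IsSmooth F) :
    ∀ k : ℕ, (a.pow k).IsSmooth F
  | 0 => by
    refine (EndForm.isSmooth_iff F _).2 fun x w ↦ ?_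
    refine (contDiffAt_const (c := (1 : Matrix (Ix 𝕜 F) (Ix 𝕜 F) 𝕜))).congr_of_eventuallyEq ?_
    filter_upwards [(isOpen_dom F x).mem_nhds (mem_dom_self F (V := V) x)] with z hz
    exact matL_one 𝕜 F hz.2
  | k + 1 => (EndForm.IsSmooth.pow ha k).wedge F ha

/-- The Leibniz rule for the covariant derivative of exterior products. -/
lemma Connection.covDeriv_wedge (D : Connection 𝕜 m F V) {a : EndForm 𝕜 m V p}
    {b : EndForm 𝕜 m V q} (ha : a.IsSmooth F) (hb : b.IsSmooth F) (x : M)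
    (v : EuclideanSpace ℝ (Fin m)) :
    D.covDeriv F (a.wedge b) x v =
      altWedge (D.covDeriv F a x v) (b x) + altWedge (a x) (D.covDeriv F b x v) := by
  have hx := FiberBundle.mem_baseSet_trivializationAt' (F := F) (E := V) x
  have h0 := mem_dom_self F (V := V) (m := m) x
  have hw : ∀ {p q : ℕ} (f : EuclideanSpace ℝ (Fin m) [⋀^Fin p]→ₗ[ℝ] Module.End 𝕜 (V x))
      (g : EuclideanSpace ℝ (Fin m) [⋀^Fin q]→ₗ[ℝ] Module.End 𝕜 (V x)) (w),
      matL 𝕜 F x x (altWedge f g w) = altWedge ((matL 𝕜 F x x).compAlternatingMap f)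
        ((matL 𝕜 F x x).compAlternatingMap g) w := by
    intro p q f g w
    have hs : ∀ (u : ℤˣ) (f : Module.End 𝕜 (V x)), matL 𝕜 F x x (u • f) = u • matL 𝕜 F x x f :=
      fun u f ↦ _root_.map_zsmul (matL 𝕜 F x x) (u : ℤ) f
    rw [altWedge_apply, altWedge_apply, _root_.map_smul, map_sum]
    simp only [hs, matL_mul 𝕜 F hx]
    rfl
  have hself : ∀ {p : ℕ} (c : EndForm 𝕜 m V p), (matL 𝕜 F x x).compAlternatingMap (c x) =
      formAt F c x (extChartAt (𝓡 m) x x) := fun c ↦ by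
    ext1 w
    rw [formAt_self]
    rfl
  ext1 w
  refine matL_injective 𝕜 F hx ?_
  have h1 : (fun z ↦ formAt F (a.wedge b) x z w) =ᶠ[𝓝 (extChartAt (𝓡 m) x x)]
      fun z ↦ altWedge (formAt F a x z) (formAt F b x z) w := by
    filter_upwards [(isOpen_dom F x).mem_nhds h0] with z hz
    rw [formAt_wedge F a b hz]
  rw [D.matL_covDeriv F (ha.wedge F hb), h1.fderiv_eq, AlternatingMap.add_apply, _root_.map_add, hw, hw, hself,
    hself, ← altWedge_leibniz (fun w ↦ (ha.contDiffAt_formAt F h0 w).differentiableAt (by simp))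
      (fun w ↦ (hb.contDiffAt_formAt F h0 w).differentiableAt (by simp)) v
      (D.gam F x (extChartAt (𝓡 m) x x) v) (D.matL_covDeriv F ha x v)
      (D.matL_covDeriv F hb x v), formAt_wedge F a b h0]
  rfl

/-- The trace of the exterior covariant derivative is the exterior derivative of the trace. -/
theorem Connection.tr_extD (D : Connection 𝕜 m F V) {lam : EndForm 𝕜 m V p}
    (h : lam.IsSmooth F) : (D.extD F lam).tr = lam.tr.d := by
  funext x
  have hx := FiberBundle.mem_baseSet_trivializationAt' (F := F) (E := V) x
  have h0 := mem_dom_self F (V := V) (m := m) x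
  ext w
  -- In coordinates `∇_v λ = ∂_v λ + [Γ(v), λ]`; the commutator has trace zero and the trace
  -- commutes with `∂_v`. Both exterior derivatives are the same alternating sum of such terms.
  have key : ∀ v w, LinearMap.trace 𝕜 (V x) (D.covDeriv F lam x v w) =
      fderiv ℝ (lam.tr.rep x) (extChartAt (𝓡 m) x x) v w := by
    intro v w
    have h1 : fderiv ℝ (lam.tr.rep x) (extChartAt (𝓡 m) x x) v w =
        fderiv ℝ (fun z ↦ lam.tr.rep x z w) (extChartAt (𝓡 m) x x) v := by
      have := ((ContinuousAlternatingMap.apply ℝ _ 𝕜 w).hasFDerivAt.comp _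
        ((h.tr F).differentiableAt x).hasFDerivAt).fderiv
      exact (DFunLike.congr_fun this v).symm
    have h2 : fderiv ℝ (fun z ↦ traceₗ 𝕜 F (formAt F lam x z w)) (extChartAt (𝓡 m) x x) v =
        traceₗ 𝕜 F (fderiv ℝ (fun z ↦ formAt F lam x z w) (extChartAt (𝓡 m) x x) v) := by
      have := ((LinearMap.toContinuousLinearMap (traceₗ 𝕜 F)).hasFDerivAt.comp _
        ((h.contDiffAt_formAt F h0 w).differentiableAt (by simp)).hasFDerivAt).fderiv
      exact DFunLike.congr_fun this v
    rw [h1, (rep_tr_eventuallyEq F lam h0 w).fderiv_eq, h2, ← trace_matL 𝕜 F hx,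
      D.matL_covDeriv F h, Matrix.trace_sub, Matrix.trace_add, Matrix.trace_mul_comm,
      add_sub_cancel_right]
    rfl
  have h3 : (D.extD F lam).tr x w =
      LinearMap.trace 𝕜 (V x) (AlternatingMap.alternatizeUncurryFin (D.covDeriv F lam x) w) := rfl
  rw [h3, DForm.d, mfderiv_extChartAt_self, AlternatingMap.alternatizeUncurryFin_apply, map_sum]
  change _ = extDeriv (lam.tr.rep x) (extChartAt (𝓡 m) x x) w
  rw [extDeriv, ContinuousAlternatingMap.alternatizeUncurryFin_apply]
  refine Finset.sum_congr rfl fun i _ ↦ ?_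
  rw [map_zsmul, key]

end CovDerivCoordinates

/-! ### The curvature in coordinates -/

section LocalExpression

lemma contDiffAt_clm {m : ℕ} {H Y : Type*} [NormedAddCommGroup H] [NormedSpace ℝ H]
    [NormedAddCommGroup Y] [NormedSpace ℝ Y] [FiniteDimensional ℝ Y] {k : ℕ∞ω} {z : H}
    {f : H → EuclideanSpace ℝ (Fin m) →L[ℝ] Y} (hf : ∀ w, ContDiffAt ℝ k (fun z ↦ f z w) z) :
    ContDiffAt ℝ k f z := by
  refine contDiffAt_of_separating (ι := Fin m)
    (fun i ↦ (ContinuousLinearMap.apply ℝ Y (EuclideanSpace.single i (1 : ℝ)) :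
      (EuclideanSpace ℝ (Fin m) →L[ℝ] Y) →ₗ[ℝ] Y)) (fun a ha ↦ ?_) fun i ↦ hf _
  ext1 v
  have := (EuclideanSpace.basisFun (Fin m) ℝ).toBasis.ext (f₁ := a.toLinearMap) (f₂ := 0)
    (fun i ↦ by simpa using ha i)
  exact DFunLike.congr_fun this v

variable {E X Y : Type*} [NormedAddCommGroup E] [NormedSpace ℝ E] [NormedAddCommGroup X]
  [NormedSpace ℝ X] [FiniteDimensional ℝ X] [NormedRing Y] [NormedAlgebra ℝ Y] [FiniteDimensional ℝ Y]
  (B : Y →ₗ[ℝ] X →ₗ[ℝ] X)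

/-- The local expression of `∇_T S`, for the connection matrix `G`, which acts by `B`. -/
def localCov (G : E → E →L[ℝ] Y) (S : E → X) (T : E → E) (z : E) : X :=
  fderiv ℝ S z (T z) + B (G z (T z)) (S z)

variable {G : E → E →L[ℝ] Y} {S : E → X} {T T' : E → E} {z : E}

lemma differentiableAt_localCov (hG : DifferentiableAt ℝ G z) (hS : ContDiffAt ℝ ∞ S z)
    (hT : DifferentiableAt ℝ T z) : DifferentiableAt ℝ (localCov B G S T) z :=
  (((hS.fderiv_right (m := ∞) le_rfl).differentiableAt (by simp)).clm_apply hT).add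
    (differentiableAt_bilin B (hG.clm_apply hT) (hS.differentiableAt (by simp)))

lemma fderiv_localCov (hG : DifferentiableAt ℝ G z) (hS : ContDiffAt ℝ ∞ S z)
    (hT : DifferentiableAt ℝ T z) (v : E) : fderiv ℝ (localCov B G S T) z v =
      fderiv ℝ (fderiv ℝ S) z v (T z) + fderiv ℝ S z (fderiv ℝ T z v) +
      (B (fderiv ℝ G z v (T z) + G z (fderiv ℝ T z v)) (S z) +
        B (G z (T z)) (fderiv ℝ S z v)) := by
  have h1 : DifferentiableAt ℝ (fderiv ℝ S) z :=
    (hS.fderiv_right (m := ∞) le_rfl).differentiableAt (by simp)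
  have h2 := hS.differentiableAt (by simp)
  have h4 := h1.hasFDerivAt.clm_apply hT.hasFDerivAt
  have h5 := (hG.hasFDerivAt.clm_apply hT.hasFDerivAt).fderiv
  have h6 := (differentiableAt_bilin B (hG.clm_apply hT) h2).hasFDerivAt
  have h7 := (h4.fun_add h6).fderiv
  rw [show localCov B G S T = fun z ↦ fderiv ℝ S z (T z) + B (G z (T z)) (S z) from rfl, h7, add_apply, fderiv_bilin B (hG.clm_apply hT) h2, h5]
  simp only [add_apply, ContinuousLinearMap.comp_apply, ContinuousLinearMap.flip_apply]
  rw [add_comm (fderiv ℝ S z _), add_comm (G z (fderiv ℝ T z v))]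

/-- The curvature of the local expression of a connection. -/
lemma localCov_comm (hB : ∀ a b s, B (a * b) s = B a (B b s)) (hG : DifferentiableAt ℝ G z)
    (hS : ContDiffAt ℝ ∞ S z) (hT : DifferentiableAt ℝ T z) (hT' : DifferentiableAt ℝ T' z)
    (hTT : fderiv ℝ T' z (T z) = fderiv ℝ T z (T' z)) :
    (fderiv ℝ (localCov B G S T') z (T z) + B (G z (T z)) (localCov B G S T' z)) -
    (fderiv ℝ (localCov B G S T) z (T' z) + B (G z (T' z)) (localCov B G S T z)) =
    B (fderiv ℝ G z (T z) (T' z) - fderiv ℝ G z (T' z) (T z) +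
      G z (T z) * G z (T' z) - G z (T' z) * G z (T z)) (S z) := by
  -- Second derivatives of `S` cancel by symmetry, terms with derivatives of `T` and `T'` by `hTT`,
  -- and the mixed terms `G · ∂S` cancel in pairs. Only an expression of order zero in `S` is left.
  have hs : fderiv ℝ (fderiv ℝ S) z (T z) (T' z) = fderiv ℝ (fderiv ℝ S) z (T' z) (T z) :=
    hS.isSymmSndFDerivAt two_le_smoothness _ _
  rw [fderiv_localCov B hG hS hT, fderiv_localCov B hG hS hT', hTT, hs, localCov, localCov]
  simp only [map_add, map_sub, LinearMap.add_apply, LinearMap.sub_apply, hB]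
  abel

/-- A linear map on a finite dimensional space, as a continuous linear map between normed
spaces. -/
def toCLM [FiniteDimensional ℝ E] (f : E →ₗ[ℝ] Y) : E →L[ℝ] Y := LinearMap.toContinuousLinearMap f

end LocalExpression

section Curvature

attribute [local instance] Matrix.linftyOpNormedRing Matrix.linftyOpNormedAlgebra

variable {𝕜 : Type*} [RCLike 𝕜] {m : ℕ}
  {M : Type*} [TopologicalSpace M] [ChartedSpace (EuclideanSpace ℝ (Fin m)) M]
  [IsManifold (𝓡 m) ∞ M]
  (F : Type*) [NormedAddCommGroup F] [NormedSpace ℝ F] [NormedSpace 𝕜 F]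
  [IsScalarTower ℝ 𝕜 F] [FiniteDimensional 𝕜 F]
  {V : M → Type*} [TopologicalSpace (TotalSpace F V)]
  [∀ x, AddCommGroup (V x)] [∀ x, Module ℝ (V x)] [∀ x, Module 𝕜 (V x)]
  [∀ x, IsScalarTower ℝ 𝕜 (V x)]
  [∀ x, TopologicalSpace (V x)] [∀ x, IsTopologicalAddGroup (V x)]
  [∀ x, ContinuousSMul ℝ (V x)]
  [FiberBundle F V] [VectorBundle ℝ F V] [VectorBundle 𝕜 F V] [ContMDiffVectorBundle ∞ F V (𝓡 m)]


variable {x : M} {p q : ℕ} {z : EuclideanSpace ℝ (Fin m)}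


/-- The connection matrix, as a linear function of the tangent vector. -/
def Connection.gamL (D : Connection 𝕜 m F V) (x : M) (z : EuclideanSpace ℝ (Fin m)) :=
  toCLM (E := EuclideanSpace ℝ (Fin m)) (Y := Matrix (Ix 𝕜 F) (Ix 𝕜 F) 𝕜)
    { toFun := D.gam F x z
      map_add' := fun v w ↦ by
        ext i j
        simp only [Connection.gam, extVec_add, _root_.map_add, Matrix.of_apply, Matrix.add_apply,
          Pi.add_apply]
      map_smul' := fun c w ↦ by
        ext i j
        simp only [Connection.gam, extVec_smul, _root_.map_smul, coord_smul_real, Matrix.of_apply,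
          Matrix.smul_apply, Pi.smul_apply, RingHom.id_apply] }

lemma Connection.gamL_apply (D : Connection 𝕜 m F V) (w : EuclideanSpace ℝ (Fin m)) :
    D.gamL F x z w = D.gam F x z w := rfl

lemma Connection.IsSmooth.contDiffAt_gamL [T2Space M] {D : Connection 𝕜 m F V} (hD : D.IsSmooth)
    (hz : z ∈ dom F V x) : ContDiffAt ℝ ∞ (D.gamL F x) z := by
  exact contDiffAt_clm fun w ↦ hD.contDiffAt_gam F hz w

lemma contDiffAt_secAt_extSec (hz : z ∈ dom F V x) {y : M} (hy : (extChartAt (𝓡 m) x).symm z = y)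
    (s : V y) : ContDiffAt ℝ ∞ (secAt 𝕜 F x (extSec F s)) z := by
  have hinv : (extChartAt (𝓡 m) y).symm (extChartAt (𝓡 m) y y) = y := extChartAt_to_inv y
  rw [← contMDiffAt_iff_secAt 𝕜 F hz, hy]
  have h := contMDiffAt_frame 𝕜 F (k := ∞) (V := V) (mem_dom_self F (m := m) y) (coord 𝕜 F y y s)
  rw [hinv] at h
  have h1 : extSec F s = fun y' ↦ frame 𝕜 F y y' (coord 𝕜 F y y s) :=
    funext (extSec_eq_frame 𝕜 F s)
  rwa [h1]

/-- The sections `∇_W S` in the definition of the curvature, in the chart at another point. -/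
lemma Connection.secAt_derivExt (D : Connection 𝕜 m F V) (hz : z ∈ dom F V x)
    (w : EuclideanSpace ℝ (Fin m)) (s : V ((extChartAt (𝓡 m) x).symm z)) :
    secAt 𝕜 F x (D.derivExt F ((extChartAt (𝓡 m) x).symm z) w s) =ᶠ[𝓝 z]
      localCov (mulVecₗ 𝕜 F) (D.gamL F x) (secAt 𝕜 F x (extSec F s))
        (fun z' ↦ transD ((extChartAt (𝓡 m) x).symm z) x z' w) := by
  have h1 := (continuousAt_extChartAt_symm'' hz.1).eventually
    (eventually_mdifferentiableAt_extSec (m := m) F s)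
  filter_upwards [(isOpen_dom F x).mem_nhds hz, h1,
    eventually_symm_mem x (isOpen_source ((extChartAt (𝓡 m) x).symm z)) hz.1
      (mem_extChartAt_source (I := 𝓡 m) _)] with z' hz' h2 h3
  have h4 := extVec_eq_extVec_transD h3.2 ((extChartAt (𝓡 m) x).map_target hz'.1) w
  rw [(extChartAt (𝓡 m) x).right_inv hz'.1] at h4
  rw [secAt, Connection.derivExt, h4, D.coord_cov F hz' h2, localCov, D.gamL_apply]
  rfl

lemma extVec_injective {x y : M} (hy : y ∈ (extChartAt (𝓡 m) x).source)
    {v w : EuclideanSpace ℝ (Fin m)} (h : extVec x v y = extVec x w y) : v = w := by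
  rw [extChartAt_source] at hy
  have key : ∀ v, (trivializationAt (EuclideanSpace ℝ (Fin m)) (TangentSpace (𝓡 m) : M → Type _)
      x).linearMapAt ℝ y (extVec x v y) = v := fun v ↦ by
    rw [extVec, linearMapAt_tangent_self]
    exact Trivialization.linearMapAt_symmₗ _ hy v
  rw [← key v, h, key]

lemma Connection.covDeriv₂_apply (D : Connection 𝕜 m F V)
    (h : ∀ w s, MDifferentiableAt (𝓡 m) ((𝓡 m).prod 𝓘(ℝ, F))
      (fun y ↦ TotalSpace.mk' F y (D.derivExt F x w s y)) x) (v w : EuclideanSpace ℝ (Fin m))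
    (s : V x) : D.covDeriv₂ F x v w s = D.cov (D.derivExt F x w s) x v := by
  rw [Connection.covDeriv₂, dif_pos h]
  rfl

lemma Connection.curvature_apply (D : Connection 𝕜 m F V) (w : Fin 2 → EuclideanSpace ℝ (Fin m)) :
    D.curvature F x w = D.covDeriv₂ F x (w 0) (w 1) - D.covDeriv₂ F x (w 1) (w 0) := by
  rw [Connection.curvature, AlternatingMap.alternatizeUncurryFin_apply, Fin.sum_univ_two]
  simp [Fin.removeNth, sub_eq_add_neg]
  rfl

/-- The curvature in coordinates: `Ω = dΓ + Γ ∧ Γ`. -/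
lemma Connection.IsSmooth.formAt_curvature [T2Space M] {D : Connection 𝕜 m F V} (hD : D.IsSmooth)
    (hz : z ∈ dom F V x) (w : Fin 2 → EuclideanSpace ℝ (Fin m)) :
    formAt F (D.curvature F) x z w =
      fderiv ℝ (D.gamL F x) z (w 0) (w 1) - fderiv ℝ (D.gamL F x) z (w 1) (w 0) +
      D.gamL F x z (w 0) * D.gamL F x z (w 1) - D.gamL F x z (w 1) * D.gamL F x z (w 0) := by
  set y := (extChartAt (𝓡 m) x).symm z with hy
  have hys : y ∈ (extChartAt (𝓡 m) x).source := (extChartAt (𝓡 m) x).map_target hz.1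
  have hyy : y ∈ (extChartAt (𝓡 m) y).source := mem_extChartAt_source y
  have hG : DifferentiableAt ℝ (D.gamL F x) z := (hD.contDiffAt_gamL F hz).differentiableAt (by simp)
  -- At `y` the curvature is defined through fields constant in the chart at `y`; `T v` is such a
  -- field in the chart at `x`. These fields commute, and their values at `z` match the given `w`
  -- (`hTw`), so tensoriality gives the formula in the chart at `x`.
  let T (v : EuclideanSpace ℝ (Fin m)) (z' : EuclideanSpace ℝ (Fin m)) := transD y x z' v
  have hT : ∀ v, DifferentiableAt ℝ (T v) z := fun v ↦
    (contDiffAt_transD hz.1 hyy v).differentiableAt (by simp)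
  have hTv : ∀ v, extVec x (T v z) y = v := fun v ↦ by
    have h := extVec_eq_extVec_transD hyy hys v
    rw [hy, (extChartAt (𝓡 m) x).right_inv hz.1, ← hy] at h
    rw [← h, extVec_self]
  have hTw : ∀ w, T (extVec x w y) z = w := fun w ↦ extVec_injective hys (hTv _)
  have hS : ∀ s : V y, ContDiffAt ℝ ∞ (secAt 𝕜 F x (extSec F s)) z := contDiffAt_secAt_extSec F hz rfl
  have hdiff : ∀ v (s : V y), MDifferentiableAt (𝓡 m) ((𝓡 m).prod 𝓘(ℝ, F))
      (fun y' ↦ TotalSpace.mk' F y' (D.derivExt F y v s y')) y := fun v s ↦ by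
    refine (mdifferentiableAt_iff_secAt 𝕜 F hz _).2 ?_
    exact (differentiableAt_localCov (mulVecₗ 𝕜 F) hG (hS s) (hT v)).congr_of_eventuallyEq
      (D.secAt_derivExt F hz v s)
  have hcov : ∀ v v' (s : V y), coord 𝕜 F x y (D.cov (D.derivExt F y v' s) y v) =
      fderiv ℝ (localCov (mulVecₗ 𝕜 F) (D.gamL F x) (secAt 𝕜 F x (extSec F s)) (T v')) z (T v z) +
      mulVecₗ 𝕜 F (D.gamL F x z (T v z))
        (localCov (mulVecₗ 𝕜 F) (D.gamL F x) (secAt 𝕜 F x (extSec F s)) (T v') z) := fun v v' s ↦ by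
    have h := D.coord_cov F hz (hdiff v' s) (T v z)
    rw [← hy, hTv, (D.secAt_derivExt F hz v' s).fderiv_eq,
      (D.secAt_derivExt F hz v' s).eq_of_nhds] at h
    exact h
  refine Matrix.ext_of_mulVec_single fun j ↦ ?_
  set c : Ix 𝕜 F → 𝕜 := Pi.single j 1
  have hcs : secAt 𝕜 F x (extSec F (frame 𝕜 F x y c : V y)) z = c := by
    have h1 : extSec F (frame 𝕜 F x y c : V y) y = frame 𝕜 F x y c := by
      rw [extSec_eq_frame 𝕜 F, frame_coord 𝕜 F (FiberBundle.mem_baseSet_trivializationAt' y)]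
    rw [secAt, ← hy, h1, coord_frame 𝕜 F hz.2]
  rw [formAt_apply, matL_mulVec, ← hy, D.curvature_apply F, LinearMap.sub_apply, _root_.map_sub,
    D.covDeriv₂_apply F hdiff, D.covDeriv₂_apply F hdiff, hcov, hcov,
    localCov_comm (mulVecₗ 𝕜 F) (fun a b c ↦ (Matrix.mulVec_mulVec c a b).symm) hG (hS _) (hT _) (hT _) (fderiv_transD_comm hz.1 hyy _ _), hcs]
  simp only [hTw]
  rfl

end Curvature

/-! ### Bianchi identity and variation of the curvature -/

section LocalBianchi

variable {E Y : Type*} [NormedAddCommGroup E] [NormedSpace ℝ E] [NormedRing Y] [NormedAlgebra ℝ Y]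

/-- The local expression `dG + G ∧ G` of the curvature, for the connection matrix `G`. -/
def localCurv (G : E → E →L[ℝ] Y) (z a b : E) : Y :=
  fderiv ℝ G z a b - fderiv ℝ G z b a + G z a * G z b - G z b * G z a

variable {G : E → E →L[ℝ] Y} {z : E}

lemma contDiffAt_localCurv (hG : ContDiffAt ℝ ∞ G z) (a b : E) :
    ContDiffAt ℝ ∞ (fun z ↦ localCurv G z a b) z := by
  have h1 : ContDiffAt ℝ ∞ (fderiv ℝ G) z := hG.fderiv_right le_rfl
  have h2 : ∀ a, ContDiffAt ℝ ∞ (fun z ↦ G z a) z := fun a ↦ hG.clm_apply contDiffAt_const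
  have h3 : ∀ a b, ContDiffAt ℝ ∞ (fun z ↦ fderiv ℝ G z a b) z := fun a b ↦
    (h1.clm_apply contDiffAt_const).clm_apply contDiffAt_const
  exact (((h3 a b).sub (h3 b a)).add ((h2 a).mul (h2 b))).sub ((h2 b).mul (h2 a))

lemma fderiv_localCurv (hG : ContDiffAt ℝ ∞ G z) (a b v : E) :
    fderiv ℝ (fun z ↦ localCurv G z a b) z v =
      fderiv ℝ (fderiv ℝ G) z v a b - fderiv ℝ (fderiv ℝ G) z v b a +
      (G z a * fderiv ℝ G z v b + fderiv ℝ G z v a * G z b) -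
      (G z b * fderiv ℝ G z v a + fderiv ℝ G z v b * G z a) := by
  have h0 : DifferentiableAt ℝ G z := hG.differentiableAt (by simp)
  have h1 : DifferentiableAt ℝ (fderiv ℝ G) z :=
    (hG.fderiv_right (m := ∞) le_rfl).differentiableAt (by simp)
  have h2 : ∀ a, HasFDerivAt (fun z ↦ G z a) ((fderiv ℝ G z).flip a) z := fun a ↦ by
    simpa using! h0.hasFDerivAt.clm_apply (hasFDerivAt_const a z)
  have h3 : ∀ a b, HasFDerivAt (fun z ↦ fderiv ℝ G z a b)
      (((fderiv ℝ (fderiv ℝ G) z).flip a).flip b) z := fun a b ↦ by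
    have := h1.hasFDerivAt.clm_apply (hasFDerivAt_const a z)
    simpa using! this.clm_apply (hasFDerivAt_const b z)
  have h4 := (((h3 a b).fun_sub (h3 b a)).fun_add ((h2 a).mul' (h2 b))).fun_sub
    ((h2 b).mul' (h2 a))
  have h5 : fderiv ℝ (fun z ↦ localCurv G z a b) z = _ := h4.fderiv
  rw [h5]
  simp [smul_eq_mul]

/-- The local form of the Bianchi identity. -/
lemma localBianchi (hG : ContDiffAt ℝ ∞ G z) (a b c : E) :
    (fderiv ℝ (fun z ↦ localCurv G z b c) z a + G z a * localCurv G z b c -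
      localCurv G z b c * G z a) -
    (fderiv ℝ (fun z ↦ localCurv G z a c) z b + G z b * localCurv G z a c -
      localCurv G z a c * G z b) +
    (fderiv ℝ (fun z ↦ localCurv G z a b) z c + G z c * localCurv G z a b -
      localCurv G z a b * G z c) = 0 := by
  -- Symmetry of `D²G` disposes of `d(dG)`; the remaining identity is algebraic in `G` and its first
  -- derivatives.
  have hs : ∀ v w, fderiv ℝ (fderiv ℝ G) z v w = fderiv ℝ (fderiv ℝ G) z w v := fun v w ↦
    hG.isSymmSndFDerivAt two_le_smoothness v w
  rw [fderiv_localCurv hG, fderiv_localCurv hG, fderiv_localCurv hG, hs b a, hs c a, hs c b]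
  simp only [localCurv]
  noncomm_ring

end LocalBianchi

section AltWedgeOne

variable {E A : Type*} [AddCommGroup E] [Module ℝ E] [Ring A] [Algebra ℝ A]

lemma altWedge_one_one (f g : E [⋀^Fin 1]→ₗ[ℝ] A) (v : Fin 2 → E) :
    altWedge f g v = f (fun _ ↦ v 0) * g (fun _ ↦ v 1) - f (fun _ ↦ v 1) * g (fun _ ↦ v 0) := by
  have h : (Finset.univ : Finset (Equiv.Perm (Fin 1 ⊕ Fin 1))) =
      {1, Equiv.swap (Sum.inl 0) (Sum.inr 0)} := by decide
  have h0 : ∀ i : Fin 1, (finSumFinEquiv (Sum.inl i) : Fin (1 + 1)) = 0 := by decide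
  have h1 : ∀ i : Fin 1, (finSumFinEquiv (Sum.inr i) : Fin (1 + 1)) = 1 := by decide
  have h2 : ∀ i : Fin 1, Equiv.swap (Sum.inl (0 : Fin 1)) (Sum.inr (0 : Fin 1)) (Sum.inl i) =
    Sum.inr 0 := by decide
  have h3 : ∀ i : Fin 1, Equiv.swap (Sum.inl (0 : Fin 1)) (Sum.inr (0 : Fin 1)) (Sum.inr i) =
    Sum.inl 0 := by decide
  rw [altWedge_apply, h, Finset.sum_pair (by decide)]
  simp [h0, h1, h2, h3, sub_eq_add_neg]

end AltWedgeOne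

section Variation

attribute [local instance] Matrix.linftyOpNormedRing Matrix.linftyOpNormedAlgebra

variable {𝕜 : Type*} [RCLike 𝕜] {m : ℕ}
  {M : Type*} [TopologicalSpace M] [ChartedSpace (EuclideanSpace ℝ (Fin m)) M]
  [IsManifold (𝓡 m) ∞ M]
  (F : Type*) [NormedAddCommGroup F] [NormedSpace ℝ F] [NormedSpace 𝕜 F]
  [IsScalarTower ℝ 𝕜 F] [FiniteDimensional 𝕜 F]
  {V : M → Type*} [TopologicalSpace (TotalSpace F V)]
  [∀ x, AddCommGroup (V x)] [∀ x, Module ℝ (V x)] [∀ x, Module 𝕜 (V x)]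
  [∀ x, IsScalarTower ℝ 𝕜 (V x)]
  [∀ x, TopologicalSpace (V x)] [∀ x, IsTopologicalAddGroup (V x)]
  [∀ x, ContinuousSMul ℝ (V x)]
  [FiberBundle F V] [VectorBundle ℝ F V] [VectorBundle 𝕜 F V] [ContMDiffVectorBundle ∞ F V (𝓡 m)]


variable {x : M} {p q : ℕ} {z : EuclideanSpace ℝ (Fin m)}

lemma Connection.IsSmooth.formAt_curvature' [T2Space M] {D : Connection 𝕜 m F V} (hD : D.IsSmooth)
    (hz : z ∈ dom F V x) (w : Fin 2 → EuclideanSpace ℝ (Fin m)) :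
    formAt F (D.curvature F) x z w = localCurv (D.gamL F x) z (w 0) (w 1) :=
  hD.formAt_curvature F hz w

lemma Connection.IsSmooth.formAt_curvature_eventuallyEq [T2Space M] {D : Connection 𝕜 m F V}
    (hD : D.IsSmooth) (x : M) (w : Fin 2 → EuclideanSpace ℝ (Fin m)) :
    (fun z ↦ formAt F (D.curvature F) x z w) =ᶠ[𝓝 (extChartAt (𝓡 m) x x)]
      fun z ↦ localCurv (D.gamL F x) z (w 0) (w 1) := by
  filter_upwards [(isOpen_dom F x).mem_nhds (mem_dom_self F (V := V) x)] with z hz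
  exact hD.formAt_curvature' F hz w

/-- The curvature of a smooth connection is smooth. -/
lemma Connection.IsSmooth.curvature [T2Space M] {D : Connection 𝕜 m F V} (hD : D.IsSmooth) :
    (D.curvature F).IsSmooth F :=
  (EndForm.isSmooth_iff F _).2 fun x w ↦
    (contDiffAt_localCurv (hD.contDiffAt_gamL F (mem_dom_self F x)) _ _).congr_of_eventuallyEq
      (hD.formAt_curvature_eventuallyEq F x w)

lemma EndForm.ext_formAt {a b : EndForm 𝕜 m V p}
    (h : ∀ x w, formAt F a x (extChartAt (𝓡 m) x x) w = formAt F b x (extChartAt (𝓡 m) x x) w) :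
    a = b := by
  funext x
  ext1 w
  refine matL_injective 𝕜 F (FiberBundle.mem_baseSet_trivializationAt' x) ?_
  rw [← formAt_self, ← formAt_self, h]

/-- The curvature is determined by the connection matrices. -/
lemma Connection.IsSmooth.curvature_congr [T2Space M] {D D' : Connection 𝕜 m F V} (hD : D.IsSmooth)
    (hD' : D'.IsSmooth) (h : ∀ x, ∀ z ∈ dom F V x, ∀ w, D.gam F x z w = D'.gam F x z w) :
    D.curvature F = D'.curvature F := by
  refine EndForm.ext_formAt F fun x w ↦ ?_
  have h0 := mem_dom_self F (V := V) (m := m) x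
  have h1 : D.gamL F x =ᶠ[𝓝 (extChartAt (𝓡 m) x x)] D'.gamL F x := by
    filter_upwards [(isOpen_dom F x).mem_nhds h0] with z hz
    ext1 w
    exact h x z hz w
  rw [hD.formAt_curvature' F h0, hD'.formAt_curvature' F h0, localCurv, localCurv,
    h1.fderiv_eq, h1.eq_of_nhds]

lemma Connection.extD_apply (D : Connection 𝕜 m F V) (lam : EndForm 𝕜 m V p) (x : M)
    (w : Fin (p + 1) → EuclideanSpace ℝ (Fin m)) : D.extD F lam x w =
      ∑ i : Fin (p + 1), (-1) ^ (i : ℕ) • D.covDeriv F lam x (w i) (i.removeNth w) :=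
  AlternatingMap.alternatizeUncurryFin_apply _ _

/-- The Bianchi identity. -/
theorem Connection.IsSmooth.extD_curvature [T2Space M] {D : Connection 𝕜 m F V}
    (hD : D.IsSmooth) : D.extD F (D.curvature F) = 0 := by
  have hΩ := hD.curvature F
  refine EndForm.ext_formAt F fun x w ↦ ?_
  have h0 := mem_dom_self F (V := V) (m := m) x
  rw [formAt_zero, formAt_self, D.extD_apply F, Fin.sum_univ_three, _root_.map_add,
    _root_.map_add, map_zsmul, map_zsmul, map_zsmul, D.matL_covDeriv F hΩ, D.matL_covDeriv F hΩ,
    D.matL_covDeriv F hΩ, (hD.formAt_curvature_eventuallyEq F x _).fderiv_eq,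
    (hD.formAt_curvature_eventuallyEq F x _).fderiv_eq,
    (hD.formAt_curvature_eventuallyEq F x _).fderiv_eq, hD.formAt_curvature' F h0,
    hD.formAt_curvature' F h0, hD.formAt_curvature' F h0]
  have h := localBianchi (hD.contDiffAt_gamL F h0) (w 0) (w 1) (w 2)
  have e1 : Fin.removeNth 0 w 0 = w 1 := rfl
  have e2 : Fin.removeNth 0 w 1 = w 2 := rfl
  have e3 : Fin.removeNth 1 w 0 = w 0 := rfl
  have e4 : Fin.removeNth 1 w 1 = w 2 := rfl
  have e5 : Fin.removeNth 2 w 0 = w 0 := rfl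
  have e6 : Fin.removeNth 2 w 1 = w 1 := rfl
  rw [e1, e2, e3, e4, e5, e6]
  refine Eq.trans ?_ h
  simp only [Fin.val_zero, Fin.val_one, Fin.val_two, pow_zero, pow_one, one_smul, neg_smul,
    even_two.neg_pow, one_pow, sub_eq_add_neg, Connection.gamL_apply]
  rfl

lemma Connection.matL_extD_one (D : Connection 𝕜 m F V) (γ : EndForm 𝕜 m V 1) (x : M) (w : Fin 2 → EuclideanSpace ℝ (Fin m)) :
    matL 𝕜 F x x (D.extD F γ x w) =
      matL 𝕜 F x x (D.covDeriv F γ x (w 0) fun _ ↦ w 1) -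
      matL 𝕜 F x x (D.covDeriv F γ x (w 1) fun _ ↦ w 0) := by
  have e0 : Fin.removeNth (0 : Fin 2) w = fun _ ↦ w 1 := by
    funext i; rw [Subsingleton.elim i 0]; rfl
  have e1 : Fin.removeNth (1 : Fin 2) w = fun _ ↦ w 0 := by
    funext i; rw [Subsingleton.elim i 0]; rfl
  rw [D.extD_apply F, Fin.sum_univ_two, e0, e1]
  simp [sub_eq_add_neg]

/-- The curvature of `∇ + γ`. -/
lemma Connection.IsSmooth.curvature_addForm [T2Space M] {D : Connection 𝕜 m F V}
    (hD : D.IsSmooth) {γ : EndForm 𝕜 m V 1} (hγ : γ.IsSmooth F) :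
    (D.addForm F γ).curvature F = D.curvature F + D.extD F γ + γ.wedge γ := by
  refine EndForm.ext_formAt F fun x w ↦ ?_
  have h0 := mem_dom_self F (V := V) (m := m) x
  set z₀ := extChartAt (𝓡 m) x x with hz₀
  set g := fun z ↦ (D.addForm F γ).gamL F x z - D.gamL F x z with hg
  have hg1 : ContDiffAt ℝ ∞ g z₀ :=
    ((hD.addForm F hγ).contDiffAt_gamL F h0).sub (hD.contDiffAt_gamL F h0)
  have hgv : ∀ z v, g z v = formAt F γ x z (fun _ ↦ v) := fun z v ↦ by
    rw [hg]
    change (D.addForm F γ).gam F x z v - D.gam F x z v = _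
    rw [D.gam_addForm F γ, add_sub_cancel_left]
  have hd : ∀ v u, fderiv ℝ (fun z ↦ formAt F γ x z (fun _ ↦ v)) z₀ u = fderiv ℝ g z₀ u v := by
    intro v u
    have h1 := ((hg1.differentiableAt (by simp)).hasFDerivAt.clm_apply
      (hasFDerivAt_const v z₀)).fderiv
    simp only [hgv] at h1
    exact (DFunLike.congr_fun h1 u).trans (by simp)
  have hsum : (D.addForm F γ).gamL F x = fun z ↦ D.gamL F x z + g z := by
    funext z; rw [hg]; exact (add_sub_cancel _ _).symm
  have hG := (hD.contDiffAt_gamL F h0).differentiableAt (by simp)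
  rw [formAt_add, formAt_add, AlternatingMap.add_apply, AlternatingMap.add_apply,
    (hD.addForm F hγ).formAt_curvature' F h0, hD.formAt_curvature' F h0, formAt_wedge F _ _ h0,
    altWedge_one_one, formAt_self F (D.extD F γ), D.matL_extD_one F γ, D.matL_covDeriv F hγ,
    D.matL_covDeriv F hγ, localCurv, localCurv, hsum,
    fderiv_fun_add hG (hg1.differentiableAt (by simp)), hd, hd]
  simp only [← hgv, add_apply, ← hz₀, Connection.gamL_apply]
  noncomm_ring

/-- The exterior covariant derivative of a smooth `1`-form is smooth. -/
lemma Connection.IsSmooth.extD_one [T2Space M] {D : Connection 𝕜 m F V} (hD : D.IsSmooth)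
    {γ : EndForm 𝕜 m V 1} (hγ : γ.IsSmooth F) : (D.extD F γ).IsSmooth F := by
  -- Solving `Ω_{∇+γ} = Ω + Dγ + γ ∧ γ` for `Dγ` gives its smoothness from that of curvatures, with
  -- no need for a formula for `Dγ` off the centres of charts.
  have h : D.extD F γ = (D.addForm F γ).curvature F + ((-1 : ℝ) • D.curvature F +
      (-1 : ℝ) • γ.wedge γ) := by
    rw [hD.curvature_addForm F hγ]
    module
  rw [h]
  exact ((hD.addForm F hγ).curvature F).add F
    (((hD.curvature F).smul F _).add F ((hγ.wedge F hγ).smul F _))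

lemma Connection.extD_smul (D : Connection 𝕜 m F V) (c : ℝ) {lam : EndForm 𝕜 m V p}
    (h : lam.IsSmooth F) : D.extD F (c • lam) = c • D.extD F lam := by
  have key : D.covDeriv F (c • lam) = c • D.covDeriv F lam := by
    funext x
    ext1 v
    ext1 w
    refine matL_injective 𝕜 F (FiberBundle.mem_baseSet_trivializationAt' x) ?_
    have e : matL 𝕜 F x x ((c • D.covDeriv F lam) x v w) =
      c • matL 𝕜 F x x (D.covDeriv F lam x v w) := _root_.map_smul _ _ _
    rw [e, D.matL_covDeriv F h, D.matL_covDeriv F (h.smul F c)]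
    have e2 : fderiv ℝ (fun z ↦ c • formAt F lam x z w) (extChartAt (𝓡 m) x x) v =
        c • fderiv ℝ (fun z ↦ formAt F lam x z w) (extChartAt (𝓡 m) x x) v :=
      DFunLike.congr_fun (fderiv_fun_const_smul
        ((h.contDiffAt_formAt F (mem_dom_self F x) w).differentiableAt (by simp)) c) v
    simp only [formAt_smul, AlternatingMap.smul_apply, e2]
    simp only [smul_sub, smul_add, mul_smul_comm, smul_mul_assoc]
  funext x
  ext1 w
  rw [D.extD_apply F, key]
  simp only [Pi.smul_apply, LinearMap.smul_apply, AlternatingMap.smul_apply, D.extD_apply F,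
    Finset.smul_sum, smul_comm c]

lemma EndForm.wedge_apply (a : EndForm 𝕜 m V p) (b : EndForm 𝕜 m V q) (x : M) :
    a.wedge b x = altWedge (a x) (b x) := rfl

lemma Connection.IsSmooth.curvature_addForm_smul [T2Space M] {D : Connection 𝕜 m F V}
    (hD : D.IsSmooth) {γ : EndForm 𝕜 m V 1} (hγ : γ.IsSmooth F) (t : ℝ) :
    (D.addForm F (t • γ)).curvature F =
      D.curvature F + t • D.extD F γ + t ^ 2 • γ.wedge γ := by
  rw [hD.curvature_addForm F (hγ.smul F t), D.extD_smul F t hγ]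
  congr 1
  funext x
  rw [EndForm.wedge_apply, Pi.smul_apply, Pi.smul_apply, EndForm.wedge_apply, altWedge_smul_left,
    altWedge_smul_right, smul_smul, sq]

end Variation

/-! ### Powers of `2`-forms and cyclicity of the trace -/

section EvenForms

open scoped TensorProduct

variable {E : Type*} [AddCommGroup E] [Module ℝ E] {m : ℕ} (b : Module.Basis (Fin m) ℝ E)

/-- A vector anticommutes with each of the two factors, so the signs cancel, and vectors generate
the exterior algebra. -/
lemma ι_mul_ι_mem_center (v w : E) :
    ExteriorAlgebra.ι ℝ v * ExteriorAlgebra.ι ℝ w ∈ Subalgebra.center ℝ (ExteriorAlgebra ℝ E) := by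
  rw [Subalgebra.mem_center_iff]
  have hs : ∀ a c : E, ExteriorAlgebra.ι ℝ a * ExteriorAlgebra.ι ℝ c =
      -(ExteriorAlgebra.ι ℝ c * ExteriorAlgebra.ι ℝ a) := fun a c ↦
    eq_neg_of_add_eq_zero_left (ExteriorAlgebra.ι_add_mul_swap a c)
  intro y
  induction y using ExteriorAlgebra.induction with
  | algebraMap r => exact Algebra.commutes r _
  | ι c => rw [mul_assoc, hs w c, mul_neg, ← mul_assoc, ← mul_assoc, hs v c, neg_mul, neg_neg]
  | mul y z hy hz => rw [mul_assoc, hz, ← mul_assoc, hy, mul_assoc]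
  | add y z hy hz => rw [add_mul, hy, hz, mul_add]

section Ring

variable {A : Type*} [Ring A] [Algebra ℝ A]

variable (E A) in
/-- The subalgebra of `Λ E ⊗ A` generated by `A` and the center of `Λ E`. -/
def centralGr : Subalgebra ℝ (ExteriorAlgebra ℝ E ⊗[ℝ] A) :=
  (Algebra.TensorProduct.map (Subalgebra.center ℝ (ExteriorAlgebra ℝ E)).val
    (AlgHom.id ℝ A)).range

lemma toGr_mem_centralGr (f : E [⋀^Fin 2]→ₗ[ℝ] A) : toGr b f ∈ centralGr E A := by
  refine Subalgebra.smul_mem _ (sum_mem fun r _ ↦ ?_) _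
  have h : ExteriorAlgebra.ιMulti ℝ 2 (fun i ↦ b (r i)) =
      ExteriorAlgebra.ι ℝ (b (r 0)) * ExteriorAlgebra.ι ℝ (b (r 1)) := by
    simp [ExteriorAlgebra.ιMulti_apply]
    rfl
  rw [h]
  exact ⟨⟨_, ι_mul_ι_mem_center (b (r 0)) (b (r 1))⟩ ⊗ₜ f (fun i ↦ b (r i)), by simp⟩

lemma centralGr_induction {P : ExteriorAlgebra ℝ E ⊗[ℝ] A → Prop} (h0 : P 0)
    (hadd : ∀ X Y, P X → P Y → P (X + Y))
    (htmul : ∀ u ∈ Subalgebra.center ℝ (ExteriorAlgebra ℝ E), ∀ a, P (u ⊗ₜ a))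
    {X : ExteriorAlgebra ℝ E ⊗[ℝ] A} (hX : X ∈ centralGr E A) : P X := by
  obtain ⟨X, rfl⟩ := hX
  induction X using TensorProduct.induction_on with
  | zero => simpa using h0
  | tmul u a => exact htmul _ u.2 a
  | add X Y hX hY => rw [map_add]; exact hadd _ _ hX hY

/-- This replaces the sign `(-1)ᵖ` of the graded Leibniz rule: such elements commute with `Λ E ⊗ 1`,
though not with `1 ⊗ A`. -/
lemma commute_of_mem_centralGr {X : ExteriorAlgebra ℝ E ⊗[ℝ] A} (hX : X ∈ centralGr E A)
    (e : ExteriorAlgebra ℝ E) : X * (e ⊗ₜ[ℝ] (1 : A)) = (e ⊗ₜ[ℝ] (1 : A)) * X := by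
  refine centralGr_induction (P := fun X ↦ X * (e ⊗ₜ[ℝ] (1 : A)) = (e ⊗ₜ[ℝ] (1 : A)) * X)
    (by simp) (fun X Y h h' ↦ by rw [add_mul, h, h', mul_add]) (fun u hu a ↦ ?_) hX
  rw [Algebra.TensorProduct.tmul_mul_tmul, Algebra.TensorProduct.tmul_mul_tmul, mul_one, one_mul,
    Subalgebra.mem_center_iff.1 hu]

variable {C : Type*} [Ring C] [Algebra ℝ C] {τ : A →ₗ[ℝ] C}

/-- Cyclicity of the trace for forms: the exterior parts commute since one of them is central, and
the coefficients commute under `τ`. -/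
lemma map_mul_comm_of_mem_centralGr (hτ : ∀ a c, τ (a * c) = τ (c * a))
    {X : ExteriorAlgebra ℝ E ⊗[ℝ] A} (hX : X ∈ centralGr E A) (Y : ExteriorAlgebra ℝ E ⊗[ℝ] A) :
    TensorProduct.map LinearMap.id τ (X * Y) = TensorProduct.map LinearMap.id τ (Y * X) := by
  refine centralGr_induction (P := fun X ↦ TensorProduct.map LinearMap.id τ (X * Y) =
    TensorProduct.map LinearMap.id τ (Y * X)) (by simp)
    (fun X X' h h' ↦ by rw [add_mul, map_add, h, h', mul_add, map_add]) (fun u hu a ↦ ?_) hX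
  induction Y using TensorProduct.induction_on with
  | zero => simp
  | tmul v c =>
    rw [Algebra.TensorProduct.tmul_mul_tmul, Algebra.TensorProduct.tmul_mul_tmul,
      TensorProduct.map_tmul, TensorProduct.map_tmul, hτ, Subalgebra.mem_center_iff.1 hu]
  | add Y Y' h h' => rw [mul_add, map_add, h, h', add_mul, map_add]

lemma toGr_compAlternatingMap {p : ℕ} (f : E [⋀^Fin p]→ₗ[ℝ] A) :
    toGr b (τ.compAlternatingMap f) = TensorProduct.map LinearMap.id τ (toGr b f) := by
  simp [toGr]

/-- Exterior powers of an algebra-valued `2`-form. -/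
def altPow (f : E [⋀^Fin 2]→ₗ[ℝ] A) : (k : ℕ) → E [⋀^Fin (2 * k)]→ₗ[ℝ] A
  | 0 => AlternatingMap.constOfIsEmpty ℝ E (Fin 0) 1
  | k + 1 => altWedge (altPow f k) f

lemma toGr_altPow (f : E [⋀^Fin 2]→ₗ[ℝ] A) (k : ℕ) : toGr b (altPow f k) = toGr b f ^ k := by
  induction k with
  | zero =>
    have : toGr b (AlternatingMap.constOfIsEmpty ℝ E (Fin 0) (1 : A)) = 1 := by
      simp [toGr, Algebra.TensorProduct.one_def]
    exact this
  | succ k ih => rw [altPow, toGr_altWedge, ih, pow_succ]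

/-- The derivative of `altPow` at `f` in the direction `g`. -/
def altPowDeriv (f g : E [⋀^Fin 2]→ₗ[ℝ] A) : (k : ℕ) → E [⋀^Fin (2 * k)]→ₗ[ℝ] A
  | 0 => 0
  | k + 1 => altWedge (altPowDeriv f g k) f + altWedge (altPow f k) g

/-- The derivative of `fⁿ` is the sum of the `n` words `fⁱ g fⁿ⁻¹⁻ⁱ`, and under `τ` each rotates to
`fⁿ⁻¹ g`. -/
lemma map_altPowDeriv (b : Module.Basis (Fin m) ℝ E) (hτ : ∀ a c, τ (a * c) = τ (c * a)) (f g : E [⋀^Fin 2]→ₗ[ℝ] A) (k : ℕ) :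
    τ.compAlternatingMap (altPowDeriv f g (k + 1)) =
      ((k + 1 : ℕ) : ℝ) • τ.compAlternatingMap (altWedge (altPow f k) g) := by
  have hf := toGr_mem_centralGr b f
  -- The recursion multiplies by `f` on the right, so the induction carries a trailing power `fʲ`.
  -- The truncated subtraction matters only for `k = j = 0`, where the coefficient `k` is zero.
  have key : ∀ k j : ℕ, TensorProduct.map LinearMap.id τ
      (toGr b (altPowDeriv f g k) * toGr b f ^ j) = (k : ℝ) •
      TensorProduct.map LinearMap.id τ (toGr b f ^ (k + j - 1) * toGr b g) := by
    intro k
    induction k with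
    | zero =>
      intro j
      have : toGr b (altPowDeriv f g 0) = 0 := by simp [altPowDeriv, toGr]
      rw [this]
      simp
    | succ k ih =>
      intro j
      have h1 : k + (j + 1) - 1 = k + j := by omega
      have h2 : k + 1 + j - 1 = k + j := by omega
      rw [altPowDeriv, toGr_add, toGr_altWedge, toGr_altWedge, toGr_altPow, add_mul, map_add,
        mul_assoc (toGr b (altPowDeriv f g k)), ← pow_succ', ih (j + 1),
        ← map_mul_comm_of_mem_centralGr hτ (Subalgebra.pow_mem _ hf j), ← mul_assoc, ← pow_add,
        h1, h2, add_comm j k]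
      push_cast
      rw [add_smul, one_smul]
  refine toGr_injective b ?_
  have h := key (k + 1) 0
  rw [pow_zero, mul_one] at h
  rw [toGr_compAlternatingMap, h, toGr_smul, toGr_compAlternatingMap, toGr_altWedge, toGr_altPow]
  simp

end Ring

section NormedRing

variable {A : Type*} [NormedRing A] [NormedAlgebra ℝ A]

lemma contDiff_altPow {k : ℕ} {H : Type*} [NormedAddCommGroup H] [NormedSpace ℝ H]
    {f : H → E [⋀^Fin 2]→ₗ[ℝ] A} {z : H} (hf : ∀ w, ContDiffAt ℝ ∞ (fun z ↦ f z w) z)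
    (w : Fin (2 * k) → E) : ContDiffAt ℝ ∞ (fun z ↦ altPow (f z) k w) z := by
  induction k with
  | zero => exact contDiffAt_const (c := (1 : A))
  | succ k ih => exact contDiffAt_altWedge ih hf w

lemma hasDerivAt_altPow {f : ℝ → E [⋀^Fin 2]→ₗ[ℝ] A} {t : ℝ}
    (hf : ∀ w, ContDiffAt ℝ ∞ (fun t ↦ f t w) t) {f' : E [⋀^Fin 2]→ₗ[ℝ] A}
    (hf' : ∀ w, f' w = deriv (fun t ↦ f t w) t) {k : ℕ} (w : Fin (2 * k) → E) :
    HasDerivAt (fun t ↦ altPow (f t) k w) (altPowDeriv (f t) f' k w) t := by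
  have h : altPowDeriv (f t) f' k w = deriv (fun t ↦ altPow (f t) k w) t := by
    induction k with
    | zero => exact (deriv_const t (1 : A)).symm
    | succ k ih =>
      -- Taking `v = 1` and `g = 0` reduces the covariant Leibniz rule to the ordinary one in the
      -- real variable `t`.
      have h1 := altWedge_leibniz (f := fun t ↦ altPow (f t) k) (h := f) (z := t)
        (fun w ↦ (contDiff_altPow hf w).differentiableAt (by simp))
        (fun w ↦ (hf w).differentiableAt (by simp)) (1 : ℝ) (0 : A)
        (f' := altPowDeriv (f t) f' k) (h' := f') (fun w ↦ by rw [ih]; simp)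
        (fun w ↦ by rw [hf']; simp) w
      rw [zero_mul, mul_zero, add_zero, sub_zero] at h1
      exact h1.symm
  rw [h]
  exact ((contDiff_altPow hf w).differentiableAt (by simp)).hasDerivAt

end NormedRing

end EvenForms

/-! ### Chern forms -/

lemma hasDerivAt_quadratic {A : Type*} [NormedAddCommGroup A] [NormedSpace ℝ A] (a b c : A) :
    HasDerivAt (fun t : ℝ ↦ a + t • b + t ^ 2 • c) b 0 := by
  have h1 := (hasDerivAt_id (0 : ℝ)).smul_const b
  have h2 := (hasDerivAt_pow 2 (0 : ℝ)).smul_const c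
  have h3 := ((hasDerivAt_const (0 : ℝ) a).add h1).add h2
  simp only [one_smul, zero_add, Nat.cast_ofNat, Nat.add_one_sub_one, pow_one, mul_zero, zero_smul,
    add_zero] at h3
  exact h3

section ChernForms

open scoped TensorProduct

attribute [local instance] Matrix.linftyOpNormedRing Matrix.linftyOpNormedAlgebra

variable {𝕜 : Type*} [RCLike 𝕜] {m : ℕ}
  {M : Type*} [TopologicalSpace M] [ChartedSpace (EuclideanSpace ℝ (Fin m)) M]
  [IsManifold (𝓡 m) ∞ M]
  (F : Type*) [NormedAddCommGroup F] [NormedSpace ℝ F] [NormedSpace 𝕜 F]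
  [IsScalarTower ℝ 𝕜 F] [FiniteDimensional 𝕜 F]
  {V : M → Type*} [TopologicalSpace (TotalSpace F V)]
  [∀ x, AddCommGroup (V x)] [∀ x, Module ℝ (V x)] [∀ x, Module 𝕜 (V x)]
  [∀ x, IsScalarTower ℝ 𝕜 (V x)]
  [∀ x, TopologicalSpace (V x)] [∀ x, IsTopologicalAddGroup (V x)]
  [∀ x, ContinuousSMul ℝ (V x)]
  [FiberBundle F V] [VectorBundle ℝ F V] [VectorBundle 𝕜 F V] [ContMDiffVectorBundle ∞ F V (𝓡 m)]


variable {x : M} {p q : ℕ} {z : EuclideanSpace ℝ (Fin m)}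

lemma EndForm.pow_apply (a : EndForm 𝕜 m V 2) (k : ℕ) (x : M) : a.pow k x = altPow (a x) k := by
  induction k with
  | zero => rfl
  | succ k ih =>
    rw [EndForm.pow, EndForm.wedge_apply, ih]
    rfl

lemma formAt_pow (a : EndForm 𝕜 m V 2) (k : ℕ) (hz : z ∈ dom F V x) :
    formAt F (a.pow k) x z = altPow (formAt F a x z) k := by
  induction k with
  | zero =>
    ext w
    exact congrFun (congrFun (matL_one 𝕜 F hz.2) _) _
  | succ k ih =>
    rw [EndForm.pow, formAt_wedge F _ _ hz, ih]
    rfl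

lemma EndForm.tr_apply (lam : EndForm 𝕜 m V p) (x : M) (w : Fin p → EuclideanSpace ℝ (Fin m)) :
    lam.tr x w = traceₗ 𝕜 F (formAt F lam x (extChartAt (𝓡 m) x x) w) := by
  rw [formAt_self]
  exact (trace_matL 𝕜 F (FiberBundle.mem_baseSet_trivializationAt' x) _).symm

/-- A basis of the model space. -/
def stdBasis (m : ℕ) : Module.Basis (Fin m) ℝ (EuclideanSpace ℝ (Fin m)) :=
  (EuclideanSpace.basisFun (Fin m) ℝ).toBasis

lemma Connection.toGr_extD (D : Connection 𝕜 m F V) (lam : EndForm 𝕜 m V p) (x : M) :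
    toGr (stdBasis m) (D.extD F lam x) = ∑ i : Fin m,
      (ExteriorAlgebra.ι ℝ (stdBasis m i) ⊗ₜ[ℝ] (1 : Module.End 𝕜 (V x))) *
        toGr (stdBasis m) (D.covDeriv F lam x (stdBasis m i)) :=
  toGr_alternatizeUncurryFin _ _

/-- The Leibniz rule for the exterior covariant derivative of `a ∧ b`, for even `a`. -/
lemma Connection.toGr_extD_wedge (D : Connection 𝕜 m F V) {a : EndForm 𝕜 m V p}
    {b : EndForm 𝕜 m V q} (ha : a.IsSmooth F) (hb : b.IsSmooth F) (x : M)
    (hax : toGr (stdBasis m) (a x) ∈ centralGr (EuclideanSpace ℝ (Fin m))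
      (Module.End 𝕜 (V x))) :
    toGr (stdBasis m) (D.extD F (a.wedge b) x) =
      toGr (stdBasis m) (D.extD F a x) * toGr (stdBasis m) (b x) +
      toGr (stdBasis m) (a x) * toGr (stdBasis m) (D.extD F b x) := by
  simp only [D.toGr_extD F, D.covDeriv_wedge F ha hb, toGr_add, toGr_altWedge, mul_add,
    Finset.sum_add_distrib, Finset.sum_mul, Finset.mul_sum, mul_assoc]
  congr 1
  refine Finset.sum_congr rfl fun i _ ↦ ?_
  -- In the second term of the Leibniz rule the vector `ι(bᵢ)` stands to the left of `a` and must be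
  -- moved past it to meet `∇b`.
  rw [← mul_assoc, ← mul_assoc, commute_of_mem_centralGr hax]

lemma toGr_pow_mem_centralGr (a : EndForm 𝕜 m V 2) (k : ℕ) (x : M) :
    toGr (stdBasis m) (a.pow k x) ∈ centralGr (EuclideanSpace ℝ (Fin m))
      (Module.End 𝕜 (V x)) := by
  rw [EndForm.pow_apply, toGr_altPow]
  exact Subalgebra.pow_mem _ (toGr_mem_centralGr _ _) _

/-- Induction from the Bianchi identity and the Leibniz rule, which has no sign for factors in
`centralGr`. -/
lemma Connection.IsSmooth.extD_pow_curvature [T2Space M] {D : Connection 𝕜 m F V}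
    (hD : D.IsSmooth) (k : ℕ) : D.extD F ((D.curvature F).pow k) = 0 := by
  have hΩ := hD.curvature F
  induction k with
  | zero =>
    -- The identity endomorphism is parallel: its matrix is constant and commutes with `Γ`.
    have h0 : ∀ x v, D.covDeriv F ((D.curvature F).pow 0) x v = 0 := by
      intro x v
      ext1 w
      have h1 := mem_dom_self F (V := V) (m := m) x
      have h2 : (fun z ↦ formAt F ((D.curvature F).pow 0) x z w)
          =ᶠ[𝓝 (extChartAt (𝓡 m) x x)] fun _ ↦ 1 := by
        filter_upwards [(isOpen_dom F x).mem_nhds h1] with z hz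
        rw [formAt_pow F _ _ hz]
        rfl
      refine matL_injective 𝕜 F (FiberBundle.mem_baseSet_trivializationAt' x) ?_
      have h3 := h2.eq_of_nhds
      rw [D.matL_covDeriv F (hΩ.pow F 0), h2.fderiv_eq, h3, AlternatingMap.zero_apply,
        _root_.map_zero]
      simp
    funext x
    refine toGr_injective (stdBasis m) ?_
    rw [D.toGr_extD F]
    simp [h0, toGr]
  | succ k ih =>
    funext x
    refine toGr_injective (stdBasis m) ?_
    have h := D.toGr_extD_wedge F (hΩ.pow F k) hΩ x (toGr_pow_mem_centralGr _ k x)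
    rw [ih, hD.extD_curvature F] at h
    have h0 : ∀ p : ℕ, toGr (stdBasis m) (0 : EuclideanSpace ℝ (Fin m) [⋀^Fin p]→ₗ[ℝ]
      Module.End 𝕜 (V x)) = 0 := fun p ↦ by simp [toGr]
    refine h.trans ?_
    rw [Pi.zero_apply, Pi.zero_apply, Pi.zero_apply, h0, h0, h0, zero_mul, mul_zero, add_zero]

lemma Connection.IsSmooth.extD_pow_wedge [T2Space M] {D : Connection 𝕜 m F V}
    (hD : D.IsSmooth) (k : ℕ) {γ : EndForm 𝕜 m V q} (hγ : γ.IsSmooth F) :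
    D.extD F (((D.curvature F).pow k).wedge γ) =
      ((D.curvature F).pow k).wedge (D.extD F γ) := by
  funext x
  refine toGr_injective (stdBasis m) ?_
  have h := D.toGr_extD_wedge F ((hD.curvature F).pow F k) hγ x (toGr_pow_mem_centralGr _ k x)
  have h0 : toGr (stdBasis m) ((0 : EndForm 𝕜 m V (2 * k + 1)) x) = 0 := by simp [toGr]
  rw [hD.extD_pow_curvature F k, h0, zero_mul, zero_add] at h
  refine h.trans ?_
  exact (toGr_altWedge (stdBasis m) _ _).symm

/-- Since `D(Ωᵏ) = 0`, the left side is the trace of `D(Ωᵏ ∧ γ)`, and `tr ∘ D = d ∘ tr`. This is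
what makes the variation of the Chern forms exact. -/
lemma Connection.IsSmooth.tr_pow_wedge_extD [T2Space M] {D : Connection 𝕜 m F V}
    (hD : D.IsSmooth) (k : ℕ) {γ : EndForm 𝕜 m V 1} (hγ : γ.IsSmooth F) :
    (((D.curvature F).pow k).wedge (D.extD F γ)).tr =
      (((D.curvature F).pow k).wedge γ).tr.d := by
  rw [← D.tr_extD F (((hD.curvature F).pow F k).wedge F hγ), hD.extD_pow_wedge F k hγ]

lemma EndForm.tr_zero : (0 : EndForm 𝕜 m V p).tr = 0 := by
  funext x
  ext w
  exact _root_.map_zero (LinearMap.trace 𝕜 (V x))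

/-- The Chern forms are smooth and closed. -/
theorem Connection.IsSmooth.chernForm_mem_closedForms [T2Space M] {D : Connection 𝕜 m F V}
    (hD : D.IsSmooth) (k : ℕ) : D.chernForm F k ∈ closedForms 𝕜 m M (2 * k) := by
  have h := (hD.curvature F).pow F k
  refine ⟨h.tr F, ?_⟩
  rw [Connection.chernForm, ← D.tr_extD F h, hD.extD_pow_curvature F k, EndForm.tr_zero]

/-- The derivative of the Chern forms. -/
theorem Connection.IsSmooth.hasDerivAt_chernForm [T2Space M] {D : Connection 𝕜 m F V}
    (hD : D.IsSmooth) {γ : EndForm 𝕜 m V 1} (hγ : γ.IsSmooth F) (k : ℕ) (x : M)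
    (v : Fin (2 * (k + 1)) → EuclideanSpace ℝ (Fin m)) :
    HasDerivAt (fun t : ℝ ↦ (D.addForm F (t • γ)).chernForm F (k + 1) x v)
      ((k + 1 : ℕ) • (((D.curvature F).pow k).wedge (D.extD F γ)).tr x v) 0 := by
  have h0 := mem_dom_self F (V := V) (m := m) x
  set z₀ := extChartAt (𝓡 m) x x with hz₀
  set W := formAt F (D.curvature F) x z₀ with hW
  set d := formAt F (D.extD F γ) x z₀ with hd
  -- At the fixed point `x` the curvature of `∇ + tγ` is a quadratic path of matrix-valued `2`-forms
  -- with initial velocity `Dγ`.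
  set f : ℝ → EuclideanSpace ℝ (Fin m) [⋀^Fin 2]→ₗ[ℝ] Matrix (Ix 𝕜 F) (Ix 𝕜 F) 𝕜 :=
    fun t ↦ W + t • d + t ^ 2 • formAt F (γ.wedge γ) x z₀ with hf
  have hft : ∀ t, formAt F ((D.addForm F (t • γ)).curvature F) x z₀ = f t := fun t ↦ by
    rw [hD.curvature_addForm_smul F hγ, formAt_add, formAt_add, formAt_smul, formAt_smul]
  have hf0 : f 0 = W := by simp [hf]
  have hfw : ∀ w t, f t w = W w + t • d w + t ^ 2 • formAt F (γ.wedge γ) x z₀ w := fun w t ↦ rfl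
  have hfd : ∀ w, HasDerivAt (fun t ↦ f t w) (d w) 0 := fun w ↦ by
    simp only [hfw]
    exact hasDerivAt_quadratic _ _ _
  have hfc : ∀ w, ContDiffAt ℝ ∞ (fun t ↦ f t w) 0 := fun w ↦ by
    simp only [hfw]
    exact ((contDiffAt_const.add (contDiffAt_id.smul contDiffAt_const)).add
      ((contDiffAt_id.pow 2).smul contDiffAt_const))
  have h1 := hasDerivAt_altPow hfc (fun w ↦ (hfd w).deriv.symm) v
  have h2 := (LinearMap.toContinuousLinearMap (traceₗ 𝕜 F)).hasFDerivAt.comp_hasDerivAt (0 : ℝ) h1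
  have h3 := map_altPowDeriv (τ := traceₗ 𝕜 F) (stdBasis m)
    (fun a c ↦ Matrix.trace_mul_comm a c) W d k
  have h4 : (fun t : ℝ ↦ (D.addForm F (t • γ)).chernForm F (k + 1) x v) =
      fun t ↦ traceₗ 𝕜 F (altPow (f t) (k + 1) v) := by
    funext t
    rw [Connection.chernForm, EndForm.tr_apply F, formAt_pow F _ _ h0, hft]
  have h5 : traceₗ 𝕜 F (altPowDeriv (f 0) d (k + 1) v) =
      (k + 1 : ℕ) • (((D.curvature F).pow k).wedge (D.extD F γ)).tr x v := by
    rw [EndForm.tr_apply F, formAt_wedge F _ _ h0, formAt_pow F _ _ h0, hf0,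
      ← Nat.cast_smul_eq_nsmul ℝ]
    exact DFunLike.congr_fun h3 v
  rw [h4, ← h5]
  exact h2

end ChernForms

/-! ### The Chern forms of different connections are cohomologous -/

section Transgression

lemma DForm.isSmooth_sum {G : Type*} [NormedAddCommGroup G] [NormedSpace ℝ G] {m p : ℕ}
    {M : Type*} [TopologicalSpace M] [ChartedSpace (EuclideanSpace ℝ (Fin m)) M]
    {ι : Type*} (s : Finset ι) {α : ι → DForm G m M p} (h : ∀ i ∈ s, (α i).IsSmooth) :
    DForm.IsSmooth (∑ i ∈ s, α i) :=
  Finset.sum_induction α DForm.IsSmooth (fun _ _ ↦ DForm.IsSmooth.add) DForm.isSmooth_zero h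

lemma DForm.d_sum {G : Type*} [NormedAddCommGroup G] [NormedSpace ℝ G] {m p : ℕ}
    {M : Type*} [TopologicalSpace M] [ChartedSpace (EuclideanSpace ℝ (Fin m)) M]
    {ι : Type*} (s : Finset ι) {α : ι → DForm G m M p} (h : ∀ i ∈ s, (α i).IsSmooth) :
    DForm.d (∑ i ∈ s, α i) = ∑ i ∈ s, (α i).d := by
  induction s using Finset.cons_induction with
  | empty => exact DForm.d_zero
  | cons a s ha ih =>
    rw [Finset.sum_cons, Finset.sum_cons, DForm.d_add (h a (Finset.mem_cons_self a s))
      (DForm.isSmooth_sum s fun i hi ↦ h i (Finset.mem_cons_of_mem hi)),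
      ih fun i hi ↦ h i (Finset.mem_cons_of_mem hi)]


attribute [local instance] Matrix.linftyOpNormedRing Matrix.linftyOpNormedAlgebra

variable {𝕜 : Type*} [RCLike 𝕜] {m : ℕ}
  {M : Type*} [TopologicalSpace M] [ChartedSpace (EuclideanSpace ℝ (Fin m)) M]
  [IsManifold (𝓡 m) ∞ M]
  (F : Type*) [NormedAddCommGroup F] [NormedSpace ℝ F] [NormedSpace 𝕜 F]
  [IsScalarTower ℝ 𝕜 F] [FiniteDimensional 𝕜 F]
  {V : M → Type*} [TopologicalSpace (TotalSpace F V)]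
  [∀ x, AddCommGroup (V x)] [∀ x, Module ℝ (V x)] [∀ x, Module 𝕜 (V x)]
  [∀ x, IsScalarTower ℝ 𝕜 (V x)]
  [∀ x, TopologicalSpace (V x)] [∀ x, IsTopologicalAddGroup (V x)]
  [∀ x, ContinuousSMul ℝ (V x)]
  [FiberBundle F V] [VectorBundle ℝ F V] [VectorBundle 𝕜 F V] [ContMDiffVectorBundle ∞ F V (𝓡 m)]


variable {x : M} {p q : ℕ} {z : EuclideanSpace ℝ (Fin m)}

/-- The exterior product of `End(V)`-valued forms as a bilinear map. -/
def EndForm.wedgeₗ (p q : ℕ) :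
    EndForm 𝕜 m V p →ₗ[ℝ] EndForm 𝕜 m V q →ₗ[ℝ] EndForm 𝕜 m V (p + q) :=
  LinearMap.mk₂ ℝ (fun a b ↦ a.wedge b)
    (fun _ _ _ ↦ funext fun _ ↦ altWedge_add_left _ _ _)
    (fun _ _ _ ↦ funext fun _ ↦ altWedge_smul_left _ _ _)
    (fun _ _ _ ↦ funext fun _ ↦ altWedge_add_right _ _ _)
    (fun _ _ _ ↦ funext fun _ ↦ altWedge_smul_right _ _ _)

lemma EndForm.wedgeₗ_apply (a : EndForm 𝕜 m V p) (b : EndForm 𝕜 m V q) :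
    EndForm.wedgeₗ p q a b = a.wedge b := rfl

/-- The trace of `End(V)`-valued forms as a linear map. -/
def EndForm.trₗ (p : ℕ) : EndForm 𝕜 m V p →ₗ[ℝ] DForm 𝕜 m M p where
  toFun a := a.tr
  map_add' a b := by
    funext x
    ext w
    exact _root_.map_add (LinearMap.trace 𝕜 (V x)) _ _
  map_smul' c a := by
    funext x
    ext w
    exact LinearMap.map_smul_of_tower (LinearMap.trace 𝕜 (V x)) c _

lemma EndForm.trₗ_apply (a : EndForm 𝕜 m V p) : EndForm.trₗ p a = a.tr := rfl

/-- The powers of a quadratic polynomial of `2`-forms are polynomials. -/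
lemma exists_pow_eq_sum {b₀ b₁ b₂ : EndForm 𝕜 m V 2} (h₀ : b₀.IsSmooth F) (h₁ : b₁.IsSmooth F)
    (h₂ : b₂.IsSmooth F) (k : ℕ) : ∃ (ι : Type) (_ : Fintype ι) (e : ι → ℕ)
    (c : ι → EndForm 𝕜 m V (2 * k)), (∀ i, (c i).IsSmooth F) ∧
      ∀ t : ℝ, EndForm.pow (b₀ + t • b₁ + t ^ 2 • b₂) k = ∑ i, t ^ e i • c i := by
  induction k with
  | zero =>
    exact ⟨Unit, inferInstance, fun _ ↦ 0, fun _ ↦ b₀.pow 0, fun _ ↦ h₀.pow F 0,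
      fun t ↦ by simp; rfl⟩
  | succ k ih =>
    obtain ⟨ι, hι, e, c, hc, h⟩ := ih
    let b : Fin 3 → EndForm 𝕜 m V 2 := ![b₀, b₁, b₂]
    have hb : ∀ j, (b j).IsSmooth F := fun j ↦ by fin_cases j <;> assumption
    -- A term of the next power is an old term times one of the three coefficients, and `bⱼ` comes
    -- with `tʲ`, so exponents add.
    refine ⟨ι × Fin 3, inferInstance, fun i ↦ e i.1 + i.2, fun i ↦ (c i.1).wedge (b i.2),
      fun i ↦ (hc i.1).wedge F (hb i.2), fun t ↦ ?_⟩
    have h1 : b₀ + t • b₁ + t ^ 2 • b₂ = ∑ j : Fin 3, t ^ (j : ℕ) • b j := by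
      simp [Fin.sum_univ_three, b]
    have h2 : EndForm.pow (b₀ + t • b₁ + t ^ 2 • b₂) (k + 1) =
        (EndForm.pow (b₀ + t • b₁ + t ^ 2 • b₂) k).wedge (b₀ + t • b₁ + t ^ 2 • b₂) := rfl
    rw [h2, h t, h1, ← EndForm.wedgeₗ_apply, map_sum, Fintype.sum_prod_type_right]
    refine Finset.sum_congr rfl fun j _ ↦ ?_
    rw [map_sum, LinearMap.sum_apply]
    refine Finset.sum_congr rfl fun i _ ↦ ?_
    rw [map_smul, map_smul, LinearMap.smul_apply, smul_smul, EndForm.wedgeₗ_apply, pow_add,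
      mul_comm (t ^ (j : ℕ))]

/-- Used to restart the path `∇ + tγ` at any time `s`. The connection matrices agree, and they
determine the curvature. -/
lemma Connection.IsSmooth.addForm_add [T2Space M] {D : Connection 𝕜 m F V} (hD : D.IsSmooth)
    {γ γ' : EndForm 𝕜 m V 1} (hγ : γ.IsSmooth F) (hγ' : γ'.IsSmooth F) :
    ((D.addForm F γ).addForm F γ').curvature F = (D.addForm F (γ + γ')).curvature F := by
  refine ((hD.addForm F hγ).addForm F hγ').curvature_congr F (hD.addForm F (hγ.add F hγ'))
    fun x z _ w ↦ ?_
  rw [Connection.gam_addForm, Connection.gam_addForm, Connection.gam_addForm, formAt_add, add_assoc]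
  rfl

/-- The Chern forms of `∇ + γ` and of `∇` differ by an exact form. -/
lemma Connection.IsSmooth.chernForm_addForm_sub_mem [T2Space M] {D : Connection 𝕜 m F V}
    (hD : D.IsSmooth) {γ : EndForm 𝕜 m V 1} (hγ : γ.IsSmooth F) (k : ℕ) :
    (D.addForm F γ).chernForm F k - D.chernForm F k ∈ exactForms 𝕜 m M (2 * k) := by
  cases k with
  | zero =>
    have h : (D.addForm F γ).chernForm F 0 = D.chernForm F 0 := rfl
    rw [h, sub_self]
    exact zero_mem _
  | succ k =>
    -- With `Ω_{∇+tγ}ᵏ` written as a polynomial in `t`, the integral over `[0, 1]` becomes a finite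
    -- sum of forms, so smoothness and `d` pass through it at once.
    obtain ⟨ι, _, e, c, hc, hpow⟩ := exists_pow_eq_sum F (hD.curvature F) (hD.extD_one F hγ)
      (hγ.wedge F hγ) k
    set a : ι → DForm 𝕜 m M (2 * k + 1) := fun i ↦ ((c i).wedge γ).tr with ha
    have has : ∀ i, (a i).IsSmooth := fun i ↦ ((hc i).wedge F hγ).tr F
    -- The integral of `(k + 1) tᵉ` over `[0, 1]`.
    set r : ι → ℝ := fun i ↦ (k + 1 : ℕ) * ((e i : ℝ) + 1)⁻¹ with hr
    have hderiv : ∀ (x : M) (v : Fin (2 * (k + 1)) → EuclideanSpace ℝ (Fin m)) (s : ℝ),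
        HasDerivAt (fun t : ℝ ↦ (D.addForm F (t • γ)).chernForm F (k + 1) x v)
          (∑ i, ((k + 1 : ℕ) * s ^ e i : ℝ) • (a i).d x v) s := by
      intro x v s
      have hDs := hD.addForm F (hγ.smul F s)
      have h1 := hDs.hasDerivAt_chernForm F hγ k x v
      rw [hDs.tr_pow_wedge_extD F k hγ, hD.curvature_addForm_smul F hγ, hpow s] at h1
      have h2 : ((∑ i, s ^ e i • c i).wedge γ).tr = ∑ i, s ^ e i • a i := by
        rw [← EndForm.trₗ_apply, ← EndForm.wedgeₗ_apply, map_sum, LinearMap.sum_apply, map_sum]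
        refine Finset.sum_congr rfl fun i _ ↦ ?_
        rw [map_smul, LinearMap.smul_apply, map_smul]
        rfl
      have h3 : DForm.d (∑ i, s ^ e i • a i) = ∑ i, s ^ e i • (a i).d := by
        rw [DForm.d_sum _ fun i _ ↦ (has i).smul _]
        exact Finset.sum_congr rfl fun i _ ↦ DForm.d_smul _ _
      have h4 : (k + 1 : ℕ) • DForm.d (∑ i, s ^ e i • a i) x v =
          ∑ i, ((k + 1 : ℕ) * s ^ e i : ℝ) • (a i).d x v := by
        rw [h3, Finset.sum_apply, ContinuousAlternatingMap.sum_apply, ← Nat.cast_smul_eq_nsmul ℝ,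
          Finset.smul_sum]
        refine Finset.sum_congr rfl fun i _ ↦ ?_
        rw [mul_smul]
        rfl
      rw [h2, h4] at h1
      -- The derivative is known only at time `0`. Viewing `∇ + tγ` as `(∇ + sγ) + (t - s)γ`
      -- transfers it to time `s`.
      have h5 : (fun t : ℝ ↦ (D.addForm F (t • γ)).chernForm F (k + 1) x v) = fun t ↦
          ((D.addForm F (s • γ)).addForm F ((t - s) • γ)).chernForm F (k + 1) x v := by
        funext t
        rw [Connection.chernForm, Connection.chernForm, hD.addForm_add F (hγ.smul F _)
          (hγ.smul F _), ← add_smul, add_sub_cancel]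
      rw [h5]
      exact HasDerivAt.comp_sub_const s s (by rwa [sub_self])
    refine ⟨∑ i, r i • a i, DForm.isSmooth_sum _ fun i _ ↦ (has i).smul _, ?_⟩
    rw [DForm.d_sum _ fun i _ ↦ (has i).smul _]
    simp only [DForm.d_smul]
    funext x
    ext v
    have hg : ∀ s : ℝ, HasDerivAt (fun t : ℝ ↦ ∑ i, (r i * t ^ (e i + 1)) • (a i).d x v)
        (∑ i, ((k + 1 : ℕ) * s ^ e i : ℝ) • (a i).d x v) s := by
      intro s
      refine HasDerivAt.fun_sum fun i _ ↦ ?_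
      have h := ((hasDerivAt_pow (e i + 1) s).const_mul (r i)).smul_const ((a i).d x v)
      have hne : (e i : ℝ) + 1 ≠ 0 := by positivity
      convert h using 2
      rw [hr]
      push_cast
      field_simp
    -- The Chern form and the explicit antiderivative have the same derivative in `t`; comparing the
    -- constant difference at `1` and `0` gives the transgression formula.
    have hconst := is_const_of_deriv_eq_zero (𝕜 := ℝ)
      (f := fun t : ℝ ↦ (D.addForm F (t • γ)).chernForm F (k + 1) x v -
        ∑ i, (r i * t ^ (e i + 1)) • (a i).d x v)
      (fun s ↦ ((hderiv x v s).fun_sub (hg s)).differentiableAt)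
      (fun s ↦ by rw [((hderiv x v s).fun_sub (hg s)).deriv, sub_self]) 1 0
    have h0 : (D.addForm F (0 : EndForm 𝕜 m V 1)).chernForm F (k + 1) = D.chernForm F (k + 1) := by
      rw [← zero_smul ℝ γ, Connection.chernForm, Connection.chernForm,
        hD.curvature_addForm_smul F hγ]
      simp
    simp only [one_smul, one_pow, mul_one, zero_pow (Nat.succ_ne_zero _), mul_zero, zero_smul, h0,
      Finset.sum_const_zero, sub_zero] at hconst
    have h1 : (∑ i, r i • (a i).d) x v = ∑ i, r i • (a i).d x v := by
      rw [Finset.sum_apply, ContinuousAlternatingMap.sum_apply]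
      rfl
    rw [h1]
    change (D.addForm F γ).chernForm F (k + 1) x v - D.chernForm F (k + 1) x v = _
    rw [← hconst]
    abel

/-- The difference of two connections. -/
def Connection.diffForm (D' D : Connection 𝕜 m F V) : EndForm 𝕜 m V 1 := fun x ↦
  AlternatingMap.ofSubsingleton ℝ (EuclideanSpace ℝ (Fin m)) (Module.End 𝕜 (V x)) (0 : Fin 1)
    { toFun := fun v ↦
        { toFun := fun s ↦ D'.cov (extSec F s) x v - D.cov (extSec F s) x v
          map_add' := fun s s' ↦ by
            have h : extSec F (s + s') = fun y ↦ extSec F s y + extSec F s' y :=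
              funext fun y ↦ extSec_add F x s s' y
            rw [h, D'.map_add F (mdifferentiableAt_extSec F s) (mdifferentiableAt_extSec F s'),
              D.map_add F (mdifferentiableAt_extSec F s) (mdifferentiableAt_extSec F s')]
            abel
          map_smul' := fun c s ↦ by
            have h : extSec F (c • s) = fun y ↦ c • extSec F s y :=
              funext fun y ↦ extSec_smul 𝕜 F x c s y
            rw [h, D'.map_smul_cov F c (mdifferentiableAt_extSec F s),
              D.map_smul_cov F c (mdifferentiableAt_extSec F s), RingHom.id_apply, smul_sub] }
      map_add' := fun v w ↦ by
        ext s
        change D'.cov _ x (v + w) - D.cov _ x (v + w) =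
          (D'.cov _ x v - D.cov _ x v) + (D'.cov _ x w - D.cov _ x w)
        rw [_root_.map_add, _root_.map_add]
        abel
      map_smul' := fun c v ↦ by
        ext s
        change D'.cov _ x (c • v) - D.cov _ x (c • v) = c • (D'.cov _ x v - D.cov _ x v)
        rw [_root_.map_smul, _root_.map_smul, smul_sub] }

/-- Both connections are applied to the same extended section, so the derivative terms cancel and
only the connection matrices remain. -/
lemma Connection.formAt_diffForm (D' D : Connection 𝕜 m F V) (hz : z ∈ dom F V x)
    (w : EuclideanSpace ℝ (Fin m)) :
    formAt F (D'.diffForm F D) x z (fun _ ↦ w) = D'.gam F x z w - D.gam F x z w := by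
  refine Matrix.ext_of_mulVec_single fun j ↦ ?_
  set c : Ix 𝕜 F → 𝕜 := Pi.single j 1
  set y := (extChartAt (𝓡 m) x).symm z with hy
  have hd : MDifferentiableAt (𝓡 m) ((𝓡 m).prod 𝓘(ℝ, F))
      (fun y' ↦ TotalSpace.mk' F y' (extSec F (frame 𝕜 F x y c : V y) y')) y :=
    mdifferentiableAt_extSec F _
  have hcs : secAt 𝕜 F x (extSec F (frame 𝕜 F x y c : V y)) z = c := by
    have h1 : extSec F (frame 𝕜 F x y c : V y) y = frame 𝕜 F x y c := by
      rw [extSec_eq_frame 𝕜 F, frame_coord 𝕜 F (FiberBundle.mem_baseSet_trivializationAt' y)]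
    rw [secAt, ← hy, h1, coord_frame 𝕜 F hz.2]
  have h1 := D'.coord_cov F hz hd w
  have h2 := D.coord_cov F hz hd w
  rw [hcs] at h1 h2
  rw [formAt_apply, matL_mulVec, ← hy, Matrix.sub_mulVec]
  have h3 : D'.diffForm F D y (fun _ ↦ extVec x w y) (frame 𝕜 F x y c) =
    D'.cov (extSec F (frame 𝕜 F x y c : V y)) y (extVec x w y) -
      D.cov (extSec F (frame 𝕜 F x y c : V y)) y (extVec x w y) := rfl
  rw [h3, _root_.map_sub, h1, h2, add_sub_add_left_eq_sub]

lemma Connection.IsSmooth.diffForm [T2Space M] {D' D : Connection 𝕜 m F V} (hD' : D'.IsSmooth)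
    (hD : D.IsSmooth) : (D'.diffForm F D).IsSmooth F := by
  refine (EndForm.isSmooth_iff F _).2 fun x w ↦ ?_
  have h0 := mem_dom_self F (V := V) (m := m) x
  refine ((hD'.contDiffAt_gam F h0 (w 0)).sub (hD.contDiffAt_gam F h0
    (w 0))).congr_of_eventuallyEq ?_
  filter_upwards [(isOpen_dom F x).mem_nhds h0] with z hz
  rw [← D'.formAt_diffForm F D hz]
  congr 1
  funext i
  rw [Subsingleton.elim i 0]

/-- The Chern forms of two smooth connections differ by an exact form. -/
theorem Connection.IsSmooth.chernForm_sub_mem_exactForms [T2Space M] {D D' : Connection 𝕜 m F V}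
    (hD : D.IsSmooth) (hD' : D'.IsSmooth) (k : ℕ) :
    D'.chernForm F k - D.chernForm F k ∈ exactForms 𝕜 m M (2 * k) := by
  have hγ := hD'.diffForm F hD
  -- `∇ + (∇' - ∇)` is compared with `∇'` only through connection matrices, which suffices for
  -- equality of curvatures.
  have h : D'.chernForm F k = (D.addForm F (D'.diffForm F D)).chernForm F k := by
    rw [Connection.chernForm, Connection.chernForm,
      hD'.curvature_congr F (hD.addForm F hγ) fun x z hz w ↦ ?_]
    rw [Connection.gam_addForm, D'.formAt_diffForm F D hz, add_sub_cancel]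
  rw [h]
  exact hD.chernForm_addForm_sub_mem F hγ k

end Transgression

/-! ### Existence of smooth connections -/

section Existence


attribute [local instance] Matrix.linftyOpNormedRing Matrix.linftyOpNormedAlgebra

variable {𝕜 : Type*} [RCLike 𝕜] {m : ℕ}
  {M : Type*} [TopologicalSpace M] [ChartedSpace (EuclideanSpace ℝ (Fin m)) M]
  [IsManifold (𝓡 m) ∞ M]
  (F : Type*) [NormedAddCommGroup F] [NormedSpace ℝ F] [NormedSpace 𝕜 F]
  [IsScalarTower ℝ 𝕜 F] [FiniteDimensional 𝕜 F]
  {V : M → Type*} [TopologicalSpace (TotalSpace F V)]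
  [∀ x, AddCommGroup (V x)] [∀ x, Module ℝ (V x)] [∀ x, Module 𝕜 (V x)]
  [∀ x, IsScalarTower ℝ 𝕜 (V x)]
  [∀ x, TopologicalSpace (V x)] [∀ x, IsTopologicalAddGroup (V x)]
  [∀ x, ContinuousSMul ℝ (V x)]
  [FiberBundle F V] [VectorBundle ℝ F V] [VectorBundle 𝕜 F V] [ContMDiffVectorBundle ∞ F V (𝓡 m)]

variable {x i : M} {z : EuclideanSpace ℝ (Fin m)}

/-- The coordinates of a section in the preferred local frame at `i`, as a function on `M`. -/
def secCoord (𝕜 : Type*) [RCLike 𝕜] [NormedSpace 𝕜 F] [IsScalarTower ℝ 𝕜 F] [FiniteDimensional 𝕜 F]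
    [∀ x, Module 𝕜 (V x)] [VectorBundle 𝕜 F V] (i : M) (σ : Π y, V y) (y : M) : Ix 𝕜 F → 𝕜 :=
  coord 𝕜 F i y (σ y)

/-- The intersection of the domains of the preferred chart and the preferred trivialization. -/
def frameDom (V : M → Type*) [TopologicalSpace (TotalSpace F V)] [∀ x, TopologicalSpace (V x)]
    [FiberBundle F V] (i : M) : Set M :=
  (extChartAt (𝓡 m) i).source ∩ (trivializationAt F V i).baseSet

lemma isOpen_frameDom : IsOpen (frameDom (m := m) F V i) :=
  (isOpen_source i).inter (trivializationAt F V i).open_baseSet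

lemma mem_frameDom_self : i ∈ frameDom (m := m) F V i :=
  ⟨mem_extChartAt_source i, FiberBundle.mem_baseSet_trivializationAt' i⟩

lemma extChartAt_mem_dom {y : M} (hy : y ∈ frameDom (m := m) F V i) :
    extChartAt (𝓡 m) i y ∈ dom F V i := by
  refine ⟨(extChartAt (𝓡 m) i).map_source hy.1, ?_⟩
  rw [mem_preimage, (extChartAt (𝓡 m) i).left_inv hy.1]
  exact hy.2

lemma contMDiffAt_secCoord {y : M} (hy : y ∈ frameDom (m := m) F V i) {σ : Π y, V y}
    (hσ : ContMDiffAt (𝓡 m) ((𝓡 m).prod 𝓘(ℝ, F)) ∞ (fun y ↦ TotalSpace.mk' F y (σ y)) y) :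
    ContMDiffAt (𝓡 m) 𝓘(ℝ, Ix 𝕜 F → 𝕜) ∞ (secCoord F 𝕜 i σ) y := by
  have h := (extChartAt (𝓡 m) i).left_inv hy.1
  have hz := extChartAt_mem_dom F hy
  rw [← h] at hσ ⊢
  exact (contMDiffAt_iff_comp_symm hz.1).2 ((contMDiffAt_iff_secAt 𝕜 F hz σ).1 hσ)

lemma mdifferentiableAt_secCoord {y : M} (hy : y ∈ frameDom (m := m) F V i) {σ : Π y, V y}
    (hσ : MDifferentiableAt (𝓡 m) ((𝓡 m).prod 𝓘(ℝ, F)) (fun y ↦ TotalSpace.mk' F y (σ y)) y) :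
    MDifferentiableAt (𝓡 m) 𝓘(ℝ, Ix 𝕜 F → 𝕜) (secCoord F 𝕜 i σ) y := by
  have h := (extChartAt (𝓡 m) i).left_inv hy.1
  have hz := extChartAt_mem_dom F hy
  rw [← h] at hσ ⊢
  exact (mdifferentiableAt_iff_comp_symm hz.1).2 ((mdifferentiableAt_iff_secAt 𝕜 F hz σ).1 hσ)

/-- The derivative at `x` of a function on `M` as a linear map on the tangent space. -/
def chartFDeriv {G : Type*} [NormedAddCommGroup G] [NormedSpace ℝ G] (g : M → G) (x : M) :
    EuclideanSpace ℝ (Fin m) →L[ℝ] G :=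
  fderiv ℝ (g ∘ (extChartAt (𝓡 m) x).symm) (extChartAt (𝓡 m) x x)

lemma chartFDeriv_extVec {G : Type*} [NormedAddCommGroup G] [NormedSpace ℝ G] {g : M → G}
    (hz : z ∈ (extChartAt (𝓡 m) x).target)
    (hg : MDifferentiableAt (𝓡 m) 𝓘(ℝ, G) g ((extChartAt (𝓡 m) x).symm z))
    (w : EuclideanSpace ℝ (Fin m)) :
    chartFDeriv g ((extChartAt (𝓡 m) x).symm z) (extVec x w ((extChartAt (𝓡 m) x).symm z)) =
      fderiv ℝ (g ∘ (extChartAt (𝓡 m) x).symm) z w := by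
  have h := mfderiv_comp z hg (mdifferentiableAt_extChartAt_symm hz)
  rw [mfderiv_eq_fderiv] at h
  rw [h, extVec_eq ((extChartAt (𝓡 m) x).map_target hz), (extChartAt (𝓡 m) x).right_inv hz]
  have h2 : ∀ y, MDifferentiableAt (𝓡 m) 𝓘(ℝ, G) g y →
      mfderiv (𝓡 m) 𝓘(ℝ, G) g y = chartFDeriv g y := by
    intro y hy
    refine hy.mfderiv.trans ?_
    simp only [chartFDeriv, writtenInExtChartAt, modelWithCornersSelf_coe, range_id,
      fderivWithin_univ]
    rfl
  rw [← h2 _ hg]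
  rfl

lemma differentiableAt_comp_symm_self {G : Type*} [NormedAddCommGroup G] [NormedSpace ℝ G]
    {g : M → G} (hg : MDifferentiableAt (𝓡 m) 𝓘(ℝ, G) g x) :
    DifferentiableAt ℝ (g ∘ (extChartAt (𝓡 m) x).symm) (extChartAt (𝓡 m) x x) := by
  rw [← mdifferentiableAt_iff_comp_symm (mem_extChartAt_target x), extChartAt_to_inv]
  exact hg

/-- The covariant derivative for which the preferred local frame at `i` is parallel. -/
def frameCov (𝕜 : Type*) [RCLike 𝕜] [NormedSpace 𝕜 F] [IsScalarTower ℝ 𝕜 F] [FiniteDimensional 𝕜 F]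
    [∀ x, Module 𝕜 (V x)] [∀ x, IsScalarTower ℝ 𝕜 (V x)] [VectorBundle 𝕜 F V]
    (i : M) (σ : Π y, V y) (x : M) : EuclideanSpace ℝ (Fin m) →ₗ[ℝ] V x :=
  ((frame 𝕜 F i x).restrictScalars ℝ) ∘ₗ (chartFDeriv (secCoord F 𝕜 i σ) x).toLinearMap

lemma frameCov_add (hx : x ∈ frameDom (m := m) F V i) {σ τ : Π y, V y}
    (hσ : MDifferentiableAt (𝓡 m) ((𝓡 m).prod 𝓘(ℝ, F)) (fun y ↦ TotalSpace.mk' F y (σ y)) x)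
    (hτ : MDifferentiableAt (𝓡 m) ((𝓡 m).prod 𝓘(ℝ, F)) (fun y ↦ TotalSpace.mk' F y (τ y)) x) :
    frameCov (m := m) F 𝕜 i (σ + τ) x = frameCov F 𝕜 i σ x + frameCov F 𝕜 i τ x := by
  have h : secCoord F 𝕜 i (σ + τ) ∘ (extChartAt (𝓡 m) x).symm =
      secCoord F 𝕜 i σ ∘ (extChartAt (𝓡 m) x).symm +
        secCoord F 𝕜 i τ ∘ (extChartAt (𝓡 m) x).symm := by
    funext z
    exact _root_.map_add (coord 𝕜 F i _) _ _
  ext v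
  simp only [frameCov, chartFDeriv]
  rw [h, fderiv_add (differentiableAt_comp_symm_self (mdifferentiableAt_secCoord F hx hσ))
    (differentiableAt_comp_symm_self (mdifferentiableAt_secCoord F hx hτ))]
  exact _root_.map_add (frame 𝕜 F i x) _ _

lemma frameCov_smul (hx : x ∈ frameDom (m := m) F V i) (c : 𝕜) {σ : Π y, V y}
    (hσ : MDifferentiableAt (𝓡 m) ((𝓡 m).prod 𝓘(ℝ, F)) (fun y ↦ TotalSpace.mk' F y (σ y)) x)
    (v : EuclideanSpace ℝ (Fin m)) :
    frameCov (m := m) F 𝕜 i (fun y ↦ c • σ y) x v = c • frameCov F 𝕜 i σ x v := by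
  have h : secCoord F 𝕜 i (fun y ↦ c • σ y) ∘ (extChartAt (𝓡 m) x).symm =
      c • (secCoord F 𝕜 i σ ∘ (extChartAt (𝓡 m) x).symm) := by
    funext z
    exact _root_.map_smul (coord 𝕜 F i _) _ _
  simp only [frameCov, chartFDeriv]
  rw [h, fderiv_const_smul
    (differentiableAt_comp_symm_self (mdifferentiableAt_secCoord F hx hσ))]
  exact _root_.map_smul (frame 𝕜 F i x) _ _

lemma frameCov_leibniz (hx : x ∈ frameDom (m := m) F V i) {σ : Π y, V y} {g : M → ℝ}
    (hσ : MDifferentiableAt (𝓡 m) ((𝓡 m).prod 𝓘(ℝ, F)) (fun y ↦ TotalSpace.mk' F y (σ y)) x)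
    (hg : MDifferentiableAt (𝓡 m) 𝓘(ℝ, ℝ) g x) (v : EuclideanSpace ℝ (Fin m)) :
    frameCov (m := m) F 𝕜 i (g • σ) x v = g x • frameCov F 𝕜 i σ x v + chartFDeriv g x v • σ x := by
  have h : secCoord F 𝕜 i (g • σ) ∘ (extChartAt (𝓡 m) x).symm = fun z ↦
      (g ∘ (extChartAt (𝓡 m) x).symm) z • (secCoord F 𝕜 i σ ∘ (extChartAt (𝓡 m) x).symm) z := by
    funext z
    exact coord_smul_real F _ _
  simp only [frameCov, chartFDeriv]
  rw [h, fderiv_fun_smul (differentiableAt_comp_symm_self hg)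
    (differentiableAt_comp_symm_self (mdifferentiableAt_secCoord F hx hσ))]
  have h1 : frame 𝕜 F i x (secCoord F 𝕜 i σ x) = σ x := frame_coord 𝕜 F hx.2 _
  simp only [LinearMap.comp_apply, LinearMap.restrictScalars_apply, ContinuousLinearMap.coe_coe,
    add_apply, smul_apply, ContinuousLinearMap.smulRight_apply, Function.comp_apply,
    extChartAt_to_inv, _root_.map_add, LinearMap.map_smul_of_tower, h1]

lemma mvfderiv_eq_chartFDeriv {g : M → ℝ} (hg : MDifferentiableAt (𝓡 m) 𝓘(ℝ, ℝ) g x)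
    (v : EuclideanSpace ℝ (Fin m)) : mvfderiv (𝓡 m) g x v = chartFDeriv g x v := by
  rw [← extChartAt_to_inv (I := 𝓡 m) x] at hg
  have h1 := chartFDeriv_extVec (mem_extChartAt_target x) hg v
  have h2 := mfderiv_extVec (mem_extChartAt_target x) hg v
  rw [extChartAt_to_inv, extVec_self] at h1 h2
  exact h2.trans h1.symm

/-- The covariant derivative patched together from the local flat connections by a partition of
unity. -/
def patchCov (𝕜 : Type*) [RCLike 𝕜] [NormedSpace 𝕜 F] [IsScalarTower ℝ 𝕜 F] [FiniteDimensional 𝕜 F]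
    [∀ x, Module 𝕜 (V x)] [∀ x, IsScalarTower ℝ 𝕜 (V x)] [VectorBundle 𝕜 F V]
    (ρ : SmoothPartitionOfUnity M (𝓡 m) M univ) (σ : Π y, V y) (x : M) :
    EuclideanSpace ℝ (Fin m) →ₗ[ℝ] V x :=
  ∑ i ∈ ρ.finsupport x, ρ i x • frameCov F 𝕜 i σ x

lemma patchCov_apply (ρ : SmoothPartitionOfUnity M (𝓡 m) M univ) (σ : Π y, V y) (x : M)
    (v : EuclideanSpace ℝ (Fin m)) : patchCov F 𝕜 ρ σ x v =
      ∑ i ∈ ρ.finsupport x, ρ i x • frameCov F 𝕜 i σ x v := by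
  simp [patchCov, LinearMap.sum_apply]

section Patch

variable {ρ : SmoothPartitionOfUnity M (𝓡 m) M univ}

lemma mem_frameDom_of_mem_finsupport
    (hρ : ρ.IsSubordinate fun i ↦ frameDom (m := m) F V i)
    (hi : i ∈ ρ.finsupport x) : x ∈ frameDom (m := m) F V i :=
  hρ i (subset_tsupport _ ((ρ.mem_finsupport x).1 hi))

lemma patchCov_add (hρ : ρ.IsSubordinate fun i ↦ frameDom (m := m) F V i)
    {σ τ : Π y, V y}
    (hσ : MDifferentiableAt (𝓡 m) ((𝓡 m).prod 𝓘(ℝ, F)) (fun y ↦ TotalSpace.mk' F y (σ y)) x)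
    (hτ : MDifferentiableAt (𝓡 m) ((𝓡 m).prod 𝓘(ℝ, F)) (fun y ↦ TotalSpace.mk' F y (τ y)) x)
    (v : EuclideanSpace ℝ (Fin m)) :
    patchCov F 𝕜 ρ (σ + τ) x v = patchCov F 𝕜 ρ σ x v + patchCov F 𝕜 ρ τ x v := by
  simp only [patchCov_apply]
  rw [← Finset.sum_add_distrib]
  refine Finset.sum_congr rfl fun i hi ↦ ?_
  rw [frameCov_add F (mem_frameDom_of_mem_finsupport F hρ hi) hσ hτ, LinearMap.add_apply, smul_add]

/-- Each local connection contributes `ρᵢ(x) • dg(v) σ`. Because the weights sum to one, the term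
`dg(v) σ` appears exactly once: covariant derivatives are closed under affine combinations. -/
lemma patchCov_leibniz (hρ : ρ.IsSubordinate fun i ↦ frameDom (m := m) F V i)
    {σ : Π y, V y} {g : M → ℝ}
    (hσ : MDifferentiableAt (𝓡 m) ((𝓡 m).prod 𝓘(ℝ, F)) (fun y ↦ TotalSpace.mk' F y (σ y)) x)
    (hg : MDifferentiableAt (𝓡 m) 𝓘(ℝ, ℝ) g x) (v : EuclideanSpace ℝ (Fin m)) :
    patchCov F 𝕜 ρ (g • σ) x v = g x • patchCov F 𝕜 ρ σ x v + mvfderiv (𝓡 m) g x v • σ x := by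
  simp only [patchCov_apply]
  rw [mvfderiv_eq_chartFDeriv hg, Finset.sum_congr rfl fun i hi ↦ by
      rw [frameCov_leibniz F (mem_frameDom_of_mem_finsupport F hρ hi) hσ hg, smul_add],
    Finset.sum_add_distrib, ← Finset.sum_smul, ρ.sum_finsupport x (mem_univ x), one_smul,
    Finset.smul_sum]
  exact congrArg (· + _) (Finset.sum_congr rfl fun i _ ↦ smul_comm _ _ _)

lemma patchCov_smul (hρ : ρ.IsSubordinate fun i ↦ frameDom (m := m) F V i)
    (c : 𝕜) {σ : Π y, V y}
    (hσ : MDifferentiableAt (𝓡 m) ((𝓡 m).prod 𝓘(ℝ, F)) (fun y ↦ TotalSpace.mk' F y (σ y)) x)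
    (v : EuclideanSpace ℝ (Fin m)) :
    patchCov F 𝕜 ρ (fun y ↦ c • σ y) x v = c • patchCov F 𝕜 ρ σ x v := by
  simp only [patchCov_apply]
  rw [Finset.smul_sum]
  refine Finset.sum_congr rfl fun i hi ↦ ?_
  rw [frameCov_smul F (mem_frameDom_of_mem_finsupport F hρ hi) c hσ, smul_comm]

end Patch

/-- The connection patched together from the local flat connections by a partition of unity. -/
def patchConnection (ρ : SmoothPartitionOfUnity M (𝓡 m) M univ)
    (hρ : ρ.IsSubordinate fun i ↦ frameDom (m := m) F V i) : Connection 𝕜 m F V where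
  toFun σ x := (LinearMap.toContinuousLinearMap (patchCov F 𝕜 ρ σ x) :
    EuclideanSpace ℝ (Fin m) →L[ℝ] V x)
  isCovariantDerivativeOnUniv :=
    { add := fun hσ hσ' _ ↦ ContinuousLinearMap.ext fun v ↦ patchCov_add F hρ hσ hσ' v
      leibniz := fun hσ hg _ ↦ ContinuousLinearMap.ext fun v ↦ patchCov_leibniz F hρ hσ hg v }
  map_smul' c _ _ v h := patchCov_smul F hρ c h v

/-- In the frame at `x`, the `j`-th column of `Γ(w)` is `∑ᵢ ρᵢ Aᵢ ∂_w gᵢ`, where `gᵢ` gives the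
coordinates of the `j`-th frame section in the frame at `i` and `Aᵢ` changes frames back. Every
factor is smooth. -/
lemma isSmooth_patchConnection (ρ : SmoothPartitionOfUnity M (𝓡 m) M univ)
    (hρ : ρ.IsSubordinate fun i ↦ frameDom (m := m) F V i) :
    (patchConnection (𝕜 := 𝕜) F ρ hρ).IsSmooth := by
  refine Connection.isSmooth_of_gam F fun x w ↦ ?_
  have h0 := mem_dom_self F (V := V) (m := m) x
  have hx : (extChartAt (𝓡 m) x).symm (extChartAt (𝓡 m) x x) = x := extChartAt_to_inv x
  have hc : ContinuousAt (extChartAt (𝓡 m) x).symm (extChartAt (𝓡 m) x x) :=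
    continuousAt_extChartAt_symm x
  -- the coordinate changes between frames
  let A (i : M) (z : EuclideanSpace ℝ (Fin m)) : Matrix (Ix 𝕜 F) (Ix 𝕜 F) 𝕜 :=
    LinearMap.toMatrix' (coord 𝕜 F (V := V) x ((extChartAt (𝓡 m) x).symm z) ∘ₗ
      frame 𝕜 F i ((extChartAt (𝓡 m) x).symm z))
  have hA : ∀ i ∈ ρ.fintsupport x, ContDiffAt ℝ ∞ (A i) (extChartAt (𝓡 m) x x) := by
    intro i hi
    have hxi := hρ i ((ρ.mem_fintsupport_iff x i).1 hi)
    refine contDiffAt_matrix 𝕜 F fun c ↦ ?_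
    have h1 := contMDiffAt_frame 𝕜 F (k := ∞) (extChartAt_mem_dom F hxi) c
    rw [(extChartAt (𝓡 m) i).left_inv hxi.1] at h1
    nth_rw 1 [← hx] at h1
    have h2 := (contMDiffAt_iff_secAt 𝕜 F h0 _).1 h1
    refine h2.congr_of_eventuallyEq (Eventually.of_forall fun z ↦ ?_)
    exact LinearMap.toMatrix'_mulVec _ _
  refine contDiffAt_of_separating (ι := Ix 𝕜 F)
    (fun j ↦ (mulVecₗ 𝕜 F).flip (Pi.single j 1)) (fun B hB ↦ ?_) (fun j ↦ ?_)
  · refine Matrix.ext_of_mulVec_single fun i ↦ ?_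
    rw [Matrix.zero_mulVec]
    exact hB i
  let g (i : M) : M → (Ix 𝕜 F → 𝕜) :=
    secCoord F 𝕜 i (fun y ↦ (frame 𝕜 F x y (Pi.single j 1) : V y))
  have hfr : ∀ z ∈ dom F V x, ContMDiffAt (𝓡 m) ((𝓡 m).prod 𝓘(ℝ, F)) ∞ (fun y ↦
      TotalSpace.mk' F y (frame 𝕜 F x y (Pi.single j 1) : V y)) ((extChartAt (𝓡 m) x).symm z) :=
    fun z hz ↦ contMDiffAt_frame 𝕜 F (k := ∞) hz _
  have hsum : ContDiffAt ℝ ∞ (fun z ↦ ∑ i ∈ ρ.fintsupport x,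
      ρ i ((extChartAt (𝓡 m) x).symm z) •
        (A i z).mulVec (fderiv ℝ (g i ∘ (extChartAt (𝓡 m) x).symm) z w))
      (extChartAt (𝓡 m) x x) := by
    refine ContDiffAt.sum fun i hi ↦ ?_
    have hxi := hρ i ((ρ.mem_fintsupport_iff x i).1 hi)
    rw [← hx] at hxi
    have h1 : ContDiffAt ℝ ∞ (g i ∘ (extChartAt (𝓡 m) x).symm) (extChartAt (𝓡 m) x x) :=
      (contMDiffAt_iff_comp_symm h0.1).1 (contMDiffAt_secCoord F hxi (hfr _ h0))
    have h2 : ContDiffAt ℝ ∞ (ρ i ∘ (extChartAt (𝓡 m) x).symm) (extChartAt (𝓡 m) x x) :=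
      (contMDiffAt_iff_comp_symm h0.1).1 (ρ i).contMDiff.contMDiffAt
    exact h2.smul (contDiffAt_mulVec 𝕜 F (hA i hi)
      ((h1.fderiv_right (m := ∞) le_rfl).clm_apply contDiffAt_const))
  refine hsum.congr_of_eventuallyEq ?_
  -- The index set `ρ.finsupport y` varies with `y`; near `x` it lies in the fixed finite set
  -- `ρ.fintsupport x`, and the extra terms vanish.
  have hev : ∀ᶠ y in 𝓝 ((extChartAt (𝓡 m) x).symm (extChartAt (𝓡 m) x x)),
      ρ.finsupport y ⊆ ρ.fintsupport x := by
    rw [hx]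
    exact ρ.eventually_finsupport_subset x
  filter_upwards [hc.eventually hev, (isOpen_dom F x).mem_nhds h0] with z hz hz'
  rw [← Finset.sum_subset hz fun i _ hi ↦ by
    have : ρ i ((extChartAt (𝓡 m) x).symm z) = 0 := by simpa using hi
    rw [this, zero_smul]]
  have hcol : (mulVecₗ 𝕜 F).flip (Pi.single j 1) ((patchConnection (𝕜 := 𝕜) F ρ hρ).gam F x z w) =
      coord 𝕜 F x ((extChartAt (𝓡 m) x).symm z)
        (patchCov F 𝕜 ρ (fun y ↦ (frame 𝕜 F x y (Pi.single j 1) : V y))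
          ((extChartAt (𝓡 m) x).symm z) (extVec x w ((extChartAt (𝓡 m) x).symm z))) :=
    (Matrix.mulVec_single_one ((patchConnection (𝕜 := 𝕜) F ρ hρ).gam F x z w) j).trans rfl
  rw [hcol, patchCov_apply, _root_.map_sum]
  refine Finset.sum_congr rfl fun i hi ↦ ?_
  have hyi := mem_frameDom_of_mem_finsupport F hρ hi
  rw [coord_smul_real, frameCov, LinearMap.comp_apply,
    ContinuousLinearMap.coe_coe, chartFDeriv_extVec hz'.1
      (mdifferentiableAt_secCoord F hyi ((hfr z hz').mdifferentiableAt (by simp)))]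
  exact congrArg _ (LinearMap.toMatrix'_mulVec (coord 𝕜 F (V := V) x ((extChartAt (𝓡 m) x).symm z) ∘ₗ
      frame 𝕜 F i ((extChartAt (𝓡 m) x).symm z)) _).symm

theorem exists_isSmooth_connection [T2Space M] [SecondCountableTopology M] :
    ∃ D : Connection 𝕜 m F V, D.IsSmooth := by
  have : LocallyCompactSpace M := ChartedSpace.locallyCompactSpace (EuclideanSpace ℝ (Fin m)) M
  obtain ⟨ρ, hρ⟩ := SmoothPartitionOfUnity.exists_isSubordinate (𝓡 m) (isClosed_univ (X := M))
    (fun i ↦ frameDom (m := m) F V i) (fun i ↦ isOpen_frameDom F)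
    (fun i _ ↦ mem_iUnion_of_mem i (mem_frameDom_self F))
  exact ⟨patchConnection F ρ hρ, isSmooth_patchConnection F ρ hρ⟩

end Existence

/-! ### Integration of forms of top degree -/

section Integration

/-- Alternating maps are determined by injective basis tuples, which in top degree are permutations
of the basis. -/
lemma alternatingMap_eq_det_smul {E G : Type*} [AddCommGroup E] [Module ℝ E]
    [AddCommGroup G] [Module ℝ G] {n : ℕ} (b : Module.Basis (Fin n) ℝ E) (f : E [⋀^Fin n]→ₗ[ℝ] G)
    (v : Fin n → E) : f v = b.det v • f b := by
  have h : f = (LinearMap.toSpanSingleton ℝ G (f b)).compAlternatingMap b.det := by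
    refine b.ext_alternating fun v hv ↦ ?_
    obtain ⟨σ, rfl⟩ : ∃ σ : Equiv.Perm (Fin n), v = σ :=
      ⟨Equiv.ofBijective v (Finite.injective_iff_bijective.1 hv), rfl⟩
    have h1 := f.map_perm b σ
    have h2 := b.det.map_perm b σ
    simp only [Function.comp_def] at h1 h2
    rw [LinearMap.compAlternatingMap_apply, h1, h2, b.det_self, LinearMap.toSpanSingleton_apply]
    rcases Int.units_eq_one_or (Equiv.Perm.sign σ) with h | h <;> simp [h]
  exact DFunLike.congr_fun h v

/-- Integration by parts against the constant function `1`. -/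
lemma integral_fderiv_eq_zero {E G : Type*} [NormedAddCommGroup E] [NormedSpace ℝ E]
    [FiniteDimensional ℝ E] [MeasurableSpace E] [BorelSpace E] (μ : Measure E)
    [μ.IsAddHaarMeasure] [NormedAddCommGroup G] [NormedSpace ℝ G] {f : E → G}
    (hf : ContDiff ℝ 1 f) (hc : HasCompactSupport f) (v : E) : ∫ x, fderiv ℝ f x v ∂μ = 0 := by
  have h1 : Integrable (fun x ↦ fderiv ℝ f x v) μ :=
    ((hf.continuous_fderiv (by simp)).clm_apply continuous_const).integrable_of_hasCompactSupport
      (hc.fderiv_apply ℝ v)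
  have h := integral_smul_fderiv_eq_neg_fderiv_smul_of_integrable (μ := μ) (f := fun _ : E ↦ (1 : ℝ))
    (g := f) (v := v) (by simp) (by simpa using h1)
    (by simpa using hf.continuous.integrable_of_hasCompactSupport hc)
    (fun x _ ↦ differentiableAt_const _) (fun x _ ↦ (hf.differentiable (by simp)).differentiableAt)
  simpa using h

lemma contDiffAt_extDeriv {E G : Type*} [NormedAddCommGroup E] [NormedSpace ℝ E]
    [NormedAddCommGroup G] [NormedSpace ℝ G] {n : ℕ} {η : E → E [⋀^Fin n]→L[ℝ] G} {z : E}
    (h : ContDiffAt ℝ ∞ η z) : ContDiffAt ℝ ∞ (extDeriv η) z :=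
  ContDiffAt.comp (g := ContinuousAlternatingMap.alternatizeUncurryFinCLM ℝ E G) z
    (ContinuousLinearMap.contDiff _).contDiffAt (h.fderiv_right (m := ∞) le_rfl)

variable {G : Type*} [NormedAddCommGroup G] [NormedSpace ℝ G] {m p : ℕ} {M : Type*}
  [TopologicalSpace M] [ChartedSpace (EuclideanSpace ℝ (Fin m)) M]

/-- The product of a form with a function. -/
def DForm.mulFun (h : M → ℝ) (α : DForm G m M p) : DForm G m M p := fun x ↦ h x • α x

variable [IsManifold (𝓡 m) ∞ M] {c c' : M}

lemma DForm.IsSmooth.mulFun {h : M → ℝ} (hh : ContMDiff (𝓡 m) 𝓘(ℝ, ℝ) ∞ h) {α : DForm G m M p}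
    (hα : α.IsSmooth) : (DForm.mulFun h α).IsSmooth := fun _ ↦
  ContDiffOn.smul (fun _ hz ↦ ((contMDiffAt_iff_comp_symm hz).1 hh.contMDiffAt).contDiffWithinAt)
    (hα _)

lemma DForm.IsSmooth.d {α : DForm G m M p} (hα : α.IsSmooth) : α.d.IsSmooth := by
  intro c
  have h : ContDiffOn ℝ ∞ (extDeriv (α.rep c)) (extChartAt (𝓡 m) c).target := fun z hz ↦
    (contDiffAt_extDeriv ((hα c).contDiffAt ((isOpen_target c).mem_nhds hz))).contDiffWithinAt
  exact h.congr fun z hz ↦ α.rep_d hα hz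

/-- The sign of the orientation form in the preferred chart at `c`. -/
def orientSign (o : DForm ℝ m M m) (c : M) (y : EuclideanSpace ℝ (Fin m)) : ℝ :=
  (SignType.sign (o.rep c y fun i ↦ EuclideanSpace.single i (1 : ℝ)) : ℝ)

lemma DForm.rep_apply_eq_det (α : DForm G m M m) {y : EuclideanSpace ℝ (Fin m)}
    (hy : y ∈ (extChartAt (𝓡 m) c).target)
    (hy' : (extChartAt (𝓡 m) c).symm y ∈ (extChartAt (𝓡 m) c').source) :
    α.rep c y (fun i ↦ EuclideanSpace.single i (1 : ℝ)) = (fderiv ℝ (chTr c c') y).det •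
      α.rep c' (chTr c c' y) (fun i ↦ EuclideanSpace.single i (1 : ℝ)) := by
  let b := (EuclideanSpace.basisFun (Fin m) ℝ).toBasis
  have hb : ⇑b = fun i ↦ EuclideanSpace.single i (1 : ℝ) := by
    funext i
    simp [b]
  have h := alternatingMap_eq_det_smul b (α.rep c' (chTr c c' y)).toAlternatingMap
    (fderiv ℝ (chTr c c') y ∘ b)
  have h2 := b.det_comp (fderiv ℝ (chTr c c') y).toLinearMap b
  rw [ContinuousLinearMap.coe_coe, b.det_self, mul_one] at h2
  rw [h2, hb] at h
  rw [α.rep_eq_pullback hy hy']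
  exact h

/-- If this one coefficient vanished, the top-degree form would vanish in the chart at `c`, hence,
by pullback to the chart centred at the point, on `M` itself. -/
lemma rep_orientation_ne_zero {o : DForm ℝ m M m} (ho : ∀ x, o x ≠ 0)
    {y : EuclideanSpace ℝ (Fin m)} (hy : y ∈ (extChartAt (𝓡 m) c).target) :
    o.rep c y (fun i ↦ EuclideanSpace.single i (1 : ℝ)) ≠ 0 := by
  intro h
  let b := (EuclideanSpace.basisFun (Fin m) ℝ).toBasis
  have hb : ⇑b = fun i ↦ EuclideanSpace.single i (1 : ℝ) := by
    funext i
    simp [b]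
  have h1 : o.rep c y = 0 := by
    ext v
    have := alternatingMap_eq_det_smul b (o.rep c y).toAlternatingMap v
    rw [hb] at this
    refine this.trans ?_
    rw [ContinuousAlternatingMap.coe_toAlternatingMap, h, smul_zero]
    rfl
  set q := (extChartAt (𝓡 m) c).symm y with hq
  have h2 : chTr q c (extChartAt (𝓡 m) q q) = y := by
    rw [chTr, Function.comp_apply, extChartAt_to_inv, hq, (extChartAt (𝓡 m) c).right_inv hy]
  have h3 := o.rep_eq_pullback (x := q) (x' := c) (mem_extChartAt_target q)
    (by rw [extChartAt_to_inv]; exact (extChartAt (𝓡 m) c).map_target hy)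
  rw [h2, h1] at h3
  refine ho q ?_
  ext v
  have h4 := DFunLike.congr_fun h3 v
  rw [DForm.rep_apply, chartD_self, extChartAt_to_inv] at h4
  exact h4

/-- A continuous nonvanishing coefficient keeps its sign locally. Charts need not be oriented or
connected: the sign is a locally constant factor that can be taken out of derivatives. -/
lemma eventually_orientSign_eq {o : DForm ℝ m M m} (hs : o.IsSmooth) (ho : ∀ x, o x ≠ 0)
    {y : EuclideanSpace ℝ (Fin m)} (hy : y ∈ (extChartAt (𝓡 m) c).target) :
    ∀ᶠ y' in 𝓝 y, orientSign o c y' = orientSign o c y := by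
  have h1 : ContinuousAt (fun y ↦ o.rep c y fun i ↦ EuclideanSpace.single i (1 : ℝ)) y :=
    ((ContinuousAlternatingMap.apply ℝ _ ℝ _).continuous.continuousAt).comp
      ((hs c).continuousOn.continuousAt ((isOpen_target c).mem_nhds hy))
  have h0 := rep_orientation_ne_zero ho hy
  rcases lt_or_gt_of_ne h0 with h | h
  · filter_upwards [h1.eventually (gt_mem_nhds h)] with y' hy'
    rw [orientSign, orientSign, sign_neg hy', sign_neg h]
  · filter_upwards [h1.eventually (lt_mem_nhds h)] with y' hy'
    rw [orientSign, orientSign, sign_pos hy', sign_pos h]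

/-- Both `α` and `o` change by the determinant of the transition; the sign coming from `o` turns the
determinant coming from `α` into its absolute value, as change of variables requires. -/
lemma orientSign_smul_rep (o : DForm ℝ m M m) (hp : p = m) (α : DForm G m M p)
    {y : EuclideanSpace ℝ (Fin m)} (hy : y ∈ (extChartAt (𝓡 m) c).target)
    (hy' : (extChartAt (𝓡 m) c).symm y ∈ (extChartAt (𝓡 m) c').source) :
    orientSign o c y • α.rep c y (fun i ↦ EuclideanSpace.single (Fin.cast hp i) (1 : ℝ)) =
      |(fderiv ℝ (chTr c c') y).det| • orientSign o c' (chTr c c' y) •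
        α.rep c' (chTr c c' y) (fun i ↦ EuclideanSpace.single (Fin.cast hp i) (1 : ℝ)) := by
  subst hp
  have h1 := o.rep_apply_eq_det hy hy'
  have h2 := α.rep_apply_eq_det hy hy'
  simp only [Fin.cast_refl, id_eq]
  rw [h2, orientSign, h1, orientSign, smul_eq_mul, sign_mul, SignType.coe_mul, smul_smul, smul_smul,
    mul_right_comm, sign_mul_self]

/-- The contribution of the preferred chart at `c` to the integral of a form. -/
def chartIntegral (o : DForm ℝ m M m) (hp : p = m) (c : M) (α : DForm G m M p) : G :=
  ∫ y in (extChartAt (𝓡 m) c).target, orientSign o c y •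
    α.rep c y fun i ↦ EuclideanSpace.single (Fin.cast hp i) (1 : ℝ)

lemma integral_eq_finsum (o : DForm ℝ m M m) (ρ : SmoothPartitionOfUnity M (𝓡 m) M univ)
    (hp : p = m) (α : DForm G m M p) :
    integral o ρ hp α = ∑ᶠ c, chartIntegral o hp c (DForm.mulFun (ρ c) α) := by
  refine finsum_congr fun c ↦ ?_
  rw [chartIntegral]
  congr 1
  funext y
  rw [mul_comm, mul_smul]
  rfl

/-- Change of variables between two charts. -/
lemma chartIntegral_congr_chart (o : DForm ℝ m M m) (hp : p = m) {α : DForm G m M p}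
    (hα : ∀ x, α x ≠ 0 → x ∈ (extChartAt (𝓡 m) c).source ∩ (extChartAt (𝓡 m) c').source) :
    chartIntegral o hp c α = chartIntegral o hp c' α := by
  set S : M → M → Set (EuclideanSpace ℝ (Fin m)) := fun a b ↦
    (extChartAt (𝓡 m) a).target ∩ (extChartAt (𝓡 m) a).symm ⁻¹' (extChartAt (𝓡 m) b).source with hS
  -- The form vanishes off the overlap of the chart domains, so both integrals live on the images of
  -- the overlap, which the transition map identifies.
  have hrestr : ∀ a b : M, (∀ x, α x ≠ 0 → x ∈ (extChartAt (𝓡 m) b).source) →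
      chartIntegral o hp a α = ∫ y in S a b, orientSign o a y •
        α.rep a y fun i ↦ EuclideanSpace.single (Fin.cast hp i) (1 : ℝ) := by
    intro a b hb
    refine (setIntegral_eq_of_subset_of_forall_sdiff_eq_zero (isOpen_target a).measurableSet
      inter_subset_left fun y hy ↦ ?_)
    have h0 : α ((extChartAt (𝓡 m) a).symm y) = 0 := by
      by_contra h
      exact hy.2 ⟨hy.1, hb _ h⟩
    rw [DForm.rep, h0]
    exact smul_zero _
  rw [hrestr c c' fun x hx ↦ (hα x hx).2, hrestr c' c fun x hx ↦ (hα x hx).1]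
  have himg : S c' c = chTr c c' '' S c c' := by
    ext y
    constructor
    · intro hy
      refine ⟨chTr c' c y, ⟨chTr_mem_target hy.2, ?_⟩, chTr_symm_apply hy.1 hy.2⟩
      rw [mem_preimage, symm_chTr hy.2]
      exact (extChartAt (𝓡 m) c').map_target hy.1
    · rintro ⟨z, hz, rfl⟩
      refine ⟨chTr_mem_target hz.2, ?_⟩
      rw [mem_preimage, symm_chTr hz.2]
      exact (extChartAt (𝓡 m) c).map_target hz.1
  have hmeas : MeasurableSet (S c c') := (isOpen_inter_preimage c (isOpen_source c')).measurableSet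
  rw [himg, integral_image_eq_integral_abs_det_fderiv_smul volume hmeas
    (f' := fun y ↦ fderiv ℝ (chTr c c') y) (fun y hy ↦
      ((contDiffAt_chTr hy.1 hy.2).differentiableAt (by simp)).hasFDerivAt.hasFDerivWithinAt)
    (fun y hy z hz h ↦ by
      rw [← chTr_symm_apply hy.1 hy.2, h, chTr_symm_apply hz.1 hz.2])]
  exact setIntegral_congr_fun hmeas fun y hy ↦ orientSign_smul_rep o hp α hy.1 hy.2

end Integration

/-! ### Stokes' theorem -/

section Stokes

variable {G : Type*} [NormedAddCommGroup G] [NormedSpace ℝ G] {m p : ℕ} {M : Type*}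
  [TopologicalSpace M] [ChartedSpace (EuclideanSpace ℝ (Fin m)) M] {c : M}

/-- Forms whose support is contained in the domain of the preferred chart at `c`. -/
def DForm.SupportedIn (α : DForm G m M p) (c : M) : Prop :=
  ∃ K : Set M, IsClosed K ∧ K ⊆ (extChartAt (𝓡 m) c).source ∧ ∀ x ∉ K, α x = 0

lemma DForm.SupportedIn.mulFun {α : DForm G m M p} (hα : α.SupportedIn c) (h : M → ℝ) :
    (DForm.mulFun h α).SupportedIn c := by
  obtain ⟨K, h1, h2, h3⟩ := hα
  exact ⟨K, h1, h2, fun x hx ↦ by rw [DForm.mulFun, h3 x hx, smul_zero]⟩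

lemma supportedIn_mulFun {h : M → ℝ} (hh : tsupport h ⊆ (extChartAt (𝓡 m) c).source)
    (α : DForm G m M p) : (DForm.mulFun h α).SupportedIn c :=
  ⟨tsupport h, isClosed_tsupport h, hh, fun x hx ↦ by
    rw [DForm.mulFun, image_eq_zero_of_notMem_tsupport hx, zero_smul]⟩

lemma DForm.SupportedIn.mem_source {α : DForm G m M p} (hα : α.SupportedIn c) {x : M}
    (hx : α x ≠ 0) : x ∈ (extChartAt (𝓡 m) c).source := by
  obtain ⟨K, -, h2, h3⟩ := hα
  exact h2 (by_contra fun h ↦ hx (h3 x h))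

lemma DForm.SupportedIn.d {α : DForm G m M p} (hα : α.SupportedIn c) : α.d.SupportedIn c := by
  obtain ⟨K, h1, h2, h3⟩ := hα
  refine ⟨K, h1, h2, fun x hx ↦ ?_⟩
  have h4 : α.rep x =ᶠ[𝓝 (extChartAt (𝓡 m) x x)] fun _ ↦ 0 := by
    have h5 : ∀ᶠ y in 𝓝 ((extChartAt (𝓡 m) x).symm (extChartAt (𝓡 m) x x)), y ∉ K := by
      rw [extChartAt_to_inv]
      exact h1.isOpen_compl.mem_nhds hx
    filter_upwards [(continuousAt_extChartAt_symm x).eventually h5] with z hz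
    rw [DForm.rep, h3 _ hz]
    rfl
  rw [DForm.d, h4.extDeriv_eq]
  have h6 : extDeriv (fun _ : EuclideanSpace ℝ (Fin m) ↦
      (0 : EuclideanSpace ℝ (Fin m) [⋀^Fin p]→L[ℝ] G)) (extChartAt (𝓡 m) x x) = 0 := by
    ext v
    rw [extDeriv_apply (differentiableAt_const _)]
    simp
  rw [h6]
  rfl

/-- The coefficient of a form in the preferred chart at `c`, with the sign of the orientation,
extended by zero. -/
def orientCoef (o : DForm ℝ m M m) (c : M) (α : DForm G m M p)
    (w : Fin p → EuclideanSpace ℝ (Fin m)) : EuclideanSpace ℝ (Fin m) → G :=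
  (extChartAt (𝓡 m) c).target.indicator fun y ↦ orientSign o c y • α.rep c y w

lemma chartIntegral_eq_integral_orientCoef (o : DForm ℝ m M m) (hp : p = m) (α : DForm G m M p) :
    chartIntegral o hp c α =
      ∫ y, orientCoef o c α (fun i ↦ EuclideanSpace.single (Fin.cast hp i) (1 : ℝ)) y :=
  (integral_indicator (isOpen_target c).measurableSet).symm

variable [CompactSpace M]

/-- A closed subset of the compact `M` is compact, and so is its image under the chart. -/
lemma DForm.SupportedIn.exists_isCompact {α : DForm G m M p} (hα : α.SupportedIn c)
    (o : DForm ℝ m M m) : ∃ K : Set (EuclideanSpace ℝ (Fin m)), IsCompact K ∧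
      K ⊆ (extChartAt (𝓡 m) c).target ∧ ∀ w, ∀ y ∉ K, orientCoef o c α w y = 0 := by
  obtain ⟨K, h1, h2, h3⟩ := hα
  refine ⟨extChartAt (𝓡 m) c '' K, h1.isCompact.image_of_continuousOn
    ((continuousOn_extChartAt c).mono h2), ?_, fun w y hy ↦ ?_⟩
  · rintro _ ⟨x, hx, rfl⟩
    exact (extChartAt (𝓡 m) c).map_source (h2 hx)
  · by_cases hy' : y ∈ (extChartAt (𝓡 m) c).target
    · have h4 : (extChartAt (𝓡 m) c).symm y ∉ K := fun h ↦
        hy ⟨_, h, (extChartAt (𝓡 m) c).right_inv hy'⟩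
      rw [orientCoef, indicator_of_mem hy', DForm.rep, h3 _ h4]
      exact smul_zero _
    · exact indicator_of_notMem hy' _

lemma DForm.SupportedIn.hasCompactSupport {α : DForm G m M p} (hα : α.SupportedIn c)
    (o : DForm ℝ m M m) (w : Fin p → EuclideanSpace ℝ (Fin m)) :
    HasCompactSupport (orientCoef o c α w) := by
  obtain ⟨K, h1, -, h3⟩ := hα.exists_isCompact o
  exact HasCompactSupport.intro h1 fun y hy ↦ h3 w y hy

variable [IsManifold (𝓡 m) ∞ M] {o : DForm ℝ m M m}

lemma orientCoef_eventuallyEq (hs : o.IsSmooth) (ho : ∀ x, o x ≠ 0) (α : DForm G m M p)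
    (w : Fin p → EuclideanSpace ℝ (Fin m)) {y : EuclideanSpace ℝ (Fin m)}
    (hy : y ∈ (extChartAt (𝓡 m) c).target) :
    orientCoef o c α w =ᶠ[𝓝 y] fun y' ↦ orientSign o c y • α.rep c y' w := by
  filter_upwards [eventually_orientSign_eq hs ho hy, (isOpen_target c).mem_nhds hy] with y' h1 h2
  rw [orientCoef, indicator_of_mem h2, h1]

lemma DForm.SupportedIn.orientCoef_eventuallyEq_zero {α : DForm G m M p} (hα : α.SupportedIn c)
    (w : Fin p → EuclideanSpace ℝ (Fin m)) {y : EuclideanSpace ℝ (Fin m)}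
    (hy : y ∉ (extChartAt (𝓡 m) c).target) : orientCoef o c α w =ᶠ[𝓝 y] fun _ ↦ 0 := by
  obtain ⟨K, h1, h2, h3⟩ := hα.exists_isCompact o
  filter_upwards [h1.isClosed.isOpen_compl.mem_nhds fun h ↦ hy (h2 h)] with y' hy'
  exact h3 w y' hy'

lemma DForm.IsSmooth.contDiffAt_rep_apply {α : DForm G m M p} (hα : α.IsSmooth)
    (w : Fin p → EuclideanSpace ℝ (Fin m)) {y : EuclideanSpace ℝ (Fin m)}
    (hy : y ∈ (extChartAt (𝓡 m) c).target) : ContDiffAt ℝ ∞ (fun y ↦ α.rep c y w) y :=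
  (ContinuousAlternatingMap.apply ℝ _ G w).contDiff.contDiffAt.comp y
    ((hα c).contDiffAt ((isOpen_target c).mem_nhds hy))

/-- Extension by zero is smooth: inside the chart target the sign is locally constant, and outside
it the coefficient vanishes near every point because its support is compact in the target. -/
lemma DForm.SupportedIn.contDiff (hs : o.IsSmooth) (ho : ∀ x, o x ≠ 0) {α : DForm G m M p}
    (hα : α.SupportedIn c) (hα' : α.IsSmooth) (w : Fin p → EuclideanSpace ℝ (Fin m)) :
    ContDiff ℝ ∞ (orientCoef o c α w) := by
  refine contDiff_iff_contDiffAt.2 fun y ↦ ?_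
  by_cases hy : y ∈ (extChartAt (𝓡 m) c).target
  · exact (contDiffAt_const.smul (hα'.contDiffAt_rep_apply w hy)).congr_of_eventuallyEq
      (orientCoef_eventuallyEq hs ho α w hy)
  · exact contDiffAt_const.congr_of_eventuallyEq (hα.orientCoef_eventuallyEq_zero w hy)

lemma DForm.SupportedIn.integrable (hs : o.IsSmooth) (ho : ∀ x, o x ≠ 0) {α : DForm G m M p}
    (hα : α.SupportedIn c) (hα' : α.IsSmooth) (w : Fin p → EuclideanSpace ℝ (Fin m)) :
    Integrable (orientCoef o c α w) :=
  (hα.contDiff hs ho hα' w).continuous.integrable_of_hasCompactSupport (hα.hasCompactSupport o w)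

/-- Stokes' theorem for forms supported in the domain of a chart. -/
lemma chartIntegral_d (hs : o.IsSmooth) (ho : ∀ x, o x ≠ 0) (hp : p + 1 = m) {η : DForm G m M p}
    (hη : η.SupportedIn c) (hη' : η.IsSmooth) : chartIntegral o hp c η.d = 0 := by
  set e : Fin (p + 1) → EuclideanSpace ℝ (Fin m) :=
    fun i ↦ EuclideanSpace.single (Fin.cast hp i) (1 : ℝ) with he
  -- With the sign locally constant, the coefficient of `dη` is an alternating sum of partial
  -- derivatives of compactly supported smooth functions, each of integral zero.
  have h1 : orientCoef o c η.d e = fun y ↦ ∑ i : Fin (p + 1), (-1 : ℝ) ^ i.val •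
      fderiv ℝ (orientCoef o c η (i.removeNth e)) y (e i) := by
    funext y
    by_cases hy : y ∈ (extChartAt (𝓡 m) c).target
    · rw [orientCoef, indicator_of_mem hy, η.rep_d hη' hy, extDeriv_apply
        (((hη' c).contDiffAt ((isOpen_target c).mem_nhds hy)).differentiableAt (by simp)),
        Finset.smul_sum]
      refine Finset.sum_congr rfl fun i _ ↦ ?_
      rw [(orientCoef_eventuallyEq hs ho η _ hy).fderiv_eq, fderiv_fun_const_smul
        ((hη'.contDiffAt_rep_apply _ hy).differentiableAt (by simp)), smul_apply]
      rcases Nat.even_or_odd i.val with h | h <;> simp [h.neg_one_pow]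
    · rw [orientCoef, indicator_of_notMem hy]
      refine (Finset.sum_eq_zero fun i _ ↦ ?_).symm
      rw [(hη.orientCoef_eventuallyEq_zero _ hy).fderiv_eq]
      simp
  rw [chartIntegral_eq_integral_orientCoef, h1, integral_finsetSum]
  · refine Finset.sum_eq_zero fun i _ ↦ ?_
    rw [integral_smul, integral_fderiv_eq_zero volume ((hη.contDiff hs ho hη' _).of_le (by simp))
      (hη.hasCompactSupport o _), smul_zero]
  · intro i _
    refine Integrable.smul _ ?_
    exact (((hη.contDiff hs ho hη' _).continuous_fderiv (by simp)).clm_apply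
      continuous_const).integrable_of_hasCompactSupport ((hη.hasCompactSupport o _).fderiv_apply ℝ _)

lemma chartIntegral_sum (hs : o.IsSmooth) (ho : ∀ x, o x ≠ 0) (hp : p = m) {ι : Type*}
    (s : Finset ι) {α : ι → DForm G m M p} (h : ∀ i ∈ s, (α i).SupportedIn c)
    (h' : ∀ i ∈ s, (α i).IsSmooth) :
    chartIntegral o hp c (∑ i ∈ s, α i) = ∑ i ∈ s, chartIntegral o hp c (α i) := by
  simp only [chartIntegral_eq_integral_orientCoef]
  rw [← integral_finsetSum s fun i hi ↦ (h i hi).integrable hs ho (h' i hi) _]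
  congr 1
  funext y
  by_cases hy : y ∈ (extChartAt (𝓡 m) c).target
  · simp only [orientCoef, indicator_of_mem hy]
    rw [← Finset.smul_sum, DForm.rep, Finset.sum_apply]
    refine congrArg _ ((ContinuousAlternatingMap.sum_apply _ _).trans rfl)
  · simp only [orientCoef, indicator_of_notMem hy, Finset.sum_const_zero]

lemma chartIntegral_smul (o : DForm ℝ m M m) (hp : p = m) (r : ℝ) (α : DForm G m M p) :
    chartIntegral o hp c (r • α) = r • chartIntegral o hp c α := by
  rw [chartIntegral, chartIntegral, ← integral_smul]
  congr 1
  funext y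
  rw [DForm.rep_smul, smul_comm]
  rfl

section Global

variable {ρ : SmoothPartitionOfUnity M (𝓡 m) M univ}

lemma finite_setOf_ne_zero (ρ : SmoothPartitionOfUnity M (𝓡 m) M univ) :
    {c | (ρ c : M → ℝ) ≠ 0}.Finite := by
  refine ρ.locallyFinite.finite_nonempty_of_compact.subset fun c hc ↦ ?_
  obtain ⟨x, hx⟩ := Function.ne_iff.1 hc
  exact ⟨x, hx⟩

/-- The finite set of indices of the nonzero functions of a partition of unity. -/
def indexFinset (ρ : SmoothPartitionOfUnity M (𝓡 m) M univ) : Finset M :=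
  (finite_setOf_ne_zero ρ).toFinset

lemma sum_mulFun (ρ : SmoothPartitionOfUnity M (𝓡 m) M univ) (α : DForm G m M p) :
    ∑ c ∈ indexFinset ρ, DForm.mulFun (ρ c) α = α := by
  funext x
  rw [Finset.sum_apply]
  simp only [DForm.mulFun]
  rw [← Finset.sum_smul, ρ.sum_finsupport' x (mem_univ x) (fun c hc ↦ ?_), one_smul]
  rw [indexFinset, Finite.mem_toFinset]
  intro h
  exact (ρ.mem_finsupport x).1 hc (congr_fun h x)

lemma integral_eq_sum (o : DForm ℝ m M m) (ρ : SmoothPartitionOfUnity M (𝓡 m) M univ)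
    (hp : p = m) (α : DForm G m M p) : integral o ρ hp α =
      ∑ c ∈ indexFinset ρ, chartIntegral o hp c (DForm.mulFun (ρ c) α) := by
  rw [integral_eq_finsum]
  refine finsum_eq_sum_of_support_subset _ fun c hc ↦ ?_
  rw [indexFinset, Finite.coe_toFinset]
  intro h
  refine hc ?_
  have h0 : DForm.mulFun (ρ c) α = (0 : ℝ) • α := by
    rw [h]
    rfl
  exact (congrArg _ h0).trans (by rw [chartIntegral_smul, zero_smul])

lemma integral_sum (hs : o.IsSmooth) (ho : ∀ x, o x ≠ 0)
    (hρ : ρ.IsSubordinate (fun x ↦ (chartAt (EuclideanSpace ℝ (Fin m)) x).source))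
    (hp : p = m) {ι : Type*} (s : Finset ι) {α : ι → DForm G m M p}
    (h : ∀ i ∈ s, (α i).IsSmooth) :
    integral o ρ hp (∑ i ∈ s, α i) = ∑ i ∈ s, integral o ρ hp (α i) := by
  simp only [integral_eq_sum]
  rw [Finset.sum_comm]
  refine Finset.sum_congr rfl fun c _ ↦ ?_
  rw [← chartIntegral_sum hs ho hp s (fun i _ ↦ supportedIn_mulFun
    (by rw [extChartAt_source]; exact hρ c) (α i)) fun i hi ↦ (h i hi).mulFun (ρ c).contMDiff]
  congr 1
  funext x
  rw [DForm.mulFun, Finset.sum_apply, Finset.sum_apply, Finset.smul_sum]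
  rfl

lemma integral_add_form (hs : o.IsSmooth) (ho : ∀ x, o x ≠ 0)
    (hρ : ρ.IsSubordinate (fun x ↦ (chartAt (EuclideanSpace ℝ (Fin m)) x).source))
    (hp : p = m) {α β : DForm G m M p} (hα : α.IsSmooth) (hβ : β.IsSmooth) :
    integral o ρ hp (α + β) = integral o ρ hp α + integral o ρ hp β := by
  have h := integral_sum hs ho hρ hp (Finset.univ : Finset (Fin 2)) (α := ![α, β])
    (fun i _ ↦ by fin_cases i <;> assumption)
  simpa [Fin.sum_univ_two] using h

/-- Stokes' theorem on a compact manifold without boundary. -/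
theorem integral_d (hs : o.IsSmooth) (ho : ∀ x, o x ≠ 0)
    (hρ : ρ.IsSubordinate (fun x ↦ (chartAt (EuclideanSpace ℝ (Fin m)) x).source))
    (hp : p + 1 = m) {η : DForm G m M p} (hη : η.IsSmooth) : integral o ρ hp η.d = 0 := by
  have hsub : ∀ c, tsupport (ρ c) ⊆ (extChartAt (𝓡 m) c).source := fun c ↦ by
    rw [extChartAt_source]; exact hρ c
  have hsm : ∀ c, (DForm.mulFun (ρ c) η).IsSmooth := fun c ↦ hη.mulFun (ρ c).contMDiff
  -- Decomposing `η` rather than `dη` makes each summand the differential of a form supported in a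
  -- single chart domain.
  conv_lhs => rw [← sum_mulFun ρ η, DForm.d_sum _ fun c _ ↦ hsm c]
  rw [integral_sum hs ho hρ hp _ fun c _ ↦ (hsm c).d]
  refine Finset.sum_eq_zero fun c' _ ↦ ?_
  set β := (DForm.mulFun (ρ c') η).d with hβ
  have hβs : β.SupportedIn c' := (supportedIn_mulFun (hsub c') η).d
  -- Every piece `ρ_c β` is moved to the chart at `c'`, which contains the support of `β`. There the
  -- pieces reassemble to `β`, and Stokes' theorem in one chart applies.
  rw [integral_eq_sum, Finset.sum_congr rfl fun c _ ↦ chartIntegral_congr_chart (c' := c') o hp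
      fun x hx ↦ ⟨(supportedIn_mulFun (hsub c) β).mem_source hx, (hβs.mulFun (ρ c)).mem_source hx⟩,
    ← chartIntegral_sum hs ho hp _ (fun c _ ↦ hβs.mulFun (ρ c))
      (fun c _ ↦ (hsm c').d.mulFun (ρ c).contMDiff), sum_mulFun]
  exact chartIntegral_d hs ho hp (supportedIn_mulFun (hsub c') η) (hsm c')

/-- The integrals of cohomologous forms agree. -/
lemma integral_eq_of_sub_mem_exactForms (hs : o.IsSmooth) (ho : ∀ x, o x ≠ 0)
    (hρ : ρ.IsSubordinate (fun x ↦ (chartAt (EuclideanSpace ℝ (Fin m)) x).source))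
    (hp : p = m) {α β : DForm G m M p} (hα : α.IsSmooth) (h : β - α ∈ exactForms G m M p) :
    integral o ρ hp β = integral o ρ hp α := by
  cases p with
  | zero => rw [sub_eq_zero.1 ((Submodule.mem_bot ℝ).1 h)]
  | succ p =>
    obtain ⟨η, hη, hd⟩ := h
    rw [← sub_add_cancel β α, hd, integral_add_form hs ho hρ hp hη.d hα, integral_d hs ho hρ hp hη,
      zero_add]

end Global

end Stokes

end ChernForms

end

/-! ### Chern forms, Chern classes and the first variation -/

theorem mainTheorem7 {𝕜 : Type*} [RCLike 𝕜] {m : ℕ}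
    {M : Type*} [TopologicalSpace M] [T2Space M] [SecondCountableTopology M]
    [ChartedSpace (EuclideanSpace ℝ (Fin m)) M] [IsManifold (𝓡 m) ∞ M]
    {F : Type*} [NormedAddCommGroup F] [NormedSpace ℝ F] [NormedSpace 𝕜 F]
    [IsScalarTower ℝ 𝕜 F] [FiniteDimensional 𝕜 F]
    {V : M → Type*} [TopologicalSpace (TotalSpace F V)]
    [∀ x, AddCommGroup (V x)] [∀ x, Module ℝ (V x)] [∀ x, Module 𝕜 (V x)]
    [∀ x, IsScalarTower ℝ 𝕜 (V x)] [∀ x, TopologicalSpace (V x)]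
    [∀ x, IsTopologicalAddGroup (V x)] [∀ x, ContinuousSMul ℝ (V x)]
    [FiberBundle F V] [VectorBundle ℝ F V] [VectorBundle 𝕜 F V]
    [ContMDiffVectorBundle ∞ F V (𝓡 m)] :
    -- `tr (D λ) = d (tr λ)`
    (∀ D : ChernForms.Connection 𝕜 m F V, D.IsSmooth →
      ∀ (p : ℕ) (lam : ChernForms.EndForm 𝕜 m V p), lam.IsSmooth F →
        lam.tr.IsSmooth ∧ (D.extD F lam).tr = lam.tr.d) ∧
    -- the Chern forms are smooth and closed
    (∀ D : ChernForms.Connection 𝕜 m F V, D.IsSmooth →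
      ∀ k : ℕ, D.chernForm F k ∈ ChernForms.closedForms 𝕜 m M (2 * k)) ∧
    -- changing the connection changes the Chern forms by exact forms
    (∀ D D' : ChernForms.Connection 𝕜 m F V, D.IsSmooth → D'.IsSmooth →
      ∀ k : ℕ, D'.chernForm F k - D.chernForm F k ∈ ChernForms.exactForms 𝕜 m M (2 * k)) ∧
    -- the Chern class `c_k(V)`: the class of `tr (Ωᵏ)` for every connection
    (∀ k : ℕ, ∃! c : ChernForms.DeRham 𝕜 m M (2 * k),
      ∀ D : ChernForms.Connection 𝕜 m F V, D.IsSmooth →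
        ∃ h : D.chernForm F k ∈ ChernForms.closedForms 𝕜 m M (2 * k),
          Submodule.Quotient.mk ⟨D.chernForm F k, h⟩ = c) ∧
    -- `d/dt tr (Ωⁿ) = n tr (Ωⁿ⁻¹ ∧ Dγ) = n d tr (Ωⁿ⁻¹ ∧ γ)` at `t = 0`, with `n = k + 1`
    (∀ D : ChernForms.Connection 𝕜 m F V, D.IsSmooth →
      ∀ γ : ChernForms.EndForm 𝕜 m V 1, γ.IsSmooth F → ∀ k : ℕ,
        (∀ (x : M) (v : Fin (2 * (k + 1)) → EuclideanSpace ℝ (Fin m)),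
          HasDerivAt (fun t : ℝ ↦ (D.addForm F (t • γ)).chernForm F (k + 1) x v)
            ((k + 1 : ℕ) • (((D.curvature F).pow k).wedge (D.extD F γ)).tr x v) 0) ∧
        (((D.curvature F).pow k).wedge (D.extD F γ)).tr =
          (((D.curvature F).pow k).wedge γ).tr.d) ∧
    -- the first variation of `∫ tr (Ωⁿ)` over a compact oriented manifold of dimension `2n`
    (CompactSpace M → ∀ o : ChernForms.DForm ℝ m M m, o.IsSmooth → (∀ x, o x ≠ 0) →
      ∀ ρ : SmoothPartitionOfUnity M (𝓡 m) M Set.univ,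
        ρ.IsSubordinate (fun x ↦ (chartAt (EuclideanSpace ℝ (Fin m)) x).source) →
      ∀ D : ChernForms.Connection 𝕜 m F V, D.IsSmooth →
      ∀ γ : ChernForms.EndForm 𝕜 m V 1, γ.IsSmooth F →
        (∀ (n : ℕ) (h : 2 * n = m),
          HasDerivAt (fun t : ℝ ↦
            ChernForms.integral o ρ h ((D.addForm F (t • γ)).chernForm F n)) 0 0) ∧
        (∀ (k : ℕ) (h : 2 * (k + 1) = m),
          HasDerivAt (fun t : ℝ ↦
              ChernForms.integral o ρ h ((D.addForm F (t • γ)).chernForm F (k + 1)))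
            ((k + 1 : ℕ) • ChernForms.integral o ρ h
              (((D.curvature F).pow k).wedge (D.extD F γ)).tr) 0 ∧
          ChernForms.integral o ρ h (((D.curvature F).pow k).wedge (D.extD F γ)).tr =
            ChernForms.integral o ρ h (((D.curvature F).pow k).wedge γ).tr.d ∧
          ChernForms.integral o ρ h (((D.curvature F).pow k).wedge γ).tr.d = 0)) := by
  refine ⟨fun D hD p lam h ↦ ⟨h.tr F, D.tr_extD F h⟩,
    fun D hD k ↦ hD.chernForm_mem_closedForms F k,
    fun D D' hD hD' k ↦ hD.chernForm_sub_mem_exactForms F hD' k, fun k ↦ ?_,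
    fun D hD γ hγ k ↦ ⟨hD.hasDerivAt_chernForm F hγ k, hD.tr_pow_wedge_extD F k hγ⟩, ?_⟩
  -- One smooth connection supplies the class and also forces uniqueness: if there were none, every
  -- class would satisfy the condition vacuously.
  · obtain ⟨D, hD⟩ := ChernForms.exists_isSmooth_connection (𝕜 := 𝕜) (m := m) F (V := V)
    refine ⟨Submodule.Quotient.mk ⟨_, hD.chernForm_mem_closedForms F k⟩,
      fun D' hD' ↦ ⟨hD'.chernForm_mem_closedForms F k, ?_⟩, fun c hc ↦ ?_⟩
    · exact (Submodule.Quotient.eq _).2 (hD.chernForm_sub_mem_exactForms F hD' k)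
    · obtain ⟨_, h⟩ := hc D hD
      exact h.symm
  · intro _ o hs ho ρ hρ D hD γ hγ
    -- The Chern forms of `∇ + tγ` and `∇` are cohomologous, so the integral does not depend on `t`.
    -- The derivative is therefore zero, and the asserted formula holds because its right side is
    -- also zero by Stokes' theorem.
    have hconst : ∀ (n : ℕ) (h : 2 * n = m), (fun t : ℝ ↦ ChernForms.integral o ρ h
        ((D.addForm F (t • γ)).chernForm F n)) =
          fun _ ↦ ChernForms.integral o ρ h (D.chernForm F n) := fun n h ↦ funext fun t ↦
      ChernForms.integral_eq_of_sub_mem_exactForms hs ho hρ h (hD.chernForm_mem_closedForms F n).1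
        (hD.chernForm_sub_mem_exactForms F (hD.addForm F (hγ.smul F t)) n)
    have h0 : ∀ (k : ℕ) (h : 2 * (k + 1) = m),
        ChernForms.integral o ρ h (((D.curvature F).pow k).wedge γ).tr.d = 0 := fun k h ↦
      ChernForms.integral_d hs ho hρ h ((((hD.curvature F).pow F k).wedge F hγ).tr F)
    refine ⟨fun n h ↦ ?_, fun k h ↦ ⟨?_, ?_, h0 k h⟩⟩
    · rw [hconst]
      exact hasDerivAt_const _ _
    · rw [hconst, hD.tr_pow_wedge_extD F k hγ, h0, smul_zero]
      exact hasDerivAt_const _ _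
    · rw [hD.tr_pow_wedge_extD F k hγ]
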